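/- **Setting.** Write $e(t)=e^{2\pi i t}$. Let $P=(P_1,\dots,P_n)$, $P_i\in\mathbb Z[t_1,\dots,t_d]$, $P(t)=\sum_\alpha c_\alpha t^\alpha$ with $c_\alpha\in\mathbb Z^n$, $D_i=\deg P_i$. $P$ is *admissible* if $P(0)=0$; there are $\beta,L_0>0$ with $|P(t)|\ge|t|^\beta$ for all $t\in\mathbb R^d$ with $|t|\ge L_0$; and for each $i$ there is a multiindex $\alpha^{(i)}$ with $|\alpha^{(i)}|=\deg P_i$ such that $c_{\alpha^{(i)}}$ is the $i$-th unit vector. A (normalized) *Calderón–Zygmund kernel* is a function $K:\mathbb R^d\to\mathbb C$, differentiable at every $y$ with $|y|\ge1$, such that $|y|^d|K(y)|+|y|^{d+1}|\nabla K(y)|\le1$ for $|y|\ge1$ and $\sup_{\lambda\ge1}\big|\int_{1\le|y|\le\lambda}K(y)\,dy\big|\le1$. Let $\psi:\mathbb R^d\to[0,1]$ be smooth, supported in $\{\frac12\le|x|\le2\}$, with $\sum_{j\in\mathbb Z}\psi(2^{-j}x)=1$ for $x\ne0$, and let $\chi:\mathbb R^n\to\mathbb C$ be smooth, supported in $\{|\xi|\le2\}$,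 with $\chi=1$ on $\{|\xi|\le1\}$. For $j\ge1$ put $K_j(x)=\psi(2^{-j}x)K(x)$ and $$m_j(\xi)=\sum_{y\in\mathbb Z^d}e(P(y)\cdot\xi)K_j(y),\qquad \Phi_j(\xi)=\int_{\mathbb R^d}e(P(t)\cdot\xi)K_j(t)\,dt .$$ For $q\ge1$ and $a\in\mathbb Z^n$ with $\gcd(a_1,\dots,a_n,q)=1$ let $S(a/q)=q^{-d}\sum_{r\in\{0,\dots,q-1\}^d}e(P(r)\cdot a/q)$, and for $k\ge1$ let $\mathcal R_k$ be the set of $a/q\in[0,1)^n$ with $\gcd(a_1,\dots,a_n,q)=1$ and $2^{k-1}\le q<2^k$. Fix $\delta'\in(0,\frac1{1000})$ and let $$L_{j,k}(\xi)=\sum_{a/q\in\mathcal R_k}S(a/q)\sum_{l\in\mathbb Z^n}\Phi_j\big(\xi-\tfrac aq+l\big)\,\chi\big(2^{10k}(\xi-\tfrac aq+l)\big),\qquad L_j=\sum_{1\le k\le\delta' j}L_{j,k},\qquad E_j=m_j-L_j .$$ For a bounded $\mathbb Z^n$-periodic $m$ and finitely supported $f:\mathbb Z^n\to\mathbb C$,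 with $\widehat f(\xi)=\sum_xf(x)e(-\xi\cdot x)$, let $m(\nabla)f(x)=\int_{[0,1]^n}m(\xi)\widehat f(\xi)e(\xi\cdot x)\,d\xi$. A *$P$-cube* is a set $Q=\mathbb Z^n\cap(I_1\times\dots\times I_n)$ with bounded intervals $I_i$ of positive length such that $|I_1|^{1/D_1}=\dots=|I_n|^{1/D_n}$. For $\sigma\in(0,1)$ a set $\mathcal S$ of $P$-cubes is *$\sigma$-sparse* if there are pairwise disjoint $E_Q\subset Q$ $(Q\in\mathcal S)$ with $|E_Q|\ge\sigma|Q|$. Put $\langle f\rangle_{Q,r}=\big(|Q|^{-1}\sum_{x\in Q}|f(x)|^r\big)^{1/r}$ and $\Lambda^{\mathcal S}_{r,s}(f,g)=\sum_{Q\in\mathcal S}|Q|\langle f\rangle_{Q,r}\langle g\rangle_{Q,s}\in[0,\infty]$ (empty $Q$ contribute $0$). For a linear operator $T$ from finitely supported functions on $\mathbb Z^n$ to functions on $\mathbb Z^n$, $\|T\|_{\mathrm{sp}(r,s)}\in[0,\infty]$ is the infimum of all $c\in(0,\infty)$ such that $|\langle Tf,g\rangle|\le c\,\sup_{\mathcal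 S}\Lambda^{\mathcal S}_{r,s}(f,g)$ for all finitely supported $f,g$, the supremum being over all $\sigma$-sparse $\mathcal S$ ($\inf\emptyset=\infty$). **Proposition.** Let $P$ be admissible and $\delta'\in(0,\frac1{1000})$. There is $\eta>0$ such that for all $r,s\in[1,\infty)$ with $|\frac1r-\frac12|<\eta$ and $|\frac1s-\frac12|<\eta$ there is $\gamma>0$ with the following property: for all $\sigma\in(0,1)$ and all $\psi,\chi$ as above there is $C>0$ such that for every Calderón–Zygmund kernel $K$ as above $$\|E_j(\nabla)\|_{\mathrm{sp}(r,s)}\le C\,2^{-\gamma j}\qquad\text{for all }j\ge1 .$$ -/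

import Mathlib

open MeasureTheory Set
open scoped ENNReal

namespace DiscreteRadon

/-- The character `e(t) = exp(2 π i t)`. -/
noncomputable def expPhase (t : ℝ) : ℂ :=
  Complex.exp (2 * Real.pi * Complex.I * t)

/-- A lattice point, regarded as a point of Euclidean space. -/
noncomputable def latticePt {m : ℕ} (y : Fin m → ℤ) : EuclideanSpace ℝ (Fin m) :=
  WithLp.toLp 2 (fun i => (y i : ℝ))

/-! ### Polynomial mappings -/

/-- The polynomial mapping `t ↦ P(t) = (P_1(t), …, P_n(t))` from `ℝ^d` to `ℝ^n`. -/
noncomputable def polyMap {d n : ℕ} (P : Fin n → MvPolynomial (Fin d) ℤ)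
    (t : EuclideanSpace ℝ (Fin d)) : EuclideanSpace ℝ (Fin n) :=
  WithLp.toLp 2 (fun i => MvPolynomial.aeval (fun l => t l) (P i))

/-- The phase `P(t) · ξ`. -/
noncomputable def phase {d n : ℕ} (P : Fin n → MvPolynomial (Fin d) ℤ)
    (t : EuclideanSpace ℝ (Fin d)) (ξ : EuclideanSpace ℝ (Fin n)) : ℝ :=
  ∑ i, polyMap P t i * ξ i

/-- The degrees `D_i = deg P_i`. -/
noncomputable def degs {d n : ℕ} (P : Fin n → MvPolynomial (Fin d) ℤ) (i : Fin n) : ℕ :=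
  (P i).totalDegree

/-- Admissible polynomial mappings: integer coefficients, `P(0) = 0`, the lower growth bound
`|P(t)| ≥ |t|^β` for large `t`, and, for each `i`, a multiindex `α` with `|α| = deg P_i` whose
vector coefficient `c_α` is the `i`-th unit vector. -/
structure IsAdmissible {d n : ℕ} (P : Fin n → MvPolynomial (Fin d) ℤ) : Prop where
  zero : ∀ i, MvPolynomial.eval (0 : Fin d → ℤ) (P i) = 0
  growth : ∃ β L₀ : ℝ, 0 < β ∧ 0 < L₀ ∧
    ∀ t : EuclideanSpace ℝ (Fin d), L₀ ≤ ‖t‖ → ‖t‖ ^ β ≤ ‖polyMap P t‖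
  coeff : ∀ i, ∃ α : Fin d →₀ ℕ, α.degree = (P i).totalDegree ∧
    ∀ l, (P l).coeff α = if l = i then 1 else 0

/-! ### Kernels and cutoffs -/

/-- Normalized Calderón–Zygmund kernels. Only the values on `|y| ≥ 1` matter. -/
structure IsCZKernel {d : ℕ} (K : EuclideanSpace ℝ (Fin d) → ℂ) : Prop where
  differentiable : ∀ y, 1 ≤ ‖y‖ → DifferentiableAt ℝ K y
  size : ∀ y, 1 ≤ ‖y‖ → ‖y‖ ^ d * ‖K y‖ + ‖y‖ ^ (d + 1) * ‖fderiv ℝ K y‖ ≤ 1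
  cancel : ∀ R : ℝ, 1 ≤ R → ‖∫ y in {y | 1 ≤ ‖y‖ ∧ ‖y‖ ≤ R}, K y‖ ≤ 1

/-- The dyadic partition of unity: `ψ` is smooth, supported in `1/2 ≤ |x| ≤ 2`, with values in
`[0,1]`, and `∑_{j ∈ ℤ} ψ(2^{-j} x) = 1` for every `x ≠ 0`. -/
structure IsDyadicPartition {d : ℕ} (ψ : EuclideanSpace ℝ (Fin d) → ℝ) : Prop where
  smooth : ContDiff ℝ ((⊤ : ℕ∞) : WithTop ℕ∞) ψ
  supp : ∀ x, ψ x ≠ 0 → 1 / 2 ≤ ‖x‖ ∧ ‖x‖ ≤ 2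
  range : ∀ x, 0 ≤ ψ x ∧ ψ x ≤ 1
  sum_eq : ∀ x, x ≠ 0 → HasSum (fun j : ℤ => ψ ((2 : ℝ) ^ (-j) • x)) 1

/-- The frequency cutoff: `χ` is smooth, supported in `|ξ| ≤ 2` and equal to one on `|ξ| ≤ 1`. -/
structure IsCutoff {n : ℕ} (χ : EuclideanSpace ℝ (Fin n) → ℂ) : Prop where
  smooth : ContDiff ℝ ((⊤ : ℕ∞) : WithTop ℕ∞) χ
  supp : ∀ ξ, χ ξ ≠ 0 → ‖ξ‖ ≤ 2
  one : ∀ ξ, ‖ξ‖ ≤ 1 → χ ξ = 1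

/-- `K_j(x) = ψ(2^{-j} x) K(x)`. -/
noncomputable def Kpiece {d : ℕ} (ψ : EuclideanSpace ℝ (Fin d) → ℝ)
    (K : EuclideanSpace ℝ (Fin d) → ℂ) (j : ℕ) (x : EuclideanSpace ℝ (Fin d)) : ℂ :=
  (ψ (((2 : ℝ) ^ j)⁻¹ • x) : ℂ) * K x

/-! ### The multipliers -/

/-- `Φ_j(ξ) = ∫_{ℝ^d} e(P(t) · ξ) K_j(t) dt`. -/
noncomputable def Phi {d n : ℕ} (P : Fin n → MvPolynomial (Fin d) ℤ)
    (ψ : EuclideanSpace ℝ (Fin d) → ℝ) (K : EuclideanSpace ℝ (Fin d) → ℂ) (j : ℕ)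
    (ξ : EuclideanSpace ℝ (Fin n)) : ℂ :=
  ∫ t : EuclideanSpace ℝ (Fin d), expPhase (phase P t ξ) * Kpiece ψ K j t

/-- `m_j(ξ) = ∑_{y ∈ ℤ^d} e(P(y) · ξ) K_j(y)` (only finitely many terms are non-zero). -/
noncomputable def mMult {d n : ℕ} (P : Fin n → MvPolynomial (Fin d) ℤ)
    (ψ : EuclideanSpace ℝ (Fin d) → ℝ) (K : EuclideanSpace ℝ (Fin d) → ℂ) (j : ℕ)
    (ξ : EuclideanSpace ℝ (Fin n)) : ℂ :=
  ∑' y : Fin d → ℤ, expPhase (phase P (latticePt y) ξ) * Kpiece ψ K j (latticePt y)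

/-- The rational point `a/q` of `ℝ^n`. -/
noncomputable def ratPt {n : ℕ} (a : Fin n → ℕ) (q : ℕ) : EuclideanSpace ℝ (Fin n) :=
  WithLp.toLp 2 (fun i => (a i : ℝ) / (q : ℝ))

/-- The complete exponential sum `S(a/q) = q^{-d} ∑_{r ∈ {0,…,q-1}^d} e(P(r) · a/q)`. -/
noncomputable def gaussS {d n : ℕ} (P : Fin n → MvPolynomial (Fin d) ℤ)
    (a : Fin n → ℕ) (q : ℕ) : ℂ :=
  ((q : ℂ) ^ d)⁻¹ * ∑ r ∈ Fintype.piFinset (fun _ : Fin d => Finset.range q),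
    expPhase (phase P (latticePt (fun l => (r l : ℤ))) (ratPt a q))

/-- The numerators `a ∈ {0,…,q-1}^n` with `gcd(a_1,…,a_n,q) = 1`; the points `a/q` are the
points of `ℚ^n ∩ [0,1)^n` with reduced common denominator `q`. -/
def numerators (n q : ℕ) : Finset (Fin n → ℕ) :=
  (Fintype.piFinset (fun _ : Fin n => Finset.range q)).filter
    (fun a => Nat.gcd (Finset.univ.gcd a) q = 1)

/-- The `ℤ^n`-periodization of a function on `ℝ^n`. -/
noncomputable def periodize {n : ℕ} (g : EuclideanSpace ℝ (Fin n) → ℂ)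
    (ξ : EuclideanSpace ℝ (Fin n)) : ℂ :=
  ∑' l : Fin n → ℤ, g (ξ + latticePt l)

/-- `L_{j,k}(ξ)`: the sum over reduced fractions `a/q ∈ [0,1)^n` with `2^{k-1} ≤ q < 2^k` of
`S(a/q)` times the periodization of `Φ_j χ(2^{10k} ·)` at `ξ - a/q`. As `χ(2^{10k} ·)` is supported
in `|ξ| ≤ 2^{1-10k}`, at most one term of each periodization is non-zero. -/
noncomputable def Lpiece {d n : ℕ} (P : Fin n → MvPolynomial (Fin d) ℤ)
    (ψ : EuclideanSpace ℝ (Fin d) → ℝ) (χ : EuclideanSpace ℝ (Fin n) → ℂ)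
    (K : EuclideanSpace ℝ (Fin d) → ℂ) (j k : ℕ) (ξ : EuclideanSpace ℝ (Fin n)) : ℂ :=
  ∑ q ∈ Finset.Ico (2 ^ (k - 1)) (2 ^ k), ∑ a ∈ numerators n q,
    gaussS P a q *
      periodize (fun η => Phi P ψ K j η * χ ((2 : ℝ) ^ (10 * k) • η)) (ξ - ratPt a q)

/-- `L_j = ∑_{1 ≤ k ≤ δ₁ j} L_{j,k}`; here `δ₁` is the parameter that governs the size of the
denominators. -/
noncomputable def LMult {d n : ℕ} (P : Fin n → MvPolynomial (Fin d) ℤ) (δ₁ : ℝ)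
    (ψ : EuclideanSpace ℝ (Fin d) → ℝ) (χ : EuclideanSpace ℝ (Fin n) → ℂ)
    (K : EuclideanSpace ℝ (Fin d) → ℂ) (j : ℕ) (ξ : EuclideanSpace ℝ (Fin n)) : ℂ :=
  ∑ k ∈ Finset.Icc 1 ⌊(j : ℝ) * δ₁⌋₊, Lpiece P ψ χ K j k ξ

/-- The error multiplier `E_j = m_j - L_j`. -/
noncomputable def EMult {d n : ℕ} (P : Fin n → MvPolynomial (Fin d) ℤ) (δ₁ : ℝ)
    (ψ : EuclideanSpace ℝ (Fin d) → ℝ) (χ : EuclideanSpace ℝ (Fin n) → ℂ)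
    (K : EuclideanSpace ℝ (Fin d) → ℂ) (j : ℕ) (ξ : EuclideanSpace ℝ (Fin n)) : ℂ :=
  mMult P ψ K j ξ - LMult P δ₁ ψ χ K j ξ

/-! ### Fourier multiplier operators on `ℤ^n` -/

/-- The dot product `ξ · x` of a frequency and a lattice point. -/
noncomputable def dotLattice {n : ℕ} (ξ : EuclideanSpace ℝ (Fin n)) (x : Fin n → ℤ) : ℝ :=
  ∑ i, ξ i * (x i : ℝ)

/-- The Fourier transform `∑_x f(x) e(-ξ · x)` of a finitely supported function. -/
noncomputable def latticeFourier {n : ℕ} (f : (Fin n → ℤ) →₀ ℂ)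
    (ξ : EuclideanSpace ℝ (Fin n)) : ℂ :=
  f.sum (fun x c => c * expPhase (-dotLattice ξ x))

/-- The Fourier multiplier operator `m(∇)`: the inverse Fourier transform, that is the integral
over `[0,1]^n` against `e(ξ · x)`, of `m` times the Fourier transform of `f`. -/
noncomputable def multOp {n : ℕ} (m : EuclideanSpace ℝ (Fin n) → ℂ)
    (f : (Fin n → ℤ) →₀ ℂ) (x : Fin n → ℤ) : ℂ :=
  ∫ ξ in {ξ : EuclideanSpace ℝ (Fin n) | ∀ i, ξ i ∈ Set.Icc (0 : ℝ) 1},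
    m ξ * latticeFourier f ξ * expPhase (dotLattice ξ x)

/-! ### Sparse forms -/

/-- `Q = ℤ^n ∩ (I_1 × ⋯ × I_n)` for bounded intervals `I_i` (with or without endpoints) with
`|I_1|^{1/D_1} = ⋯ = |I_n|^{1/D_n}`; the common value is `ℓ`. -/
def IsPCube {n : ℕ} (D : Fin n → ℕ) (Q : Finset (Fin n → ℤ)) : Prop :=
  ∃ (ℓ : ℝ) (I : Fin n → Set ℝ), 0 < ℓ ∧
    (∀ i, (I i).OrdConnected ∧ volume (I i) = ENNReal.ofReal (ℓ ^ D i)) ∧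
    ∀ x : Fin n → ℤ, x ∈ Q ↔ ∀ i, (x i : ℝ) ∈ I i

/-- A `σ`-sparse collection of cubes. -/
def IsSparse {n : ℕ} (D : Fin n → ℕ) (σ : ℝ) (S : Set (Finset (Fin n → ℤ))) : Prop :=
  (∀ Q ∈ S, IsPCube D Q) ∧
    ∃ E : Finset (Fin n → ℤ) → Finset (Fin n → ℤ),
      (∀ Q ∈ S, E Q ⊆ Q ∧ σ * (Q.card : ℝ) ≤ ((E Q).card : ℝ)) ∧ S.PairwiseDisjoint E

/-- The average `⟨f⟩_{Q,r} = (|Q|^{-1} ∑_{x ∈ Q} |f(x)|^r)^{1/r}`. -/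
noncomputable def avg {n : ℕ} (r : ℝ) (Q : Finset (Fin n → ℤ)) (f : (Fin n → ℤ) →₀ ℂ) : ℝ :=
  ((Q.card : ℝ)⁻¹ * ∑ x ∈ Q, ‖f x‖ ^ r) ^ (1 / r)

/-- The sparse form `Λ_{r,s}(f,g) = ∑_{Q ∈ S} |Q| ⟨f⟩_{Q,r} ⟨g⟩_{Q,s}`, as an element of
`[0,∞]`. -/
noncomputable def sparseForm {n : ℕ} (r s : ℝ) (S : Set (Finset (Fin n → ℤ)))
    (f g : (Fin n → ℤ) →₀ ℂ) : ℝ≥0∞ :=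
  ∑' Q : S, ENNReal.ofReal ((Q.1.card : ℝ) * avg r Q.1 f * avg s Q.1 g)

/-- The pairing `⟨F, g⟩ = ∑_x F(x) conj(g(x))` with a finitely supported `g`. -/
noncomputable def pairing {n : ℕ} (F : (Fin n → ℤ) → ℂ) (g : (Fin n → ℤ) →₀ ℂ) : ℂ :=
  g.sum (fun x c => F x * (starRingEnd ℂ) c)

/-- The sparse operator norm `‖T‖_{sp(r,s)}` with sparsity parameter `σ`: the infimum of all
`c ∈ (0,∞)` such that `|⟨T f, g⟩| ≤ c sup_S Λ_{r,s}(f,g)` for all finitely supported `f, g`, with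
the supremum over all `σ`-sparse collections `S`. It is `∞` if there is no such `c`. -/
noncomputable def spNorm {n : ℕ} (D : Fin n → ℕ) (σ r s : ℝ)
    (T : ((Fin n → ℤ) →₀ ℂ) → (Fin n → ℤ) → ℂ) : ℝ≥0∞ :=
  sInf {c : ℝ≥0∞ | c ≠ 0 ∧ c ≠ ∞ ∧ ∀ f g : (Fin n → ℤ) →₀ ℂ,
    ‖pairing (T f) g‖ₑ ≤
      c * ⨆ (S : Set (Finset (Fin n → ℤ))) (_ : IsSparse D σ S), sparseForm r s S f g}

end DiscreteRadon

/-!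
The proof combines exponentially small `L^∞` bounds for the error multiplier with sparse
domination at a single scale.

*The uniform bound.* The pieces `m_j` and `Φ_j` are controlled by the inverse form of Weyl's
inequality: a weighted exponential sum of length `N` that is within a factor `A` of the trivial
bound has all its coefficients within `A ^ C / N ^ k` (`k` the degree of the monomial) of rationals
with one denominator at most `A ^ C`. In one variable this follows from van der Corput differencing
and a recurrence argument for the leading coefficient (`weyl_leading_coeff`). In several variables
one restricts to lines, recovers the coefficients of the leading form by interpolation, absorbs that
form into the weight, and continues with the lower degrees (`weyl_inverse`). Since each
component of `P` has a monomial of top degree that no other component contains, `ξ_i` is itself one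
of these coefficients (`exists_weyl_Kpiece`). The same inequality on the lattices `M⁻¹ ℤ^d`,
uniformly in `M`, yields the decay of `Φ_j` (`exists_Phi_decay`), as `Φ_j` is a limit of Riemann
sums.

If `m_j(ξ)` exceeds `2 ^ (-γ j)`, or if some fraction contributes more than that to `L_j(ξ)`, then
`ξ` is close to a reduced fraction `a/q` with `q` a small power of `2 ^ j`. Close to `a/q` the sum
`m_j` agrees with `S(a/q) Φ_j` up to a negative power of `2 ^ j` (`exists_major_arc_bound`), and the
other fractions are too far away for their contributions to be large. When `γ` is small in terms of
`δ₁`, all relevant denominators occur in `L_j`, so that `|E_j| ≤ C 2 ^ (-γ j)`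
(`norm_EMult_le_of_alternatives`, `exists_norm_EMult_le`).

*Sparse domination.* By Parseval's identity `E_j(∇)` is bounded on `ℓ²` with that small norm
(`norm_pairing_multOp_le`). Its convolution kernel is essentially supported in the anisotropic box
of scale `L = L₀ 2 ^ j`: that of `m_j` vanishes outside of it, and that of `L_j` decays rapidly
there, as the inverse Fourier transform of the cutoff does (`exists_multKernel_EMult_decay`).
The part of the form close to the diagonal therefore splits into `ℓ²` bounds on the `P`-cubes of
scale `L`. These overlap boundedly, so they split into boundedly many disjoint, hence sparse,
families (`sum_l2On_le_sparseSup`). Passing from `L²` averages to `L^r` and `L^s` averages on a cube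
costs a power of its cardinality (`l2On_le_avg`), that is `2 ^ (2 η j ∑ D_i)` up to a constant,
which is less than the gain if `η` is small. The part far from the diagonal is a superposition of
correlations `∑ x, |f(x)| |g(x + z)|`, each of which is dominated by the cubes of scale about
`∑ |z_i|`; the rapid decay of the kernel pays for the size of these cubes
(`enorm_pairing_multOp_le_sparseSup`).
-/

namespace DiscreteRadon

/-! ### The character and distance to the integers -/

lemma expPhase_add (x y : ℝ) : expPhase (x + y) = expPhase x * expPhase y := by
  simp only [expPhase, ← Complex.exp_add]; congr 1; push_cast; ring

lemma expPhase_zero : expPhase 0 = 1 := by simp [expPhase]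

lemma expPhase_eq (x : ℝ) : expPhase x = Complex.exp (Complex.I * ((2 * Real.pi * x : ℝ) : ℂ)) := by
  simp only [expPhase]; congr 1; push_cast; ring

@[simp] lemma norm_expPhase (x : ℝ) : ‖expPhase x‖ = 1 := by
  rw [expPhase_eq, Complex.norm_exp_I_mul_ofReal]

lemma expPhase_int (b : ℤ) : expPhase b = 1 := by
  rw [expPhase, ← Complex.exp_int_mul_two_pi_mul_I b]; congr 1; push_cast; ring

lemma conj_expPhase (x : ℝ) : (starRingEnd ℂ) (expPhase x) = expPhase (-x) := by
  simp only [expPhase, ← Complex.exp_conj]; congr 1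
  simp [Complex.conj_ofNat]

lemma expPhase_add_int (x : ℝ) (b : ℤ) : expPhase (x + b) = expPhase x := by
  rw [expPhase_add, expPhase_int, mul_one]

lemma expPhase_sum {ι : Type*} (s : Finset ι) (f : ι → ℝ) :
    expPhase (∑ i ∈ s, f i) = ∏ i ∈ s, expPhase (f i) := by
  classical
  induction s using Finset.induction_on with
  | empty => simp [expPhase_zero]
  | insert a s ha ih => rw [Finset.sum_insert ha, Finset.prod_insert ha, expPhase_add, ih]

@[fun_prop] lemma continuous_expPhase : Continuous expPhase := by
  unfold expPhase; fun_prop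

lemma norm_expPhase_sub_one_le (x : ℝ) : ‖expPhase x - 1‖ ≤ 7 * |x| := by
  rw [expPhase_eq]
  refine Real.norm_exp_I_mul_ofReal_sub_one_le.trans ?_
  rw [Real.norm_eq_abs, abs_mul, abs_of_pos (by positivity)]
  have := Real.pi_lt_d2
  gcongr; linarith

lemma norm_expPhase_sub_le (x y : ℝ) (b : ℤ) : ‖expPhase x - expPhase y‖ ≤ 7 * |x - y - b| := by
  have h : expPhase x - expPhase y = (expPhase (x - y - b) - 1) * expPhase y := by
    have : x = (x - y - b) + y + b := by ring
    conv_lhs => rw [this, expPhase_add_int, expPhase_add]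
    ring
  rw [h, norm_mul, norm_expPhase, mul_one]
  exact norm_expPhase_sub_one_le _

lemma le_norm_expPhase_sub_one (x : ℝ) : 4 * |x - round x| ≤ ‖expPhase x - 1‖ := by
  set y := x - round x with hy
  have h1 : expPhase x = expPhase y := by
    rw [← expPhase_add_int y (round x)]; congr 1; rw [hy]; ring
  have hy2 : |y| ≤ 1 / 2 := abs_sub_round x
  rw [h1, expPhase_eq, Complex.norm_exp_I_mul_ofReal_sub_one]
  have h2 : 2 * Real.pi * y / 2 = Real.pi * y := by ring
  rw [h2, Real.norm_eq_abs, abs_mul, abs_two]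
  have h3 := Real.mul_abs_le_abs_sin (x := Real.pi * y) (by
    rw [abs_mul, abs_of_pos Real.pi_pos]; nlinarith [Real.pi_pos])
  rw [abs_mul, abs_of_pos Real.pi_pos] at h3
  have h4 : 2 / Real.pi * (Real.pi * |y|) = 2 * |y| := by field_simp
  linarith

/-- `x` lies within `ε` of an integer. -/
def NearInt (ε x : ℝ) : Prop := ∃ b : ℤ, |x - b| ≤ ε

lemma NearInt.mono {ε ε' x : ℝ} (h : NearInt ε x) (hε : ε ≤ ε') : NearInt ε' x := by
  obtain ⟨b, hb⟩ := h; exact ⟨b, hb.trans hε⟩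

lemma nearInt_of_half_le {ε : ℝ} (x : ℝ) (h : 1 / 2 ≤ ε) : NearInt ε x :=
  ⟨round x, (abs_sub_round x).trans h⟩

lemma NearInt.int_mul {ε x : ℝ} (h : NearInt ε x) (m : ℤ) : NearInt (|(m : ℝ)| * ε) (m * x) := by
  obtain ⟨b, hb⟩ := h
  refine ⟨m * b, ?_⟩
  have : (m : ℝ) * x - ((m * b : ℤ) : ℝ) = m * (x - b) := by push_cast; ring
  rw [this, abs_mul]; gcongr

lemma NearInt.nat_mul {ε x : ℝ} (h : NearInt ε x) (m : ℕ) : NearInt (m * ε) (m * x) := by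
  simpa using h.int_mul m

lemma NearInt.add {ε ε' x y : ℝ} (h : NearInt ε x) (h' : NearInt ε' y) :
    NearInt (ε + ε') (x + y) := by
  obtain ⟨b, hb⟩ := h
  obtain ⟨c, hc⟩ := h'
  refine ⟨b + c, ?_⟩
  have : x + y - ((b + c : ℤ) : ℝ) = (x - b) + (y - c) := by push_cast; ring
  rw [this]; exact (abs_add_le _ _).trans (add_le_add hb hc)

lemma NearInt.neg {ε x : ℝ} (h : NearInt ε x) : NearInt ε (-x) := by
  obtain ⟨b, hb⟩ := h
  refine ⟨-b, ?_⟩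
  have : -x - ((-b : ℤ) : ℝ) = -(x - b) := by push_cast; ring
  rwa [this, abs_neg]

lemma NearInt.sub {ε ε' x y : ℝ} (h : NearInt ε x) (h' : NearInt ε' y) :
    NearInt (ε + ε') (x - y) := by
  rw [sub_eq_add_neg]; exact h.add h'.neg

lemma NearInt.sum {ι : Type*} (s : Finset ι) (ε x : ι → ℝ) (h : ∀ i ∈ s, NearInt (ε i) (x i)) :
    NearInt (∑ i ∈ s, ε i) (∑ i ∈ s, x i) := by
  classical
  induction s using Finset.induction_on with
  | empty => exact ⟨0, by simp⟩
  | insert a s ha ih =>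
    rw [Finset.sum_insert ha, Finset.sum_insert ha]
    exact (h a (Finset.mem_insert_self _ _)).add
      (ih fun i hi => h i (Finset.mem_insert_of_mem hi))

lemma norm_expPhase_sub_le_of_nearInt {ε x y : ℝ} (h : NearInt ε (x - y)) :
    ‖expPhase x - expPhase y‖ ≤ 7 * ε := by
  obtain ⟨b, hb⟩ := h
  exact (norm_expPhase_sub_le x y b).trans (by linarith)

/-! ### Recurrence of linear phases -/

/-- A set of integers in `[-2N, 2N]` in which points at distance at most `W` are in fact at
distance at most `V` splits into `4N / W + 1` clusters of at most `V + 1` points. -/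
lemma card_le_of_clustered (N : ℕ) (U : Finset ℤ) (hU : ∀ h ∈ U, |h| ≤ 2 * (N : ℤ))
    {W V : ℝ} (hW : 0 < W) (hV : 0 ≤ V)
    (hc : ∀ h ∈ U, ∀ h' ∈ U, h ≤ h' → ((h' - h : ℤ) : ℝ) ≤ W → ((h' - h : ℤ) : ℝ) ≤ V) :
    (U.card : ℝ) ≤ (4 * N / W + 1) * (V + 1) := by
  classical
  set g : ℤ → ℕ := fun h => ⌊((h + 2 * N : ℤ) : ℝ) / W⌋₊ with hg
  have hnn : ∀ h ∈ U, (0 : ℝ) ≤ ((h + 2 * N : ℤ) : ℝ) := fun h hh => by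
    have := abs_le.1 (hU h hh); exact_mod_cast (by omega : (0 : ℤ) ≤ h + 2 * N)
  have himg : U.image g ⊆ Finset.range (⌊4 * N / W⌋₊ + 1) := by
    intro m hm
    obtain ⟨h, hh, rfl⟩ := Finset.mem_image.1 hm
    rw [Finset.mem_range, Nat.lt_succ_iff]
    apply Nat.floor_le_floor
    gcongr
    have := abs_le.1 (hU h hh); exact_mod_cast (by omega : h + 2 * N ≤ 4 * (N : ℤ))
  have hfib : ∀ m ∈ U.image g, (U.filter (fun h => g h = m)).card ≤ ⌊V⌋₊ + 1 := by
    intro m hm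
    set F := U.filter (fun h => g h = m)
    rcases F.eq_empty_or_nonempty with hF | hF
    · rw [hF]; simp
    set h0 := F.min' hF
    have h0m : h0 ∈ F := F.min'_mem hF
    have hsub : F ⊆ Finset.Icc h0 (h0 + ⌊V⌋₊) := by
      intro h hh
      have hle : h0 ≤ h := F.min'_le h hh
      rw [Finset.mem_Icc]
      refine ⟨hle, ?_⟩
      have hhU := (Finset.mem_filter.1 hh)
      have h0U := (Finset.mem_filter.1 h0m)
      have hclose : ((h - h0 : ℤ) : ℝ) ≤ W := by
        have e1 : ((h + 2 * N : ℤ) : ℝ) / W < m + 1 := by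
          have := Nat.lt_floor_add_one (((h + 2 * N : ℤ) : ℝ) / W)
          rw [← hhU.2]; exact this
        have e2 : (m : ℝ) ≤ ((h0 + 2 * N : ℤ) : ℝ) / W := by
          rw [← h0U.2]; exact Nat.floor_le (div_nonneg (hnn _ h0U.1) hW.le)
        rw [div_lt_iff₀ hW] at e1
        rw [le_div_iff₀ hW] at e2
        push_cast at *
        linarith
      have := hc h0 h0U.1 h hhU.1 hle hclose
      have h2 : ((h - h0).toNat : ℝ) ≤ V := by
        have : (((h - h0).toNat : ℤ) : ℝ) = ((h - h0 : ℤ) : ℝ) := by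
          rw [Int.toNat_of_nonneg (by omega)]
        rw [Int.cast_natCast] at this; rw [this]; assumption
      have h3 := Nat.le_floor h2
      omega
    refine (Finset.card_le_card hsub).trans ?_
    rw [Int.card_Icc]; omega
  have h1 := Finset.card_le_mul_card_image U (⌊V⌋₊ + 1) hfib
  have h2 := (Finset.card_le_card himg)
  rw [Finset.card_range] at h2
  calc (U.card : ℝ) ≤ ((⌊V⌋₊ + 1) * (U.image g).card : ℕ) := by exact_mod_cast h1
    _ ≤ ((⌊V⌋₊ + 1) * (⌊4 * N / W⌋₊ + 1) : ℕ) := by exact_mod_cast Nat.mul_le_mul_left _ h2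
    _ = ((⌊4 * N / W⌋₊ : ℝ) + 1) * ((⌊V⌋₊ : ℝ) + 1) := by push_cast; ring
    _ ≤ (4 * N / W + 1) * (V + 1) := by
        gcongr
        · exact Nat.floor_le (by positivity)
        · exact Nat.floor_le hV

/-- If `h β` is within `ε` of an integer for a positive proportion of `|h| ≤ 2N`, then `β` is
within `O(ε / N)` of a rational with bounded denominator. -/
lemma exists_denominator_of_recurrence (N : ℕ) (U : Finset ℤ)
    (hU : ∀ h ∈ U, |h| ≤ 2 * (N : ℤ)) {B ε β : ℝ} (hB : 1 ≤ B) (hε : 0 ≤ ε)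
    (hN : 4 * B ≤ N) (hcard : N / B ≤ U.card) (hεB : ε * (1000 * B ^ 2) ≤ 1)
    (hnear : ∀ h ∈ U, NearInt ε (h * β)) :
    ∃ q : ℕ, 1 ≤ q ∧ (q : ℝ) ≤ 10 * B ∧ NearInt (40 * B ^ 2 * ε / N) (q * β) := by
  have hNpos : (0 : ℝ) < N := by linarith
  -- two distinct elements of `U` at distance at most `10 B`
  obtain ⟨h, hh, h', hh', hlt, hle⟩ : ∃ h ∈ U, ∃ h' ∈ U, h < h' ∧ ((h' - h : ℤ) : ℝ) ≤ 10 * B := by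
    by_contra! hcon
    have := card_le_of_clustered N U hU (W := 10 * B) (V := 0) (by linarith) le_rfl (by
      intro h hh h' hh' hle hW
      rcases hle.eq_or_lt with rfl | hlt
      · simp
      · exact absurd (hcon h hh h' hh' hlt) (not_lt.2 hW))
    have e : 4 * (N : ℝ) / (10 * B) = 0.4 * (N / B) := by field_simp; norm_num
    have e2 : 4 ≤ (N : ℝ) / B := by rw [le_div_iff₀ (by linarith)]; exact hN
    rw [e] at this
    norm_num at this
    linarith
  have hdiff : ∀ h ∈ U, ∀ h' ∈ U, NearInt (2 * ε) (((h' - h : ℤ) : ℝ) * β) := by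
    intro h hh h' hh'
    have := (hnear h' hh').sub (hnear h hh)
    rw [← two_mul] at this
    convert this using 1; push_cast; ring
  set q := (h' - h).toNat with hq
  have hqz : (q : ℤ) = h' - h := Int.toNat_of_nonneg (by omega)
  have hqr : (q : ℝ) = ((h' - h : ℤ) : ℝ) := by rw [← hqz]; simp
  refine ⟨q, by omega, by rw [hqr]; exact hle, ?_⟩
  obtain ⟨b, hb⟩ := hdiff h hh h' hh'
  rw [← hqr] at hb hle
  -- With `κ` the signed distance of `q β` to an integer, a difference `m` of elements of `U` is such
  -- that `m κ` is close to an integer. If `m ≤ 1 / (2 |κ|)` this integer is zero, so `m |κ|` is small: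
  -- the set `U` is clustered, and as it is large, `|κ|` has to be small.
  set κ := (q : ℝ) * β - b with hκ
  refine ⟨b, ?_⟩
  rw [← hκ]
  rcases eq_or_ne κ 0 with h0 | h0
  · rw [h0, abs_zero]; positivity
  have hκpos : 0 < |κ| := abs_pos.2 h0
  set ε' := 20 * B * ε with hε'
  have hε'1 : ε' ≤ 1 / 50 := by
    rw [hε']; nlinarith
  have hε'0 : 0 ≤ ε' := by positivity
  have hcount := card_le_of_clustered N U hU (W := 1 / (2 * |κ|)) (V := ε' / |κ|) (by positivity)
    (by positivity) (by
      intro g hg g' hg' hgle hW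
      obtain ⟨c, hc⟩ := (hdiff g hg g' hg').nat_mul q
      set m := g' - g with hm
      have hm0 : (0 : ℝ) ≤ (m : ℝ) := by exact_mod_cast (by omega : (0 : ℤ) ≤ m)
      have e1 : (m : ℝ) * κ - ((c - m * b : ℤ) : ℝ) = (q : ℝ) * ((m : ℝ) * β) - c := by
        rw [hκ]; push_cast; ring
      have e2 : |(m : ℝ) * κ - ((c - m * b : ℤ) : ℝ)| ≤ ε' := by
        rw [e1]; refine hc.trans ?_
        rw [hε']; nlinarith
      have e3 : |(m : ℝ) * κ| ≤ 1 / 2 := by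
        rw [abs_mul, abs_of_nonneg hm0]
        rw [le_div_iff₀ (by positivity)] at hW
        linarith
      have e4 : c - m * b = 0 := by
        have : |((c - m * b : ℤ) : ℝ)| < 1 := by
          have := abs_sub_abs_le_abs_sub ((c - m * b : ℤ) : ℝ) ((m : ℝ) * κ)
          rw [abs_sub_comm] at this
          linarith
        exact Int.abs_lt_one_iff.1 (by exact_mod_cast this)
      rw [e4, Int.cast_zero, sub_zero, abs_mul, abs_of_nonneg hm0] at e2
      rwa [le_div_iff₀ hκpos])
  have e1 : 4 * (N : ℝ) / (1 / (2 * |κ|)) = 8 * N * |κ| := by field_simp; norm_num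
  rw [e1] at hcount
  have e2 : (8 * N * |κ| + 1) * (ε' / |κ| + 1) = 8 * N * ε' + 8 * N * |κ| + ε' / |κ| + 1 := by
    field_simp; ring
  rw [e2] at hcount
  have e3 : (N : ℝ) * ε' ≤ N / B * (1 / 50) := by
    have : ε' ≤ 1 / B * (1 / 50) := by
      rw [hε', ← mul_div_mul_comm, le_div_iff₀ (by positivity)]; nlinarith
    calc (N : ℝ) * ε' ≤ N * (1 / B * (1 / 50)) := by gcongr
      _ = _ := by ring
  have e4 : (N : ℝ) * |κ| ≤ N / B * (1 / 500) := by
    have : |κ| ≤ 1 / B * (1 / 500) := by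
      refine hb.trans ?_
      rw [← mul_div_mul_comm, le_div_iff₀ (by positivity)]; nlinarith
    calc (N : ℝ) * |κ| ≤ N * (1 / B * (1 / 500)) := by gcongr
      _ = _ := by ring
  have e5 : 4 ≤ (N : ℝ) / B := by rw [le_div_iff₀ (by linarith)]; exact hN
  have e6 : (N : ℝ) / B / 2 ≤ ε' / |κ| := by linarith
  rw [le_div_iff₀ hκpos] at e6
  rw [le_div_iff₀ hNpos]
  have e7 : (N : ℝ) / B / 2 * |κ| * (2 * B) = |κ| * N := by field_simp
  rw [← e7]
  calc (N : ℝ) / B / 2 * |κ| * (2 * B) ≤ ε' * (2 * B) := by gcongr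
    _ = 40 * B ^ 2 * ε := by rw [hε']; ring

/-! ### Weyl's inequality in one variable -/

lemma sum_Icc_shift {E : Type*} [AddCommMonoid E] (N M : ℕ) (u : ℤ → E) (a : ℤ)
    (hu : ∀ t, (N : ℤ) < |t| → u t = 0) (hM : (N : ℤ) + |a| ≤ M) :
    ∑ t ∈ Finset.Icc (-(M : ℤ)) M, u (t + a) = ∑ t ∈ Finset.Icc (-(N : ℤ)) N, u t := by
  classical
  have h1 : ∑ t ∈ Finset.Icc (-(M : ℤ)) M, u (t + a)
      = ∑ t ∈ Finset.Icc (-(M : ℤ) + a) (M + a), u t := by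
    refine Finset.sum_nbij' (fun t => t + a) (fun t => t - a) ?_ ?_ ?_ ?_ ?_
    · intro t ht; rw [Finset.mem_Icc] at *; omega
    · intro t ht; rw [Finset.mem_Icc] at *; omega
    · intro t _; simp
    · intro t _; simp
    · intro t _; rfl
  rw [h1]
  symm
  apply Finset.sum_subset
  · intro t ht
    rw [Finset.mem_Icc] at *
    have := abs_le.1 (le_refl |a|)
    omega
  · intro t _ ht
    apply hu
    rw [Finset.mem_Icc, ← abs_le] at ht
    omega

/-- A Lipschitz weight tested against a linear phase detects how close the frequency is to an
integer. -/
lemma nearInt_of_linear_sum (A : ℝ) (hA : 2 ≤ A) (N : ℕ) (hN : 1 ≤ N) (w : ℤ → ℂ)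
    (hsupp : ∀ t, (N : ℤ) < |t| → w t = 0)
    (hlip : ∀ t, ‖w (t + 1) - w t‖ ≤ A / N) (θ c : ℝ)
    (hsum : N / A ≤ ‖∑ t ∈ Finset.Icc (-(N : ℤ)) N, w t * expPhase (θ * t + c)‖) :
    NearInt (A ^ 3 / N) θ := by
  have hNr : (1 : ℝ) ≤ N := by exact_mod_cast hN
  set S := ∑ t ∈ Finset.Icc (-(N : ℤ)) N, w t * expPhase (θ * t + c) with hS
  set M := N + 1 with hM
  have hS1 : S = ∑ t ∈ Finset.Icc (-(M : ℤ)) M, w t * expPhase (θ * t + c) := by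
    have := sum_Icc_shift N M (fun t => w t * expPhase (θ * t + c)) 0
      (fun t ht => by simp only [hsupp t ht, zero_mul]) (by simp [hM])
    simpa using this.symm
  have hS2 : S = ∑ t ∈ Finset.Icc (-(M : ℤ)) M, w (t + 1) * expPhase (θ * (t + 1 : ℤ) + c) :=
    (sum_Icc_shift N M (fun t => w t * expPhase (θ * t + c)) 1
      (fun t ht => by simp only [hsupp t ht, zero_mul]) (by simp [hM])).symm
  -- summation by parts: the boundary terms vanish because the weight does
  have h3 : (expPhase θ - 1) * S = ∑ t ∈ Finset.Icc (-(M : ℤ)) M,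
      (w t - w (t + 1)) * expPhase (θ * (t + 1 : ℤ) + c) := by
    have h4 : expPhase θ * S = ∑ t ∈ Finset.Icc (-(M : ℤ)) M,
        w t * expPhase (θ * (t + 1 : ℤ) + c) := by
      rw [hS1, Finset.mul_sum]
      refine Finset.sum_congr rfl fun t _ => ?_
      have : θ * ((t + 1 : ℤ) : ℝ) + c = θ + (θ * t + c) := by push_cast; ring
      rw [this, expPhase_add θ]; ring
    rw [sub_mul, one_mul, h4]
    nth_rewrite 1 [hS2]
    rw [← Finset.sum_sub_distrib]
    exact Finset.sum_congr rfl fun t _ => by ring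
  have h5 : ‖(expPhase θ - 1) * S‖ ≤ 5 * A := by
    rw [h3]
    refine (norm_sum_le _ _).trans ?_
    have : ∀ t ∈ Finset.Icc (-(M : ℤ)) M,
        ‖(w t - w (t + 1)) * expPhase (θ * (t + 1 : ℤ) + c)‖ ≤ A / N := by
      intro t _
      rw [norm_mul, norm_expPhase, mul_one, norm_sub_rev]; exact hlip t
    refine (Finset.sum_le_card_nsmul _ _ _ this).trans ?_
    rw [Int.card_Icc, nsmul_eq_mul]
    have e : (((M : ℤ) + 1 - -(M : ℤ)).toNat : ℝ) = 2 * N + 3 := by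
      have : ((M : ℤ) + 1 - -(M : ℤ)).toNat = 2 * N + 3 := by omega
      rw [this]; push_cast; ring
    rw [e, mul_div_assoc', div_le_iff₀ (by linarith)]
    nlinarith
  rw [norm_mul] at h5
  have h6 := le_norm_expPhase_sub_one θ
  refine ⟨round θ, ?_⟩
  rw [le_div_iff₀ (by linarith)]
  have h7 : 4 * |θ - round θ| * (N / A) ≤ 5 * A :=
    (mul_le_mul h6 hsum (by positivity) (by positivity)).trans h5
  rw [mul_div_assoc', div_le_iff₀ (by linarith)] at h7
  have : 0 ≤ |θ - round θ| := abs_nonneg _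
  nlinarith [mul_le_mul_of_nonneg_right hA (sq_nonneg A)]

open Polynomial in
/-- The difference `f(X + h) - f(X)` drops the degree, and its leading coefficient is
`(D + 1) h` times that of `f`. -/
lemma natDegree_taylor_sub_le (D : ℕ) (f : ℝ[X]) (hf : f.natDegree ≤ D + 1) (h : ℝ) :
    (taylor h f - f).natDegree ≤ D ∧
      (taylor h f - f).coeff D = (D + 1) * h * f.coeff (D + 1) := by
  constructor
  · rw [natDegree_le_iff_coeff_eq_zero]
    intro k hk
    rw [coeff_sub, taylor_coeff]
    rcases (show D + 1 ≤ k from hk).eq_or_lt with rfl | hlt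
    · have h1 : (hasseDeriv (D + 1) f).natDegree ≤ 0 :=
        (natDegree_hasseDeriv_le f (D + 1)).trans (by omega)
      rw [eq_C_of_natDegree_le_zero h1, eval_C, hasseDeriv_coeff]
      simp
    · rw [hasseDeriv_eq_zero_of_lt_natDegree f k (by omega),
        coeff_eq_zero_of_natDegree_lt (by omega)]
      simp
  · rw [coeff_sub, taylor_coeff]
    have h1 : (hasseDeriv D f).natDegree ≤ 1 := (natDegree_hasseDeriv_le f D).trans (by omega)
    rw [eval_eq_sum_range' (Nat.lt_succ_of_le h1)]
    simp only [Finset.sum_range_succ, Finset.sum_range_zero, hasseDeriv_coeff]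
    rw [zero_add D, add_comm 1 D, Nat.choose_self, Nat.choose_succ_self_right]
    push_cast; ring

/-- The van der Corput expansion of the square of a sum. -/
lemma norm_sq_sum_le_sum_correlations (N : ℕ) (u : ℤ → ℂ) (hu : ∀ t, (N : ℤ) < |t| → u t = 0) :
    ‖∑ t ∈ Finset.Icc (-(N : ℤ)) N, u t‖ ^ 2 ≤
      ∑ h ∈ Finset.Icc (-((2 * N : ℕ) : ℤ)) (2 * N : ℕ),
        ‖∑ t ∈ Finset.Icc (-(N : ℤ)) N, u (t + h) * (starRingEnd ℂ) (u t)‖ := by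
  set S := ∑ t ∈ Finset.Icc (-(N : ℤ)) N, u t with hS
  have h1 : S * (starRingEnd ℂ) S = ∑ h ∈ Finset.Icc (-((2 * N : ℕ) : ℤ)) (2 * N : ℕ),
      ∑ t ∈ Finset.Icc (-(N : ℤ)) N, u (t + h) * (starRingEnd ℂ) (u t) := by
    rw [Finset.sum_comm]
    nth_rewrite 2 [hS]
    rw [map_sum, Finset.mul_sum]
    refine Finset.sum_congr rfl fun t ht => ?_
    rw [← Finset.sum_mul]
    congr 1
    rw [hS]
    rw [Finset.mem_Icc, ← abs_le] at ht
    rw [← sum_Icc_shift N (2 * N) u t hu (by push_cast; omega)]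
    exact Finset.sum_congr rfl fun h _ => by rw [add_comm]
  have h2 : ‖S‖ ^ 2 = ‖S * (starRingEnd ℂ) S‖ := by
    rw [norm_mul, RCLike.norm_conj, sq]
  rw [h2, h1]
  exact norm_sum_le _ _

/-- If the average of numbers in `[0, 3N]` over `[-2N, 2N]` is large then many of them are
large. -/
lemma card_large_of_sum_ge (A : ℝ) (hA : 2 ≤ A) (N : ℕ) (hN : 1 ≤ N) (I : ℤ → ℝ)
    (hI : ∀ h, I h ≤ 3 * N)
    (hsum : (N / A) ^ 2 ≤ ∑ h ∈ Finset.Icc (-((2 * N : ℕ) : ℤ)) (2 * N : ℕ), I h) :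
    N / (6 * A ^ 2) ≤ (((Finset.Icc (-((2 * N : ℕ) : ℤ)) (2 * N : ℕ)).filter
      (fun h => N / (10 * A ^ 2) ≤ I h)).card : ℝ) := by
  have hNr : (1 : ℝ) ≤ N := by exact_mod_cast hN
  set H := Finset.Icc (-((2 * N : ℕ) : ℤ)) (2 * N : ℕ) with hH
  have hHc : (H.card : ℝ) ≤ 5 * N := by
    rw [hH, Int.card_Icc]
    have : (((2 * N : ℕ) : ℤ) + 1 - -((2 * N : ℕ) : ℤ)).toNat = 4 * N + 1 := by omega
    rw [this]; push_cast; linarith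
  rw [← Finset.sum_filter_add_sum_filter_not H (fun h => N / (10 * A ^ 2) ≤ I h)] at hsum
  set G := H.filter (fun h => N / (10 * A ^ 2) ≤ I h)
  have h1 : ∑ h ∈ G, I h ≤ G.card * (3 * N) := by
    have := Finset.sum_le_card_nsmul G I (3 * N) (fun h _ => hI h)
    simpa using this
  have h2 : ∑ h ∈ H.filter (fun h => ¬ N / (10 * A ^ 2) ≤ I h), I h
      ≤ (5 * N) * (N / (10 * A ^ 2)) := by
    have := Finset.sum_le_card_nsmul (H.filter (fun h => ¬ N / (10 * A ^ 2) ≤ I h)) I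
      (N / (10 * A ^ 2)) (fun h hh => by
        have := (Finset.mem_filter.1 hh).2; exact (not_le.1 this).le)
    rw [nsmul_eq_mul] at this
    refine this.trans ?_
    gcongr
    exact le_trans (by exact_mod_cast Finset.card_le_card (Finset.filter_subset _ _)) hHc
  have h3 : (N / A) ^ 2 ≤ G.card * (3 * N) + (5 * N) * (N / (10 * A ^ 2)) := by linarith
  have h4 : (N / A) ^ 2 - (5 * N) * (N / (10 * A ^ 2)) = N / (6 * A ^ 2) * (3 * N) := by
    field_simp; norm_num
  have h5 : N / (6 * A ^ 2) * (3 * N) ≤ G.card * (3 * N) := by linarith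
  exact le_of_mul_le_mul_right h5 (by linarith)

/-- A constant below `2 ^ c` is absorbed by `c` additional powers of a base at least `2`. -/
lemma mul_pow_le_pow {A k : ℝ} (hA : 2 ≤ A) (c m : ℕ) (hk : k ≤ 2 ^ c) :
    k * A ^ m ≤ A ^ (c + m) := by
  rw [pow_add]
  have : (2 : ℝ) ^ c ≤ A ^ c := by gcongr
  have : 0 ≤ A ^ m := by positivity
  nlinarith

open Polynomial in
/-- Inverse form of Weyl's inequality, for the leading coefficient: if a weighted exponential sum
of length `N` exceeds `N / A`, the leading coefficient of the phase is within `A ^ C / N ^ D` of a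
rational with denominator at most `A ^ C`. -/
theorem weyl_leading_coeff (D : ℕ) : ∃ C : ℕ, ∀ (A : ℝ), 2 ≤ A → ∀ (N : ℕ), 1 ≤ N →
    ∀ (w : ℤ → ℂ), (∀ t, ‖w t‖ ≤ 1) → (∀ t, (N : ℤ) < |t| → w t = 0) →
    (∀ t, ‖w (t + 1) - w t‖ ≤ A / N) →
    ∀ f : ℝ[X], f.natDegree ≤ D + 1 →
    N / A ≤ ‖∑ t ∈ Finset.Icc (-(N : ℤ)) N, w t * expPhase (f.eval (t : ℝ))‖ →
    ∃ q : ℕ, 1 ≤ q ∧ (q : ℝ) ≤ A ^ C ∧ NearInt (A ^ C / N ^ (D + 1)) (q * f.coeff (D + 1)) := by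
  induction D with
  | zero =>
    refine ⟨3, fun A hA N hN w _ hsupp hlip f hf hsum => ⟨1, le_rfl, ?_, ?_⟩⟩
    · push_cast; exact one_le_pow₀ (by linarith)
    · have hfe : ∀ t : ℤ, f.eval (t : ℝ) = f.coeff 1 * t + f.coeff 0 := by
        intro t
        rw [eval_eq_sum_range' (Nat.lt_succ_of_le hf)]
        simp [Finset.sum_range_succ]; ring
      simp only [hfe] at hsum
      have := nearInt_of_linear_sum A hA N hN w hsupp hlip _ _ hsum
      simpa using this
  | succ D ih =>
    obtain ⟨C, hC⟩ := ih
    -- `6 A² (10 A²)^C ≤ A^(6C+5)` is the inverse density of shifts with a common denominator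
    set b := 6 * C + 5 with hb
    set E := (20 + 3 * b) * (D + 2) with hE
    refine ⟨E, fun A hA N hN w hw hsupp hlip f hf hsum => ?_⟩
    have hA1 : (1 : ℝ) ≤ A := by linarith
    have hNr : (1 : ℝ) ≤ N := by exact_mod_cast hN
    have hN0 : (0 : ℝ) < N := by linarith
    -- For short sums every number is close enough to an integer.
    by_cases hsmall : (N : ℝ) < A ^ (12 + 3 * b)
    · refine ⟨1, le_rfl, by push_cast; exact one_le_pow₀ hA1, nearInt_of_half_le _ ?_⟩
      rw [le_div_iff₀ (by positivity)]
      calc 1 / 2 * (N : ℝ) ^ (D + 1 + 1) ≤ 1 * (A ^ (12 + 3 * b)) ^ (D + 1 + 1) := by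
            gcongr; norm_num
        _ = A ^ ((12 + 3 * b) * (D + 2)) := by rw [one_mul, ← pow_mul]
        _ ≤ A ^ E := pow_le_pow_right₀ hA1 (by rw [hE]; gcongr; omega)
    push Not at hsmall
    set A' := 10 * A ^ 2 with hA'
    have hA'2 : 2 ≤ A' := by nlinarith
    set u : ℤ → ℂ := fun t => w t * expPhase (f.eval (t : ℝ)) with hu
    have hus : ∀ t, (N : ℤ) < |t| → u t = 0 := fun t ht => by simp [hu, hsupp t ht]
    have hcor := norm_sq_sum_le_sum_correlations N u hus
    set I : ℤ → ℝ := fun h =>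
      ‖∑ t ∈ Finset.Icc (-(N : ℤ)) N, u (t + h) * (starRingEnd ℂ) (u t)‖ with hI
    have hun : ∀ t, ‖u t‖ ≤ 1 := fun t => by
      simp only [hu, norm_mul, norm_expPhase, mul_one]; exact hw t
    have hI3 : ∀ h, I h ≤ 3 * N := by
      intro h
      refine (norm_sum_le_of_le (Finset.Icc (-(N : ℤ)) N) (n := fun _ => (1 : ℝ)) ?_).trans ?_
      · intro t _
        rw [norm_mul, RCLike.norm_conj]
        exact mul_le_one₀ (hun _) (norm_nonneg _) (hun _)
      · rw [Finset.sum_const, Int.card_Icc, nsmul_eq_mul, mul_one]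
        have : ((N : ℤ) + 1 - -(N : ℤ)).toNat = 2 * N + 1 := by omega
        rw [this]; push_cast; linarith
    have hcard := card_large_of_sum_ge A hA N hN I hI3
      ((by gcongr : (N / A) ^ 2 ≤ _).trans hcor)
    set G := (Finset.Icc (-((2 * N : ℕ) : ℤ)) (2 * N : ℕ)).filter
      (fun h => N / (10 * A ^ 2) ≤ I h) with hG
    -- Differencing lowers the degree: the induction hypothesis applies to each large correlation.
    have hkey : ∀ h ∈ G, ∃ q : ℕ, 1 ≤ q ∧ (q : ℝ) ≤ A' ^ C ∧
        NearInt (A' ^ C / N ^ (D + 1)) (q * ((D + 1 + 1) * h * f.coeff (D + 1 + 1))) := by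
      intro h hh
      obtain ⟨hdeg, hcoe⟩ := natDegree_taylor_sub_le (D + 1) f hf (h : ℝ)
      have := hC A' hA'2 N hN (fun t => w (t + h) * (starRingEnd ℂ) (w t))
        (fun t => by
          rw [norm_mul, RCLike.norm_conj]; exact mul_le_one₀ (hw _) (norm_nonneg _) (hw _))
        (fun t ht => by simp [hsupp t ht])
        (fun t => by
          have e : w (t + 1 + h) * (starRingEnd ℂ) (w (t + 1)) - w (t + h) * (starRingEnd ℂ) (w t)
              = (w (t + h + 1) - w (t + h)) * (starRingEnd ℂ) (w (t + 1))
                + w (t + h) * (starRingEnd ℂ) (w (t + 1) - w t) := by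
            rw [map_sub, show t + 1 + h = t + h + 1 by ring]; ring
          rw [e]
          refine (norm_add_le _ _).trans ?_
          rw [norm_mul, norm_mul, RCLike.norm_conj, RCLike.norm_conj]
          have h1 := mul_le_mul (hlip (t + h)) (hw (t + 1)) (norm_nonneg _) (by positivity)
          have h2 := mul_le_mul (hw (t + h)) (hlip t) (norm_nonneg _) zero_le_one
          have h3 : A / N * 1 + 1 * (A / N) ≤ A' / N := by
            rw [mul_one, one_mul, ← add_div]; gcongr; nlinarith
          linarith)
        (taylor (h : ℝ) f - f) hdeg
        (by
          refine (Finset.mem_filter.1 hh).2.trans (le_of_eq ?_)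
          simp only [hI, hu]
          congr 1
          refine Finset.sum_congr rfl fun t _ => ?_
          rw [eval_sub, taylor_eval, sub_eq_add_neg, expPhase_add, map_mul, conj_expPhase]
          push_cast
          ring)
      rw [hcoe] at this
      exact_mod_cast this
    choose! Q hQ1 hQ2 hQ3 using hkey
    -- a common denominator for many shifts
    obtain ⟨q, hqm, hqc⟩ : ∃ q ∈ Finset.Icc 1 ⌊A' ^ C⌋₊,
        N / A ^ b ≤ ((G.filter (fun h => Q h = q)).card : ℝ) := by
      have hmaps : ∀ h ∈ G, Q h ∈ Finset.Icc 1 ⌊A' ^ C⌋₊ := fun h hh =>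
        Finset.mem_Icc.2 ⟨hQ1 h hh, Nat.le_floor (hQ2 h hh)⟩
      have hone : (1 : ℝ) ≤ A' ^ C := one_le_pow₀ (by linarith)
      refine Finset.exists_le_card_fiber_of_nsmul_le_card_of_maps_to hmaps
        ⟨1, Finset.mem_Icc.2 ⟨le_rfl, Nat.le_floor (by simpa using hone)⟩⟩ ?_
      rw [Nat.card_Icc, nsmul_eq_mul, Nat.add_sub_cancel]
      refine le_trans ?_ hcard
      have h1 : (⌊A' ^ C⌋₊ : ℝ) ≤ A' ^ C := Nat.floor_le (by positivity)
      have h2 : A' ^ C * (6 * A ^ 2) ≤ A ^ b := by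
        calc A' ^ C * (6 * A ^ 2) = (6 * 10 ^ C) * A ^ (2 * C + 2) := by rw [hA']; ring
          _ ≤ A ^ ((4 * C + 3) + (2 * C + 2)) := by
              apply mul_pow_le_pow hA
              rw [pow_add, pow_mul]
              have : (10 : ℝ) ^ C ≤ (2 ^ 4) ^ C := by gcongr; norm_num
              have : (0 : ℝ) ≤ 10 ^ C := by positivity
              linarith
          _ = A ^ b := by congr 1; rw [hb]; ring
      calc (⌊A' ^ C⌋₊ : ℝ) * (N / A ^ b) ≤ A' ^ C * (N / A ^ b) := by gcongr
        _ = N * A' ^ C / A ^ b := by ring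
        _ ≤ N / (6 * A ^ 2) := by
            rw [div_le_div_iff₀ (by positivity) (by positivity), mul_assoc]
            gcongr
    rw [Finset.mem_Icc] at hqm
    have hq' : (q : ℝ) ≤ A' ^ C :=
      (Nat.cast_le.2 hqm.2).trans (Nat.floor_le (by positivity))
    have hA'C : A' ^ C ≤ A ^ b := by
      calc A' ^ C = 10 ^ C * A ^ (2 * C) := by rw [hA']; ring
        _ ≤ A ^ (4 * C + 2 * C) := by
            apply mul_pow_le_pow hA
            rw [pow_mul]; gcongr; norm_num
        _ ≤ A ^ b := pow_le_pow_right₀ hA1 (by omega)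
    set ε := A ^ b / N ^ (D + 1) with hε
    have hεN : ε ≤ A ^ b / N := by
      rw [hε]
      have : (N : ℝ) ≤ N ^ (D + 1) := le_self_pow₀ hNr (by omega)
      gcongr
    have hAb : 1 ≤ A ^ b := one_le_pow₀ hA1
    obtain ⟨q', h1, h2, h3⟩ := exists_denominator_of_recurrence N (G.filter (fun h => Q h = q))
      (fun h hh => by
        have := (Finset.mem_filter.1 (Finset.mem_filter.1 hh).1).1
        rw [Finset.mem_Icc, ← abs_le] at this
        exact_mod_cast this)
      (B := A ^ b) (ε := ε) (β := q * ((D + 1 + 1) * f.coeff (D + 1 + 1))) hAb (by positivity)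
      (by
        refine le_trans ?_ hsmall
        calc 4 * A ^ b ≤ A ^ (2 + b) := mul_pow_le_pow hA 2 b (by norm_num)
          _ ≤ _ := pow_le_pow_right₀ hA1 (by omega))
      hqc
      (by
        calc ε * (1000 * (A ^ b) ^ 2) ≤ A ^ b / N * (1000 * (A ^ b) ^ 2) := by gcongr
          _ = (1000 * A ^ (3 * b)) / N := by ring
          _ ≤ 1 := by
              rw [div_le_one hN0]
              refine le_trans ?_ hsmall
              calc 1000 * A ^ (3 * b) ≤ A ^ (10 + 3 * b) := mul_pow_le_pow hA 10 _ (by norm_num)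
                _ ≤ _ := pow_le_pow_right₀ hA1 (by omega))
      (fun h hh => by
        obtain ⟨hhG, rfl⟩ := Finset.mem_filter.1 hh
        have := (hQ3 h hhG).mono (by rw [hε]; gcongr : _ ≤ ε)
        convert this using 1; ring)
    set r := q' * q * (D + 2) with hr
    refine ⟨r, Nat.mul_pos (Nat.mul_pos h1 hqm.1) (by omega), ?_, ?_⟩
    · have hD : ((D : ℝ) + 2) ≤ 2 ^ (D + 2) := by
        have := @Nat.lt_two_pow_self (D + 2)
        exact_mod_cast this.le
      calc (r : ℝ) = q' * q * (D + 2) := by rw [hr]; push_cast; ring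
        _ ≤ (10 * A ^ b) * A ^ b * 2 ^ (D + 2) := by gcongr; exact hq'.trans hA'C
        _ = (10 * 2 ^ (D + 2)) * A ^ (2 * b) := by ring
        _ ≤ A ^ ((4 + (D + 2)) + 2 * b) := by
            apply mul_pow_le_pow hA
            have : (2 : ℝ) ^ (4 + (D + 2)) = 16 * 2 ^ (D + 2) := by ring
            rw [this]; gcongr; norm_num
        _ ≤ A ^ E := pow_le_pow_right₀ hA1 (by rw [hE]; nlinarith)
    · have e : (r : ℝ) * f.coeff (D + 1 + 1)
          = q' * (q * ((D + 1 + 1) * f.coeff (D + 1 + 1))) := by rw [hr]; push_cast; ring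
      rw [e]
      refine h3.mono ?_
      rw [hε, mul_div_assoc', div_div, ← pow_succ]
      gcongr
      calc 40 * (A ^ b) ^ 2 * A ^ b = 40 * A ^ (3 * b) := by ring
        _ ≤ A ^ (6 + 3 * b) := mul_pow_le_pow hA 6 _ (by norm_num)
        _ ≤ A ^ E := pow_le_pow_right₀ hA1 (by rw [hE]; nlinarith)

/-! ### Polynomials in several variables in coordinates -/

/-- The monomial `x ^ α = ∏ i, x i ^ α i`. -/
def monom {d : ℕ} (α : Fin d → ℕ) (x : Fin d → ℝ) : ℝ := ∏ i, x i ^ α i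

/-- The homogeneous form of degree `k` with coefficients `c`. -/
noncomputable def homForm {d : ℕ} (k : ℕ) (c : (Fin d → ℕ) → ℝ) (x : Fin d → ℝ) : ℝ :=
  ∑ α ∈ Finset.piAntidiag Finset.univ k, c α * monom α x

/-- The polynomial of degree at most `D` with coefficients `c`. -/
noncomputable def polySum {d : ℕ} (D : ℕ) (c : (Fin d → ℕ) → ℝ) (x : Fin d → ℝ) : ℝ :=
  ∑ k ∈ Finset.range (D + 1), homForm k c x

lemma abs_monom_sub_le {d : ℕ} (α : Fin d → ℕ) (x y : Fin d → ℝ) {R : ℝ} (hR : 0 < R)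
    (hx : ∀ i, |x i| ≤ R) (hy : ∀ i, |y i| ≤ R) :
    R * |monom α y - monom α x| ≤ R ^ (∑ i, α i) * ∑ i, α i * |y i - x i| := by
  unfold monom
  have key : ∀ s : Finset (Fin d), R * |∏ i ∈ s, y i ^ α i - ∏ i ∈ s, x i ^ α i|
      ≤ R ^ (∑ i ∈ s, α i) * ∑ i ∈ s, α i * |y i - x i| := by
    intro s
    induction s using Finset.induction_on with
    | empty => simp
    | insert a s ha ih =>
      rw [Finset.prod_insert ha, Finset.prod_insert ha, Finset.sum_insert ha, Finset.sum_insert ha]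
      have e : y a ^ α a * ∏ i ∈ s, y i ^ α i - x a ^ α a * ∏ i ∈ s, x i ^ α i
          = y a ^ α a * (∏ i ∈ s, y i ^ α i - ∏ i ∈ s, x i ^ α i)
            + (y a ^ α a - x a ^ α a) * ∏ i ∈ s, x i ^ α i := by ring
      have h1 : |y a ^ α a| ≤ R ^ α a := by
        rw [abs_pow]; exact pow_le_pow_left₀ (abs_nonneg _) (hy a) _
      have h2 : |∏ i ∈ s, x i ^ α i| ≤ R ^ (∑ i ∈ s, α i) := by
        rw [Finset.abs_prod, ← Finset.prod_pow_eq_pow_sum]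
        refine Finset.prod_le_prod (fun i _ => abs_nonneg _) fun i _ => ?_
        rw [abs_pow]; exact pow_le_pow_left₀ (abs_nonneg _) (hx i) _
      have h3 : R * |y a ^ α a - x a ^ α a| ≤ R ^ α a * (α a * |y a - x a|) := by
        rcases Nat.eq_zero_or_pos (α a) with h0 | h0
        · simp [h0]
        · have := abs_pow_sub_pow_le (y a) (x a) (α a)
          have hm : max |y a| |x a| ≤ R := max_le (hy a) (hx a)
          calc R * |y a ^ α a - x a ^ α a|
              ≤ R * (|y a - x a| * α a * R ^ (α a - 1)) := by
                gcongr; refine this.trans ?_; gcongr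
            _ = R ^ (α a - 1 + 1) * (α a * |y a - x a|) := by ring
            _ = _ := by rw [Nat.sub_add_cancel h0]
      rw [e]
      calc R * |y a ^ α a * (∏ i ∈ s, y i ^ α i - ∏ i ∈ s, x i ^ α i)
            + (y a ^ α a - x a ^ α a) * ∏ i ∈ s, x i ^ α i|
          ≤ R * (|y a ^ α a| * |∏ i ∈ s, y i ^ α i - ∏ i ∈ s, x i ^ α i|
            + |y a ^ α a - x a ^ α a| * |∏ i ∈ s, x i ^ α i|) := by
            gcongr; refine (abs_add_le _ _).trans ?_; rw [abs_mul, abs_mul]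
        _ = |y a ^ α a| * (R * |∏ i ∈ s, y i ^ α i - ∏ i ∈ s, x i ^ α i|)
            + (R * |y a ^ α a - x a ^ α a|) * |∏ i ∈ s, x i ^ α i| := by ring
        _ ≤ R ^ α a * (R ^ (∑ i ∈ s, α i) * ∑ i ∈ s, α i * |y i - x i|)
            + (R ^ α a * (α a * |y a - x a|)) * R ^ (∑ i ∈ s, α i) := by
            gcongr
        _ = _ := by rw [pow_add]; ring
  exact key Finset.univ

lemma exists_sum_choose_mul_pow (a : ℕ) : ∃ μ : ℕ → ℤ, ∀ b ≤ a,
    ∑ j ∈ Finset.range (a + 1), (μ j : ℝ) * (j : ℝ) ^ b = if b = a then (a.factorial : ℝ) else 0 := by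
  refine ⟨fun k => (-1 : ℤ) ^ (a - k) * a.choose k, fun b hb => ?_⟩
  have h := fwdDiff_iter_eq_sum_shift (1 : ℝ) (fun r : ℝ => r ^ b) a 0
  simp only [zero_add, nsmul_eq_mul, mul_one, zsmul_eq_mul] at h
  rw [← h]
  split_ifs with hba
  · subst hba; rw [fwdDiff_iter_eq_factorial]; simp
  · rw [fwdDiff_iter_pow_eq_zero_of_lt (by omega)]; simp

/-- The coefficients of a form of degree `k` are, up to the factor `k! ^ d`, integer combinations
of its values on the grid `{0, …, k} ^ d`: mixed finite differences of order `α` at the origin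
annihilate every monomial of degree `k` other than `x ^ α`. -/
lemma exists_interpolation (d k : ℕ) : ∃ K : ℕ, 1 ≤ K ∧
    ∀ α ∈ Finset.piAntidiag (Finset.univ : Finset (Fin d)) k, ∃ μ : (Fin d → ℕ) → ℤ,
    (∀ v, |μ v| ≤ K) ∧ ∀ c : (Fin d → ℕ) → ℝ,
      ∑ v ∈ Fintype.piFinset (fun _ : Fin d => Finset.range (k + 1)),
        (μ v : ℝ) * homForm k c (fun i => (v i : ℝ)) = (k.factorial : ℝ) ^ d * c α := by
  classical
  have key : ∀ α ∈ Finset.piAntidiag (Finset.univ : Finset (Fin d)) k, ∃ μ : (Fin d → ℕ) → ℤ,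
      ∃ K : ℕ, (∀ v, |μ v| ≤ K) ∧ ∀ c : (Fin d → ℕ) → ℝ,
      ∑ v ∈ Fintype.piFinset (fun _ : Fin d => Finset.range (k + 1)),
        (μ v : ℝ) * homForm k c (fun i => (v i : ℝ)) = (k.factorial : ℝ) ^ d * c α := by
    intro α hα
    have hαs : ∑ i, α i = k := (Finset.mem_piAntidiag.1 hα).1
    have hαk : ∀ i, α i ≤ k := fun i => by
      rw [← hαs]; exact Finset.single_le_sum (fun i _ => Nat.zero_le _) (Finset.mem_univ i)
    choose ν hν using fun i => exists_sum_choose_mul_pow (α i)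
    set V := Fintype.piFinset (fun _ : Fin d => Finset.range (k + 1))
    set Vα := Fintype.piFinset (fun i : Fin d => Finset.range (α i + 1))
    have hsub : Vα ⊆ V := Fintype.piFinset_subset _ _ fun i =>
      Finset.range_subset_range.2 (by have := hαk i; omega)
    set F : ℕ := ∏ i, (k.factorial / (α i).factorial) with hF
    have hFr : (F : ℝ) * ∏ i, ((α i).factorial : ℝ) = (k.factorial : ℝ) ^ d := by
      have : F * ∏ i, (α i).factorial = k.factorial ^ d := by
        rw [hF, ← Finset.prod_mul_distrib]
        rw [Finset.prod_congr rfl fun i _ =>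
          Nat.div_mul_cancel (Nat.factorial_dvd_factorial (hαk i))]
        simp
      exact_mod_cast this
    set μ : (Fin d → ℕ) → ℤ := fun v => if v ∈ Vα then F * ∏ i, ν i (v i) else 0 with hμ
    have hmon : ∀ β ∈ Finset.piAntidiag (Finset.univ : Finset (Fin d)) k,
        ∑ v ∈ V, (μ v : ℝ) * monom β (fun i => (v i : ℝ))
          = if β = α then (k.factorial : ℝ) ^ d else 0 := by
      intro β hβ
      have hβs : ∑ i, β i = k := (Finset.mem_piAntidiag.1 hβ).1
      have h1 : ∑ v ∈ V, (μ v : ℝ) * monom β (fun i => (v i : ℝ))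
          = ∑ v ∈ Vα, (F : ℝ) * ∏ i, ((ν i (v i) : ℝ) * (v i : ℝ) ^ β i) := by
        rw [← Finset.sum_subset hsub (fun v _ hv => by simp [hμ, hv])]
        refine Finset.sum_congr rfl fun v hv => ?_
        simp only [hμ, if_pos hv, monom, Finset.prod_mul_distrib]
        push_cast; ring
      rw [h1, ← Finset.mul_sum, ← Finset.prod_univ_sum (fun i => Finset.range (α i + 1))
        (fun i j => (ν i j : ℝ) * (j : ℝ) ^ β i)]
      split_ifs with hβα
      · subst hβα
        rw [← hFr]
        congr 1
        refine Finset.prod_congr rfl fun i _ => ?_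
        rw [hν i _ le_rfl, if_pos rfl]
      · obtain ⟨i, hi⟩ : ∃ i, β i < α i := by
          by_contra! hcon
          apply hβα
          -- multiindices of the same size, one of which dominates the other, agree
          have := (Finset.sum_eq_sum_iff_of_le (s := Finset.univ) (f := α) (g := β)
            (fun i _ => hcon i)).1 (by rw [hαs, hβs])
          exact funext fun i => (this i (Finset.mem_univ i)).symm
        rw [Finset.prod_eq_zero (Finset.mem_univ i), mul_zero]
        rw [hν i _ hi.le, if_neg hi.ne]
    refine ⟨μ, ∑ v ∈ Vα, (μ v).natAbs, fun v => ?_, fun c => ?_⟩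
    · by_cases hv : v ∈ Vα
      · have : (μ v).natAbs ≤ ∑ v ∈ Vα, (μ v).natAbs :=
          Finset.single_le_sum (f := fun v => (μ v).natAbs) (fun _ _ => Nat.zero_le _) hv
        rw [Int.abs_eq_natAbs]; exact_mod_cast this
      · simp only [hμ, if_neg hv, abs_zero]; positivity
    · simp only [homForm, Finset.mul_sum]
      rw [Finset.sum_comm]
      have : ∀ β ∈ Finset.piAntidiag (Finset.univ : Finset (Fin d)) k,
          ∑ v ∈ V, (μ v : ℝ) * (c β * monom β (fun i => (v i : ℝ)))
            = if β = α then (k.factorial : ℝ) ^ d * c α else 0 := by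
        intro β hβ
        have e : ∑ v ∈ V, (μ v : ℝ) * (c β * monom β (fun i => (v i : ℝ)))
            = c β * ∑ v ∈ V, (μ v : ℝ) * monom β (fun i => (v i : ℝ)) := by
          rw [Finset.mul_sum]; exact Finset.sum_congr rfl fun v _ => by ring
        rw [e, hmon β hβ]
        split_ifs with h
        · rw [h, mul_comm]
        · simp
      rw [Finset.sum_congr rfl this, Finset.sum_ite_eq' _ α, if_pos hα]
  choose! μ K hK hμ using key
  refine ⟨1 + ∑ α ∈ Finset.piAntidiag Finset.univ k, K α, by omega, fun α hα =>
    ⟨μ α, fun v => (hK α hα v).trans ?_, hμ α hα⟩⟩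
  have : K α ≤ ∑ α ∈ Finset.piAntidiag Finset.univ k, K α :=
    Finset.single_le_sum (f := K) (fun _ _ => Nat.zero_le _) hα
  exact_mod_cast (by omega : K α ≤ 1 + ∑ α ∈ Finset.piAntidiag Finset.univ k, K α)

open Polynomial in
lemma natDegree_prod_le_and_coeff {ι : Type*} (s : Finset ι) (f : ι → ℝ[X]) (n : ι → ℕ)
    (h : ∀ i ∈ s, (f i).natDegree ≤ n i) :
    (∏ i ∈ s, f i).natDegree ≤ ∑ i ∈ s, n i ∧
      (∏ i ∈ s, f i).coeff (∑ i ∈ s, n i) = ∏ i ∈ s, (f i).coeff (n i) := by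
  classical
  induction s using Finset.induction_on with
  | empty => simp
  | insert a s ha ih =>
    obtain ⟨h1, h2⟩ := ih fun i hi => h i (Finset.mem_insert_of_mem hi)
    have h3 := h a (Finset.mem_insert_self _ _)
    rw [Finset.prod_insert ha, Finset.sum_insert ha, Finset.prod_insert ha]
    exact ⟨natDegree_mul_le_of_le h3 h1, by rw [coeff_mul_add_eq_of_natDegree_le h3 h1, h2]⟩

open Polynomial in
/-- The restriction of a polynomial to a line `t ↦ x + t u`; its leading coefficient is the value
of the leading form at `u`. -/
lemma exists_line_polynomial {d : ℕ} (D : ℕ) (c : (Fin d → ℕ) → ℝ) (x u : Fin d → ℝ) :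
    ∃ f : ℝ[X], f.natDegree ≤ D ∧ f.coeff D = homForm D c u ∧
      ∀ t : ℝ, f.eval t = polySum D c (fun i => x i + t * u i) := by
  set g : (Fin d → ℕ) → ℝ[X] := fun α => ∏ i, (C (x i) + C (u i) * X) ^ α i with hg
  have hlin : ∀ i, (C (x i) + C (u i) * X : ℝ[X]).natDegree ≤ 1 := fun i => by
    rw [add_comm]; exact natDegree_linear_le
  have hgd : ∀ k, ∀ α ∈ Finset.piAntidiag (Finset.univ : Finset (Fin d)) k,
      (g α).natDegree ≤ k ∧ (g α).coeff k = monom α u := by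
    intro k α hα
    have hs : ∑ i, α i = k := (Finset.mem_piAntidiag.1 hα).1
    have := natDegree_prod_le_and_coeff Finset.univ
      (fun i => (C (x i) + C (u i) * X : ℝ[X]) ^ α i) α
      (fun i _ => (natDegree_pow_le_of_le _ (hlin i)).trans (by simp))
    rw [hs] at this
    refine ⟨this.1, this.2.trans (Finset.prod_congr rfl fun i _ => ?_)⟩
    have h2 := coeff_pow_of_natDegree_le (m := α i) (hlin i)
    rw [mul_one] at h2
    rw [h2]; simp
  refine ⟨∑ k ∈ Finset.range (D + 1), ∑ α ∈ Finset.piAntidiag Finset.univ k, C (c α) * g α,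
    ?_, ?_, ?_⟩
  · refine natDegree_sum_le_of_forall_le _ _ fun k hk => natDegree_sum_le_of_forall_le _ _
      fun α hα => (natDegree_C_mul_le _ _).trans ((hgd k α hα).1.trans ?_)
    rw [Finset.mem_range] at hk; omega
  · rw [finsetSum_coeff, Finset.sum_range_succ, Finset.sum_eq_zero, zero_add, finsetSum_coeff]
    · exact Finset.sum_congr rfl fun α hα => by rw [coeff_C_mul, (hgd D α hα).2]
    · intro k hk
      rw [finsetSum_coeff]
      refine Finset.sum_eq_zero fun α hα => ?_
      rw [Finset.mem_range] at hk
      rw [coeff_C_mul, coeff_eq_zero_of_natDegree_lt ((hgd k α hα).1.trans_lt hk), mul_zero]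
  · intro t
    simp only [eval_finsetSum, polySum, homForm, hg, monom, eval_mul, eval_C, eval_prod, eval_pow,
      eval_add, eval_X]
    refine Finset.sum_congr rfl fun k _ => Finset.sum_congr rfl fun α _ => ?_
    congr 1
    exact Finset.prod_congr rfl fun i _ => by rw [mul_comm (u i)]

lemma homForm_smul {d : ℕ} (k : ℕ) (c : (Fin d → ℕ) → ℝ) (a : ℝ) (x : Fin d → ℝ) :
    homForm k c (fun i => a * x i) = a ^ k * homForm k c x := by
  unfold homForm
  rw [Finset.mul_sum]
  refine Finset.sum_congr rfl fun α hα => ?_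
  have hs : ∑ i, α i = k := (Finset.mem_piAntidiag.1 hα).1
  simp only [monom, mul_pow, Finset.prod_mul_distrib, Finset.prod_pow_eq_pow_sum, hs]
  ring

/-! ### Weyl's inequality in several variables -/

/-- The lattice points of the cube `[-N, N]^d`. -/
noncomputable def box (d N : ℕ) : Finset (Fin d → ℤ) := Finset.Icc (fun _ => -(N : ℤ)) (fun _ => (N : ℤ))

lemma mem_box {d N : ℕ} {x : Fin d → ℤ} : x ∈ box d N ↔ ∀ i, |x i| ≤ N := by
  simp only [box, Finset.mem_Icc, Pi.le_def, abs_le, forall_and]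

lemma card_box (d N : ℕ) : (box d N).card = (2 * N + 1) ^ d := by
  rw [box, Pi.card_Icc]
  simp only [Int.card_Icc, Finset.prod_const, Finset.card_univ, Fintype.card_fin]
  congr 1; omega

lemma sum_box_shift {d : ℕ} {E : Type*} [AddCommMonoid E] (N M : ℕ) (u : (Fin d → ℤ) → E)
    (a : Fin d → ℤ) (hu : ∀ x, x ∉ box d N → u x = 0) (hM : ∀ i, (N : ℤ) + |a i| ≤ M) :
    ∑ x ∈ box d M, u (x + a) = ∑ x ∈ box d N, u x := by
  classical
  have h1 : ∑ x ∈ box d M, u (x + a) = ∑ x ∈ (box d M).map (addRightEmbedding a), u x := by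
    rw [Finset.sum_map]; rfl
  rw [h1]
  symm
  apply Finset.sum_subset
  · intro x hx
    rw [Finset.mem_map]
    refine ⟨x - a, ?_, by simp⟩
    rw [mem_box] at *
    intro i
    have := hx i
    have h2 := hM i
    have h3 := abs_sub (x i) (a i)
    rw [Pi.sub_apply]; omega
  · intro x _ hx; exact hu x hx

/-- Weights on `[-N, N]^d` bounded by one and Lipschitz, with constant `A / N`, along each residue
class modulo `Q`. The congruence makes the class stable under multiplication by phases whose
coefficients are close to rationals with denominator dividing `Q`. -/
structure LipWeight {d : ℕ} (N : ℕ) (A : ℝ) (Q : ℕ) (w : (Fin d → ℤ) → ℂ) : Prop where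
  norm_le : ∀ x, ‖w x‖ ≤ 1
  supp : ∀ x, x ∉ box d N → w x = 0
  lip : ∀ x y, (∀ i, (Q : ℤ) ∣ y i - x i) →
    ‖w y - w x‖ ≤ A / N * ∑ i, |(y i : ℝ) - x i|

/-- Some line in direction `u`, with a tent cutoff, carries a large part of a large sum. -/
lemma exists_line_sum_large {d : ℕ} (N R : ℕ) (hN : 1 ≤ N) (F : (Fin d → ℤ) → ℂ)
    (hF : ∀ x, x ∉ box d N → F x = 0) (u : Fin d → ℤ) (hu : ∀ i, |u i| ≤ R) {S : ℝ}
    (hS : S * (2 * (N + N * R) + 1) ^ d ≤ N / 2 * ‖∑ x ∈ box d N, F x‖) :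
    ∃ x : Fin d → ℤ, S ≤ ‖∑ t ∈ Finset.Icc (-(N : ℤ)) N,
      ((max 0 (1 - |(t : ℝ)| / N) : ℝ) : ℂ) * F (x + t • u)‖ := by
  have hNr : (1 : ℝ) ≤ N := by exact_mod_cast hN
  set τ : ℤ → ℝ := fun t => max 0 (1 - |(t : ℝ)| / N) with hτ
  set M := N + N * R with hM
  by_contra! hcon
  have hτsum : (N : ℝ) / 2 ≤ ∑ t ∈ Finset.Icc (-(N : ℤ)) N, τ t := by
    have h1 : ∑ t ∈ Finset.Icc (-((N / 2 : ℕ) : ℤ)) (N / 2 : ℕ), (1 / 2 : ℝ)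
        ≤ ∑ t ∈ Finset.Icc (-(N : ℤ)) N, τ t := by
      refine (Finset.sum_le_sum (g := τ) fun t ht => ?_).trans
        (Finset.sum_le_sum_of_subset_of_nonneg ?_ fun t _ _ => le_max_left _ _)
      · rw [Finset.mem_Icc, ← abs_le] at ht
        refine le_trans ?_ (le_max_right _ _)
        have h2 : 2 * |t| ≤ N := by omega
        have h3 : 2 * |(t : ℝ)| ≤ N := by exact_mod_cast h2
        have : |(t : ℝ)| / N ≤ 1 / 2 := by
          rw [div_le_iff₀ (by linarith)]; linarith
        linarith
      · apply Finset.Icc_subset_Icc <;> omega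
    refine le_trans ?_ h1
    rw [Finset.sum_const, Int.card_Icc, nsmul_eq_mul]
    have : N ≤ (((N / 2 : ℕ) : ℤ) + 1 - -((N / 2 : ℕ) : ℤ)).toNat := by omega
    have : (N : ℝ) ≤ ((((N / 2 : ℕ) : ℤ) + 1 - -((N / 2 : ℕ) : ℤ)).toNat : ℝ) := by
      exact_mod_cast this
    linarith
  -- Averaging the sum over its translates along `u` expresses it through sums over lines.
  have hswap : ((∑ t ∈ Finset.Icc (-(N : ℤ)) N, τ t : ℝ) : ℂ) * ∑ x ∈ box d N, F x
      = ∑ x ∈ box d M, ∑ t ∈ Finset.Icc (-(N : ℤ)) N, (τ t : ℂ) * F (x + t • u) := by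
    rw [Finset.sum_comm]
    push_cast
    rw [Finset.sum_mul]
    refine Finset.sum_congr rfl fun t ht => ?_
    rw [← Finset.mul_sum, sum_box_shift N M F (t • u) hF]
    intro i
    rw [Finset.mem_Icc, ← abs_le] at ht
    rw [Pi.smul_apply, smul_eq_mul, abs_mul, hM]
    push_cast
    have := mul_le_mul ht (hu i) (abs_nonneg _) (by positivity)
    linarith
  have hlt : ‖((∑ t ∈ Finset.Icc (-(N : ℤ)) N, τ t : ℝ) : ℂ) * ∑ x ∈ box d N, F x‖
      < S * (2 * (N + N * R) + 1) ^ d := by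
    rw [hswap]
    refine (norm_sum_le _ _).trans_lt ?_
    have : ∑ x ∈ box d M, ‖∑ t ∈ Finset.Icc (-(N : ℤ)) N, (τ t : ℂ) * F (x + t • u)‖
        < ∑ x ∈ box d M, S :=
      Finset.sum_lt_sum_of_nonempty ⟨0, by rw [mem_box]; intro i; simp⟩ fun x _ => hcon x
    refine this.trans_le (le_of_eq ?_)
    rw [Finset.sum_const, card_box, nsmul_eq_mul, hM]
    push_cast; ring
  rw [norm_mul, Complex.norm_real, Real.norm_eq_abs] at hlt
  have := le_abs_self (∑ t ∈ Finset.Icc (-(N : ℤ)) N, τ t)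
  have h5 := mul_le_mul_of_nonneg_right (hτsum.trans this) (norm_nonneg (∑ x ∈ box d N, F x))
  linarith

lemma natCast_le_pow {A : ℝ} (hA : 2 ≤ A) (n : ℕ) : (n : ℝ) ≤ A ^ n :=
  calc (n : ℝ) ≤ 2 ^ n := by exact_mod_cast (Nat.lt_two_pow_self (n := n)).le
    _ ≤ A ^ n := by gcongr

/-- The value of the leading form at a lattice direction is close to a rational with small
denominator if the exponential sum is large. -/
lemma weyl_direction (d D R : ℕ) : ∃ C : ℕ, ∀ (A : ℝ), 2 ≤ A → ∀ (N : ℕ), 1 ≤ N →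
    ∀ Q : ℕ, (Q : ℝ) ≤ A → ∀ w : (Fin d → ℤ) → ℂ, LipWeight N A Q w →
    ∀ c : (Fin d → ℕ) → ℝ,
    (N : ℝ) ^ d / A ≤ ‖∑ x ∈ box d N, w x * expPhase (polySum (D + 1) c (fun i => (x i : ℝ)))‖ →
    ∀ v : Fin d → ℕ, (∀ i, v i ≤ R) →
    ∃ q : ℕ, 1 ≤ q ∧ (q : ℝ) ≤ A ^ C ∧ NearInt (A ^ C / N ^ (D + 1))
      (q * ((Q : ℝ) ^ (D + 1) * homForm (D + 1) c (fun i => (v i : ℝ)))) := by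
  obtain ⟨C₀, hC₀⟩ := weyl_leading_coeff D
  set e := (3 + 2 * R) + 1 with he
  set e₁ := (2 + e * d) + (1 + d * R) with he₁
  refine ⟨e₁ * C₀, fun A hA N hN Q hQA w hw c hsum v hv => ?_⟩
  have hA1 : (1 : ℝ) ≤ A := by linarith
  have hNr : (1 : ℝ) ≤ N := by exact_mod_cast hN
  set A₁ := A ^ e₁ with hA₁
  have hA₁2 : 2 ≤ A₁ := hA.trans (le_self_pow₀ hA1 (by omega))
  set F : (Fin d → ℤ) → ℂ := fun x => w x * expPhase (polySum (D + 1) c (fun i => (x i : ℝ)))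
    with hF
  have hFs : ∀ x, x ∉ box d N → F x = 0 := fun x hx => by simp [hF, hw.supp x hx]
  set u : Fin d → ℤ := fun i => (Q : ℤ) * v i with hu
  -- Steps along a direction divisible by `Q` stay in one residue class, where the weight is Lipschitz.
  obtain ⟨x, hx⟩ := exists_line_sum_large (S := N / A₁) N (Q * R) hN F hFs u (fun i => by
      rw [hu]
      have : Q * v i ≤ Q * R := Nat.mul_le_mul_left _ (hv i)
      simp only [abs_mul, Nat.abs_cast]
      exact_mod_cast this) (by
      have h1 : (2 * ((N : ℝ) + N * (Q * R : ℕ)) + 1) ≤ N * A ^ e := by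
        have h2 : (2 * ((N : ℝ) + N * (Q * R : ℕ)) + 1) ≤ N * ((3 + 2 * R : ℕ) * A ^ 1) := by
          push_cast
          have : (N : ℝ) * (Q * R) ≤ N * (A * R) := by gcongr
          nlinarith
        refine h2.trans ?_
        gcongr
        exact mul_pow_le_pow hA (3 + 2 * R) 1 (natCast_le_pow le_rfl _)
      calc N / A₁ * (2 * ((N : ℝ) + N * (Q * R : ℕ)) + 1) ^ d
          ≤ N / A₁ * (N * A ^ e) ^ d := by gcongr
        _ = N * N ^ d * (A ^ (e * d) / A₁) := by rw [mul_pow, ← pow_mul]; ring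
        _ ≤ N * N ^ d * (1 / (2 * A)) := by
            refine mul_le_mul_of_nonneg_left ?_ (by positivity)
            rw [div_le_div_iff₀ (by positivity) (by positivity), one_mul, hA₁]
            calc A ^ (e * d) * (2 * A) ≤ A ^ (e * d) * (A * A) := by gcongr
              _ = A ^ (2 + e * d) := by ring
              _ ≤ A ^ e₁ := pow_le_pow_right₀ hA1 (by omega)
        _ = N / 2 * (N ^ d / A) := by field_simp
        _ ≤ _ := by gcongr)
  obtain ⟨f, hf1, hf2, hf3⟩ := exists_line_polynomial (D + 1) c (fun i => (x i : ℝ))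
    (fun i => (Q : ℝ) * v i)
  have := hC₀ A₁ hA₁2 N hN
    (fun t => ((max 0 (1 - |(t : ℝ)| / N) : ℝ) : ℂ) * w (x + t • u))
    (fun t => by
      rw [norm_mul, Complex.norm_real, Real.norm_of_nonneg (le_max_left _ _)]
      refine mul_le_one₀ (max_le zero_le_one ?_) (norm_nonneg _) (hw.norm_le _)
      have : 0 ≤ |(t : ℝ)| / N := by positivity
      linarith)
    (fun t ht => by
      have h1 : (N : ℝ) < |(t : ℝ)| := by exact_mod_cast ht
      have : (1 : ℝ) - |(t : ℝ)| / N ≤ 0 := by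
        rw [sub_nonpos, le_div_iff₀ (by linarith)]; linarith
      simp [max_eq_left this])
    (fun t => by
      set τ : ℤ → ℝ := fun t => max 0 (1 - |(t : ℝ)| / N) with hτ
      have hτ1 : |τ (t + 1) - τ t| ≤ 1 / N := by
        refine (abs_max_sub_max_le_max _ _ _ _).trans ?_
        rw [sub_self, abs_zero]
        refine max_le (by positivity) ?_
        have e1 : 1 - |((t + 1 : ℤ) : ℝ)| / N - (1 - |(t : ℝ)| / N)
            = (|(t : ℝ)| - |((t + 1 : ℤ) : ℝ)|) / N := by ring
        rw [e1, abs_div, Nat.abs_cast]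
        gcongr
        refine (abs_abs_sub_abs_le _ _).trans ?_
        push_cast
        rw [show (t : ℝ) - (t + 1) = -1 by ring]; simp
      have hτ2 : |τ t| ≤ 1 := by
        rw [abs_of_nonneg (le_max_left _ _)]
        refine max_le zero_le_one ?_
        have : 0 ≤ |(t : ℝ)| / N := by positivity
        linarith
      have hl := hw.lip (x + t • u) (x + (t + 1) • u) (fun i => by
        simp only [Pi.add_apply, Pi.smul_apply, smul_eq_mul, hu]
        exact ⟨v i, by ring⟩)
      have hs : ∑ i, |(((x + (t + 1) • u) i : ℤ) : ℝ) - ((x + t • u) i : ℤ)| ≤ A * (d * R) := by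
        calc ∑ i, |(((x + (t + 1) • u) i : ℤ) : ℝ) - ((x + t • u) i : ℤ)|
            ≤ ∑ i : Fin d, A * R := by
              refine Finset.sum_le_sum fun i _ => ?_
              have e2 : (((x + (t + 1) • u) i : ℤ) : ℝ) - ((x + t • u) i : ℤ) = Q * v i := by
                simp only [Pi.add_apply, Pi.smul_apply, smul_eq_mul, hu]; push_cast; ring
              rw [e2, abs_of_nonneg (by positivity)]
              have := hv i
              gcongr
          _ = A * (d * R) := by simp; ring
      have e3 : (τ (t + 1) : ℂ) * w (x + (t + 1) • u) - (τ t : ℂ) * w (x + t • u)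
          = ((τ (t + 1) - τ t : ℝ) : ℂ) * w (x + (t + 1) • u)
            + (τ t : ℂ) * (w (x + (t + 1) • u) - w (x + t • u)) := by push_cast; ring
      change ‖(τ (t + 1) : ℂ) * w (x + (t + 1) • u) - (τ t : ℂ) * w (x + t • u)‖ ≤ _
      rw [e3]
      refine (norm_add_le _ _).trans ?_
      rw [norm_mul, norm_mul, Complex.norm_real, Complex.norm_real, Real.norm_eq_abs,
        Real.norm_eq_abs]
      have h1 := mul_le_mul hτ1 (hw.norm_le (x + (t + 1) • u)) (norm_nonneg _) (by positivity)
      have h2 := mul_le_mul hτ2 hl (norm_nonneg _) zero_le_one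
      have h3 : A / N * ∑ i, |(((x + (t + 1) • u) i : ℤ) : ℝ) - ((x + t • u) i : ℤ)|
          ≤ A / N * (A * (d * R)) := by gcongr
      have h4 : 1 / (N : ℝ) * 1 + A / N * (A * (d * R)) ≤ A₁ / N := by
        have : 1 / (N : ℝ) * 1 + A / N * (A * (d * R)) = (1 + A ^ 2 * (d * R)) / N := by ring
        rw [this]
        gcongr
        calc 1 + A ^ 2 * (d * R) ≤ (1 + d * R : ℕ) * A ^ 2 := by
              push_cast; nlinarith [one_le_pow₀ hA1 (n := 2)]
          _ ≤ A ^ ((1 + d * R) + 2) := mul_pow_le_pow hA _ _ (natCast_le_pow le_rfl _)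
          _ ≤ A₁ := pow_le_pow_right₀ hA1 (by rw [he₁]; omega)
      linarith)
    f hf1
    (by
      refine hx.trans (le_of_eq ?_)
      congr 1
      refine Finset.sum_congr rfl fun t _ => ?_
      have hpt : (fun i => (x i : ℝ) + t * ((Q : ℝ) * v i))
          = fun i => (((x + t • u) i : ℤ) : ℝ) := by
        funext i
        simp only [Pi.add_apply, Pi.smul_apply, smul_eq_mul, hu]; push_cast; ring
      rw [hf3, hpt, mul_assoc])
  obtain ⟨q, hq1, hq2, hq3⟩ := this
  rw [hf2, homForm_smul] at hq3
  rw [hA₁, ← pow_mul] at hq2 hq3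
  exact ⟨q, hq1, hq2, hq3⟩

/-- All leading coefficients are close to rationals with one small denominator if the exponential
sum is large. -/
lemma weyl_leading_form (d D : ℕ) : ∃ C : ℕ, ∀ (A : ℝ), 2 ≤ A → ∀ (N : ℕ), 1 ≤ N →
    ∀ Q : ℕ, 1 ≤ Q → (Q : ℝ) ≤ A → ∀ w : (Fin d → ℤ) → ℂ, LipWeight N A Q w →
    ∀ c : (Fin d → ℕ) → ℝ,
    (N : ℝ) ^ d / A ≤ ‖∑ x ∈ box d N, w x * expPhase (polySum (D + 1) c (fun i => (x i : ℝ)))‖ →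
    ∃ q : ℕ, 1 ≤ q ∧ (q : ℝ) ≤ A ^ C ∧ ∀ α ∈ Finset.piAntidiag Finset.univ (D + 1),
      NearInt (A ^ C / N ^ (D + 1)) (q * c α) := by
  obtain ⟨C₁, hC₁⟩ := weyl_direction d D (D + 1)
  obtain ⟨K, hK1, hK⟩ := exists_interpolation d (D + 1)
  set V := Fintype.piFinset (fun _ : Fin d => Finset.range (D + 1 + 1)) with hV
  set F := (D + 1).factorial ^ d with hF
  set E := C₁ * V.card + C₁ + (D + 1) + F + V.card * K with hE
  refine ⟨E, fun A hA N hN Q hQ hQA w hw c hsum => ?_⟩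
  have hA1 : (1 : ℝ) ≤ A := by linarith
  have hdir : ∀ v ∈ V, ∃ q : ℕ, 1 ≤ q ∧ (q : ℝ) ≤ A ^ C₁ ∧ NearInt (A ^ C₁ / N ^ (D + 1))
      (q * ((Q : ℝ) ^ (D + 1) * homForm (D + 1) c (fun i => (v i : ℝ)))) := by
    intro v hv
    refine hC₁ A hA N hN Q hQA w hw c hsum v fun i => ?_
    have := Fintype.mem_piFinset.1 hv i
    rw [Finset.mem_range] at this; omega
  choose! q hq1 hq2 hq3 using hdir
  have hprod : ∀ s ⊆ V, ((∏ v ∈ s, q v : ℕ) : ℝ) ≤ A ^ (C₁ * V.card) := by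
    intro s hs
    push_cast
    calc ∏ v ∈ s, (q v : ℝ) ≤ ∏ v ∈ s, A ^ C₁ :=
          Finset.prod_le_prod (fun _ _ => Nat.cast_nonneg _) fun v hv => hq2 v (hs hv)
      _ = A ^ (C₁ * s.card) := by rw [Finset.prod_const, ← pow_mul]
      _ ≤ _ := pow_le_pow_right₀ hA1 (Nat.mul_le_mul_left _ (Finset.card_le_card hs))
  -- The denominators of the values at all grid points multiply up to a common denominator for the
  -- coefficients, by interpolation.
  refine ⟨(∏ v ∈ V, q v) * Q ^ (D + 1) * F, ?_, ?_, fun α hα => ?_⟩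
  · have h1 : 0 < ∏ v ∈ V, q v := Finset.prod_pos fun v hv => hq1 v hv
    have h2 : 0 < F := by positivity
    have h3 : 0 < Q ^ (D + 1) := by positivity
    exact Nat.mul_pos (Nat.mul_pos h1 h3) h2
  · rw [Nat.cast_mul, Nat.cast_mul, Nat.cast_pow]
    calc ((∏ v ∈ V, q v : ℕ) : ℝ) * (Q : ℝ) ^ (D + 1) * F
        ≤ A ^ (C₁ * V.card) * A ^ (D + 1) * A ^ F := by
          gcongr
          · exact hprod V subset_rfl
          · exact natCast_le_pow hA F
      _ = A ^ (C₁ * V.card + (D + 1) + F) := by rw [← pow_add, ← pow_add]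
      _ ≤ A ^ E := pow_le_pow_right₀ hA1 (by rw [hE]; omega)
  · obtain ⟨μ, hμ1, hμ2⟩ := hK α hα
    have e : (((∏ v ∈ V, q v) * Q ^ (D + 1) * F : ℕ) : ℝ) * c α
        = ∑ v ∈ V, ((μ v * (∏ v' ∈ V.erase v, q v' : ℕ) : ℤ) : ℝ)
          * (q v * ((Q : ℝ) ^ (D + 1) * homForm (D + 1) c (fun i => (v i : ℝ)))) := by
      have h1 : ∀ v ∈ V, ((μ v * (∏ v' ∈ V.erase v, q v' : ℕ) : ℤ) : ℝ)
          * (q v * ((Q : ℝ) ^ (D + 1) * homForm (D + 1) c (fun i => (v i : ℝ))))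
          = ((∏ v ∈ V, q v : ℕ) : ℝ) * (Q : ℝ) ^ (D + 1)
            * (μ v * homForm (D + 1) c (fun i => (v i : ℝ))) := by
        intro v hv
        rw [← Finset.mul_prod_erase V q hv]
        push_cast; ring
      rw [Finset.sum_congr rfl h1, ← Finset.mul_sum, hμ2, hF]
      push_cast; ring
    rw [e]
    refine (NearInt.sum V _ _ fun v hv => (hq3 v hv).int_mul _).mono ?_
    have h2 : ∀ v ∈ V, |((μ v * (∏ v' ∈ V.erase v, q v' : ℕ) : ℤ) : ℝ)| * (A ^ C₁ / N ^ (D + 1))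
        ≤ K * A ^ (C₁ * V.card) * (A ^ C₁ / N ^ (D + 1)) := by
      intro v hv
      gcongr
      rw [Int.cast_mul, abs_mul]
      have h3 : |((μ v : ℤ) : ℝ)| ≤ K := by exact_mod_cast hμ1 v
      have h4 : |(((∏ v' ∈ V.erase v, q v' : ℕ) : ℤ) : ℝ)| ≤ A ^ (C₁ * V.card) := by
        rw [Int.cast_natCast, Nat.abs_cast]; exact hprod _ (Finset.erase_subset _ _)
      gcongr
    refine (Finset.sum_le_sum h2).trans ?_
    rw [Finset.sum_const, nsmul_eq_mul]
    calc (V.card : ℝ) * (K * A ^ (C₁ * V.card) * (A ^ C₁ / N ^ (D + 1)))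
        = ((V.card * K : ℕ) * A ^ (C₁ * V.card + C₁)) / N ^ (D + 1) := by
          rw [pow_add]; push_cast; ring
      _ ≤ A ^ E / N ^ (D + 1) := by
          gcongr
          refine (mul_pow_le_pow hA (V.card * K) _ (natCast_le_pow le_rfl _)).trans ?_
          exact pow_le_pow_right₀ hA1 (by rw [hE]; omega)

/-- A form whose coefficients are close to rationals with denominator `q` is slowly varying modulo
one along residue classes modulo `q`, so that its phase may be absorbed into the weight. -/
lemma LipWeight.mul_expPhase_homForm {d N Q q D : ℕ} {A B : ℝ} {w : (Fin d → ℤ) → ℂ}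
    (hN : 1 ≤ N) (hw : LipWeight N A Q w) (hB : 0 ≤ B) (hq : 1 ≤ q)
    (c : (Fin d → ℕ) → ℝ)
    (hc : ∀ α ∈ Finset.piAntidiag Finset.univ (D + 1), NearInt (B / N ^ (D + 1)) (q * c α)) :
    LipWeight N (A + 7 * ((Finset.piAntidiag (Finset.univ : Finset (Fin d)) (D + 1)).card
      * (D + 1) * B)) (Q * q)
      (fun x => w x * expPhase (homForm (D + 1) c (fun i => (x i : ℝ)))) := by
  have hNr : (1 : ℝ) ≤ N := by exact_mod_cast hN
  set T := Finset.piAntidiag (Finset.univ : Finset (Fin d)) (D + 1) with hT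
  refine ⟨fun x => by rw [norm_mul, norm_expPhase, mul_one]; exact hw.norm_le x,
    fun x hx => by rw [hw.supp x hx, zero_mul], fun x y hxy => ?_⟩
  have hl := hw.lip x y fun i => (Dvd.intro _ (by push_cast; rfl)).trans (hxy i)
  set s := ∑ i, |(y i : ℝ) - x i| with hs
  have hs0 : 0 ≤ s := Finset.sum_nonneg fun _ _ => abs_nonneg _
  have hAle : A / N * s ≤ (A + 7 * (T.card * (D + 1) * B)) / N * s := by
    have : 0 ≤ 7 * (T.card * (D + 1) * B) := by positivity
    gcongr; linarith
  by_cases hx : x ∈ box d N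
  swap
  · simp only [hw.supp x hx, zero_mul, sub_zero, norm_mul, norm_expPhase, mul_one] at hl ⊢
    exact hl.trans hAle
  by_cases hy : y ∈ box d N
  swap
  · simp only [hw.supp y hy, zero_mul, zero_sub, norm_neg, norm_mul, norm_expPhase, mul_one]
      at hl ⊢
    exact hl.trans hAle
  rw [mem_box] at hx hy
  have hnear : NearInt (T.card * (D + 1) * B / N * s)
      (homForm (D + 1) c (fun i => (y i : ℝ)) - homForm (D + 1) c (fun i => (x i : ℝ))) := by
    have e1 : homForm (D + 1) c (fun i => (y i : ℝ)) - homForm (D + 1) c (fun i => (x i : ℝ))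
        = ∑ α ∈ T, c α * (monom α (fun i => (y i : ℝ)) - monom α (fun i => (x i : ℝ))) := by
      simp only [homForm, ← Finset.sum_sub_distrib, mul_sub, hT]
    rw [e1]
    have h1 : ∀ α ∈ T, NearInt ((D + 1) * B / N * s)
        (c α * (monom α (fun i => (y i : ℝ)) - monom α (fun i => (x i : ℝ)))) := by
      intro α hα
      have hαs : ∑ i, α i = D + 1 := (Finset.mem_piAntidiag.1 hα).1
      obtain ⟨m, hm⟩ : (q : ℤ) ∣ ∏ i, y i ^ α i - ∏ i, x i ^ α i := by
        apply Int.ModEq.dvd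
        refine Int.ModEq.prod fun i _ => Int.ModEq.pow _ ?_
        exact (Int.modEq_iff_dvd.2 ((Dvd.intro_left (Q : ℤ) (by push_cast; rfl)).trans (hxy i)))
      have hmr : monom α (fun i => (y i : ℝ)) - monom α (fun i => (x i : ℝ)) = q * m := by
        simp only [monom]; exact_mod_cast hm
      have h2 := abs_monom_sub_le α (fun i => (x i : ℝ)) (fun i => (y i : ℝ)) (R := N)
        (by linarith) (fun i => by exact_mod_cast hx i) (fun i => by exact_mod_cast hy i)
      rw [hαs, hmr, abs_mul, Nat.abs_cast] at h2
      have h3 : ∑ i, (α i : ℝ) * |(y i : ℝ) - x i| ≤ (D + 1) * s := by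
        rw [hs, Finset.mul_sum]
        refine Finset.sum_le_sum fun i _ => ?_
        gcongr
        have : α i ≤ D + 1 := by
          rw [← hαs]; exact Finset.single_le_sum (fun i _ => Nat.zero_le _) (Finset.mem_univ i)
        exact_mod_cast this
      have h4 : |(m : ℝ)| * (B / N ^ (D + 1)) ≤ (D + 1) * B / N * s := by
        have h5 : N * |(m : ℝ)| ≤ N ^ (D + 1) * ((D + 1) * s) := by
          refine le_trans ?_ (h2.trans (by gcongr))
          have : (1 : ℝ) ≤ q := by exact_mod_cast hq
          have h0 : 0 ≤ |(m : ℝ)| := abs_nonneg _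
          gcongr; nlinarith
        have h6 : |(m : ℝ)| * (B / N ^ (D + 1))
            = N * |(m : ℝ)| * (B / (N * N ^ (D + 1))) := by field_simp
        rw [h6]
        calc N * |(m : ℝ)| * (B / (N * N ^ (D + 1)))
            ≤ N ^ (D + 1) * ((D + 1) * s) * (B / (N * N ^ (D + 1))) := by gcongr
          _ = _ := by field_simp
      have h7 := ((hc α hα).int_mul m).mono h4
      rw [hmr]
      convert h7 using 1; ring
    refine (NearInt.sum T _ _ h1).mono (le_of_eq ?_)
    rw [Finset.sum_const, nsmul_eq_mul]; ring
  have h2 := norm_expPhase_sub_le_of_nearInt hnear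
  have e2 : w y * expPhase (homForm (D + 1) c (fun i => (y i : ℝ)))
      - w x * expPhase (homForm (D + 1) c (fun i => (x i : ℝ)))
      = (w y - w x) * expPhase (homForm (D + 1) c (fun i => (y i : ℝ)))
        + w x * (expPhase (homForm (D + 1) c (fun i => (y i : ℝ)))
          - expPhase (homForm (D + 1) c (fun i => (x i : ℝ)))) := by ring
  rw [e2]
  refine (norm_add_le _ _).trans ?_
  rw [norm_mul, norm_mul, norm_expPhase, mul_one]
  have h3 := mul_le_mul (hw.norm_le x) h2 (norm_nonneg _) zero_le_one
  calc _ ≤ A / N * s + 1 * (7 * (T.card * (D + 1) * B / N * s)) := add_le_add hl h3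
    _ = _ := by ring

/-- Inverse form of Weyl's inequality: a large weighted exponential sum forces all coefficients of
the phase to be close to rationals with one small denominator. -/
theorem weyl_inverse (d D : ℕ) : ∃ C : ℕ, ∀ (A : ℝ), 2 ≤ A → ∀ (N : ℕ), 1 ≤ N →
    ∀ Q : ℕ, 1 ≤ Q → (Q : ℝ) ≤ A → ∀ w : (Fin d → ℤ) → ℂ, LipWeight N A Q w →
    ∀ c : (Fin d → ℕ) → ℝ,
    (N : ℝ) ^ d / A ≤ ‖∑ x ∈ box d N, w x * expPhase (polySum D c (fun i => (x i : ℝ)))‖ →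
    ∃ q : ℕ, 1 ≤ q ∧ (q : ℝ) ≤ A ^ C ∧ ∀ k, 1 ≤ k → k ≤ D →
      ∀ α ∈ Finset.piAntidiag Finset.univ k, NearInt (A ^ C / N ^ k) (q * c α) := by
  induction D with
  | zero =>
    exact ⟨0, fun A hA N hN Q _ _ w hw c _ => ⟨1, le_rfl, by simp, fun k h1 h2 => by omega⟩⟩
  | succ D ih =>
    obtain ⟨C₁, hC₁⟩ := weyl_leading_form d D
    obtain ⟨C₂, hC₂⟩ := ih
    set T := Finset.piAntidiag (Finset.univ : Finset (Fin d)) (D + 1) with hT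
    set e := (1 + 7 * (T.card * (D + 1))) + C₁ + 1 with he
    refine ⟨C₁ + e * C₂, fun A hA N hN Q hQ hQA w hw c hsum => ?_⟩
    have hA1 : (1 : ℝ) ≤ A := by linarith
    obtain ⟨q₁, h1, h2, h3⟩ := hC₁ A hA N hN Q hQ hQA w hw c hsum
    -- The leading form is absorbed into the weight, which leaves a phase of lower degree.
    have hw' := hw.mul_expPhase_homForm hN (by positivity) h1 c h3
    have hAe : A + 7 * (T.card * (D + 1) * A ^ C₁) ≤ A ^ e := by
      have h0 : 1 ≤ A ^ C₁ := one_le_pow₀ hA1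
      calc A + 7 * (T.card * (D + 1) * A ^ C₁)
          ≤ (1 + 7 * (T.card * (D + 1)) : ℕ) * A ^ (C₁ + 1) := by
            push_cast
            have h9 : A ≤ A ^ (C₁ + 1) := le_self_pow₀ hA1 (by omega)
            have h10 : A ^ C₁ ≤ A ^ (C₁ + 1) := pow_le_pow_right₀ hA1 (by omega)
            have h11 : (T.card * (D + 1) : ℝ) * A ^ C₁ ≤ T.card * (D + 1) * A ^ (C₁ + 1) := by
              gcongr
            linarith
        _ ≤ A ^ e := (mul_pow_le_pow hA _ _ (natCast_le_pow le_rfl _)).trans_eq (by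
            rw [he]; ring_nf)
    have hw'' : LipWeight N (A ^ e) (Q * q₁)
        (fun x => w x * expPhase (homForm (D + 1) c (fun i => (x i : ℝ)))) :=
      ⟨hw'.norm_le, hw'.supp, fun x y hxy => (hw'.lip x y hxy).trans (by
        have : 0 ≤ ∑ i, |(y i : ℝ) - x i| := Finset.sum_nonneg fun _ _ => abs_nonneg _
        gcongr)⟩
    obtain ⟨q₂, h4, h5, h6⟩ := hC₂ (A ^ e) (hA.trans (le_self_pow₀ hA1 (by omega))) N hN
      (Q * q₁) (Nat.mul_pos hQ h1) (by
        push_cast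
        calc (Q : ℝ) * q₁ ≤ A * A ^ C₁ := by gcongr
          _ = A ^ (C₁ + 1) := by ring
          _ ≤ A ^ e := pow_le_pow_right₀ hA1 (by omega)) _ hw'' c (by
        have h7 : (N : ℝ) ^ d / A ^ e ≤ N ^ d / A := by
          gcongr; exact le_self_pow₀ hA1 (by omega)
        refine h7.trans (hsum.trans (le_of_eq ?_))
        congr 1
        refine Finset.sum_congr rfl fun x _ => ?_
        rw [polySum, Finset.sum_range_succ, add_comm, expPhase_add, mul_assoc]
        rfl)
    rw [← pow_mul] at h5 h6
    refine ⟨q₁ * q₂, Nat.mul_pos h1 h4, ?_, fun k hk1 hk2 α hα => ?_⟩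
    · push_cast; rw [pow_add]; gcongr
    · rcases hk2.lt_or_eq with hlt | rfl
      · have := (h6 k hk1 (by omega) α hα).nat_mul q₁
        rw [Nat.cast_mul, mul_assoc]
        refine this.mono ?_
        rw [pow_add, mul_div_assoc']; gcongr
      · have := (h3 α hα).nat_mul q₂
        rw [Nat.cast_mul, mul_assoc, mul_left_comm]
        refine this.mono ?_
        rw [pow_add A, mul_div_assoc', mul_comm (A ^ C₁)]; gcongr

/-! ### The polynomial phase -/

section Phase

variable {d n : ℕ} (P : Fin n → MvPolynomial (Fin d) ℤ)

lemma polyMap_apply (t : EuclideanSpace ℝ (Fin d)) (i : Fin n) :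
    polyMap P t i = ∑ α ∈ (P i).support, (((P i).coeff α : ℤ) : ℝ) * monom α (fun l => t l) := by
  simp only [polyMap, MvPolynomial.aeval_def, MvPolynomial.eval₂_eq', monom]
  rfl

lemma polyMap_latticePt (y : Fin d → ℤ) (i : Fin n) :
    polyMap P (latticePt y) i = ((MvPolynomial.eval y (P i) : ℤ) : ℝ) := by
  rw [polyMap_apply, MvPolynomial.eval_eq']
  simp [monom, latticePt]

/-- The coefficients of the phase `P · ξ`. -/
noncomputable def phaseCoeff (ξ : EuclideanSpace ℝ (Fin n)) (α : Fin d → ℕ) : ℝ :=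
  ∑ i, (((P i).coeff (Finsupp.equivFunOnFinite.symm α) : ℤ) : ℝ) * ξ i

lemma phase_eq_polySum {D : ℕ} (hD : ∀ i, degs P i ≤ D) (t : EuclideanSpace ℝ (Fin d))
    (ξ : EuclideanSpace ℝ (Fin n)) :
    phase P t ξ = polySum D (phaseCoeff P ξ) (fun l => t l) := by
  have h : ∀ i, polyMap P t i = ∑ k ∈ Finset.range (D + 1),
      ∑ α ∈ Finset.piAntidiag Finset.univ k,
        (((P i).coeff (Finsupp.equivFunOnFinite.symm α) : ℤ) : ℝ) * monom α (fun l => t l) := by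
    intro i
    rw [polyMap_apply, Finset.sum_sigma']
    refine Finset.sum_bij_ne_zero (fun α _ _ => ⟨α.degree, ⇑α⟩) ?_ ?_ ?_ ?_
    · intro α hα _
      rw [Finset.mem_sigma, Finset.mem_range, Nat.lt_succ_iff, Finset.mem_piAntidiag]
      refine ⟨(MvPolynomial.le_totalDegree hα).trans (hD i), ?_, fun _ _ => Finset.mem_univ _⟩
      rw [Finsupp.degree_eq_sum]
    · intro α _ _ β _ _ hαβ
      have := (Sigma.mk.inj_iff.1 hαβ).2
      exact DFunLike.coe_injective (eq_of_heq this)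
    · rintro ⟨k, α⟩ hk hne
      rw [Finset.mem_sigma, Finset.mem_piAntidiag] at hk
      have hs : (Finsupp.equivFunOnFinite.symm α).degree = k := by
        rw [Finsupp.degree_eq_sum]; exact hk.2.1
      refine ⟨Finsupp.equivFunOnFinite.symm α, ?_, ?_, ?_⟩
      · rw [MvPolynomial.mem_support_iff]
        intro h0; apply hne; simp [h0]
      · exact hne
      · rw [Sigma.mk.inj_iff]; exact ⟨hs, HEq.rfl⟩
    · intro α _ _
      simp
  simp only [phase, h, polySum, homForm, phaseCoeff, Finset.sum_mul]
  rw [Finset.sum_comm]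
  refine Finset.sum_congr rfl fun k _ => ?_
  rw [Finset.sum_comm]
  exact Finset.sum_congr rfl fun α _ => Finset.sum_congr rfl fun i _ => by ring

/-- Dilating the variable rescales the coefficients of the phase. -/
lemma phase_smul_eq_polySum {D : ℕ} (hD : ∀ i, degs P i ≤ D) (a : ℝ)
    (t : EuclideanSpace ℝ (Fin d)) (ξ : EuclideanSpace ℝ (Fin n)) :
    phase P (a • t) ξ = polySum D (fun α => a ^ (∑ l, α l) * phaseCoeff P ξ α) (fun l => t l) := by
  rw [phase_eq_polySum P hD]
  refine Finset.sum_congr rfl fun k _ => ?_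
  have h1 : (fun l => (a • t) l) = fun l => a * t l := by ext l; simp
  rw [h1, homForm_smul, homForm, homForm, Finset.mul_sum]
  refine Finset.sum_congr rfl fun α hα => ?_
  rw [(Finset.mem_piAntidiag.1 hα).1]; ring

variable {P}

lemma IsAdmissible.one_le_degs (hP : IsAdmissible P) (i : Fin n) : 1 ≤ degs P i := by
  by_contra hcon
  have h0 : (P i).totalDegree = 0 := by unfold degs at hcon; omega
  obtain ⟨α, hα, hc⟩ := hP.coeff i
  rw [h0, Finsupp.degree_eq_zero_iff] at hα
  have h1 := hc i
  rw [if_pos rfl, hα, ← MvPolynomial.constantCoeff_eq] at h1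
  have h2 := hP.zero i
  have h3 : MvPolynomial.eval (0 : Fin d → ℤ) (P i) = MvPolynomial.constantCoeff (P i) := by
    rw [MvPolynomial.eval_zero]
  rw [h3, h1] at h2
  exact one_ne_zero h2

lemma IsAdmissible.exists_phaseCoeff (hP : IsAdmissible P) (i : Fin n) :
    ∃ α ∈ Finset.piAntidiag (Finset.univ : Finset (Fin d)) (degs P i),
      ∀ ξ, phaseCoeff P ξ α = ξ i := by
  obtain ⟨α, hα, hc⟩ := hP.coeff i
  refine ⟨⇑α, ?_, fun ξ => ?_⟩
  · rw [Finset.mem_piAntidiag]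
    exact ⟨by rw [← Finsupp.degree_eq_sum]; exact hα, fun _ _ => Finset.mem_univ _⟩
  · simp [phaseCoeff, hc]

variable (P)

/-- Lipschitz bound for the components of `P` on cubes of side at least one. -/
lemma exists_abs_polyMap_sub_le : ∃ C : ℝ, 1 ≤ C ∧ ∀ (R : ℝ), 1 ≤ R →
    ∀ s t : EuclideanSpace ℝ (Fin d), (∀ l, |s l| ≤ R) → (∀ l, |t l| ≤ R) → ∀ i,
    R * |polyMap P t i - polyMap P s i| ≤ C * R ^ degs P i * ∑ l, |t l - s l| := by
  set c : Fin n → ℝ := fun i => ∑ α ∈ (P i).support, |(((P i).coeff α : ℤ) : ℝ)| * degs P i with hc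
  have hc0 : ∀ i, 0 ≤ c i := fun i => Finset.sum_nonneg fun _ _ => by positivity
  refine ⟨1 + ∑ i, c i, by have := Finset.sum_nonneg fun i (_ : i ∈ Finset.univ) => hc0 i; linarith,
    fun R hR s t hs ht i => ?_⟩
  have hci : c i ≤ 1 + ∑ i, c i := by
    have := Finset.single_le_sum (fun i _ => hc0 i) (Finset.mem_univ i); linarith
  have hsum0 : 0 ≤ ∑ l, |t l - s l| := Finset.sum_nonneg fun _ _ => abs_nonneg _
  have e : polyMap P t i - polyMap P s i = ∑ α ∈ (P i).support, (((P i).coeff α : ℤ) : ℝ) *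
      (monom α (fun l => t l) - monom α (fun l => s l)) := by
    rw [polyMap_apply, polyMap_apply, ← Finset.sum_sub_distrib]
    exact Finset.sum_congr rfl fun _ _ => by ring
  rw [e]
  calc R * |∑ α ∈ (P i).support, (((P i).coeff α : ℤ) : ℝ) *
        (monom α (fun l => t l) - monom α (fun l => s l))|
      ≤ R * ∑ α ∈ (P i).support, |(((P i).coeff α : ℤ) : ℝ)| *
        |monom α (fun l => t l) - monom α (fun l => s l)| := by
        gcongr
        refine (Finset.abs_sum_le_sum_abs _ _).trans (le_of_eq ?_)
        exact Finset.sum_congr rfl fun _ _ => abs_mul _ _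
    _ = ∑ α ∈ (P i).support, |(((P i).coeff α : ℤ) : ℝ)| *
        (R * |monom α (fun l => t l) - monom α (fun l => s l)|) := by
        rw [Finset.mul_sum]; exact Finset.sum_congr rfl fun _ _ => by ring
    _ ≤ ∑ α ∈ (P i).support, |(((P i).coeff α : ℤ) : ℝ)| *
        (R ^ degs P i * (degs P i * ∑ l, |t l - s l|)) := by
        refine Finset.sum_le_sum fun α hα => mul_le_mul_of_nonneg_left ?_ (abs_nonneg _)
        have hdeg : ∑ l, α l ≤ degs P i := by
          have := MvPolynomial.le_totalDegree hα
          rwa [← Finsupp.degree_eq_sum]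
        refine (abs_monom_sub_le α _ _ (by linarith) hs ht).trans ?_
        gcongr
        rw [Finset.mul_sum]
        refine Finset.sum_le_sum fun l _ => ?_
        gcongr
        exact (Finset.single_le_sum (f := fun l => α l) (fun _ _ => Nat.zero_le _)
          (Finset.mem_univ l)).trans hdeg
    _ = c i * R ^ degs P i * ∑ l, |t l - s l| := by
        rw [hc]; simp only [Finset.sum_mul]
        exact Finset.sum_congr rfl fun _ _ => by ring
    _ ≤ _ := by gcongr

variable {P}

lemma IsAdmissible.exists_abs_polyMap_le (hP : IsAdmissible P) : ∃ C : ℕ, ∀ (R : ℝ), 1 ≤ R →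
    ∀ t : EuclideanSpace ℝ (Fin d), (∀ l, |t l| ≤ R) → ∀ i,
    |polyMap P t i| ≤ C * R ^ degs P i := by
  obtain ⟨C, hC1, hC⟩ := exists_abs_polyMap_sub_le P
  refine ⟨⌈C * d⌉₊, fun R hR t ht i => ?_⟩
  have h := hC R hR 0 t (fun l => by simp; linarith) ht i
  have h0 : polyMap P 0 i = 0 := by
    have h1 := polyMap_latticePt P (0 : Fin d → ℤ) i
    have h2 : (latticePt (0 : Fin d → ℤ)) = 0 := by ext l; simp [latticePt]
    rw [h2, hP.zero i] at h1
    simpa using h1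
  rw [h0, sub_zero] at h
  have h2 : ∑ l, |t l - (0 : EuclideanSpace ℝ (Fin d)) l| ≤ d * R := by
    calc ∑ l, |t l - (0 : EuclideanSpace ℝ (Fin d)) l| ≤ ∑ l : Fin d, R :=
          Finset.sum_le_sum fun l _ => by simpa using ht l
      _ = d * R := by simp
  have h3 : R * |polyMap P t i| ≤ R * (C * d * R ^ degs P i) := by
    refine h.trans ?_
    calc C * R ^ degs P i * ∑ l, |t l - (0 : EuclideanSpace ℝ (Fin d)) l|
        ≤ C * R ^ degs P i * (d * R) := by gcongr
      _ = _ := by ring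
  refine (le_of_mul_le_mul_left h3 (by linarith)).trans ?_
  gcongr
  exact Nat.le_ceil _

variable (P) in
lemma continuous_polyMap_apply (i : Fin n) :
    Continuous fun t : EuclideanSpace ℝ (Fin d) => polyMap P t i := by
  simp only [polyMap_apply, monom]; fun_prop

variable (P) in
lemma continuous_phase_left (ξ : EuclideanSpace ℝ (Fin n)) :
    Continuous fun t : EuclideanSpace ℝ (Fin d) => phase P t ξ := by
  simp only [phase]
  exact continuous_finsetSum _ fun i _ => (continuous_polyMap_apply P i).mul continuous_const

lemma continuous_phase_right (t : EuclideanSpace ℝ (Fin d)) :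
    Continuous fun ξ : EuclideanSpace ℝ (Fin n) => phase P t ξ := by
  simp only [phase]; fun_prop

end Phase

/-! ### Dyadic pieces of the kernel -/

section Kernel

variable {d : ℕ}

lemma abs_coord_le_norm {d : ℕ} (t : EuclideanSpace ℝ (Fin d)) (l : Fin d) : |t l| ≤ ‖t‖ := by
  simpa using PiLp.norm_apply_le t l

lemma norm_le_sum_abs {d : ℕ} (t : EuclideanSpace ℝ (Fin d)) : ‖t‖ ≤ ∑ l, |t l| := by
  rw [EuclideanSpace.norm_eq]
  apply Real.sqrt_le_iff.2
  refine ⟨Finset.sum_nonneg fun _ _ => abs_nonneg _, ?_⟩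
  simp only [Real.norm_eq_abs]
  exact Finset.sum_sq_le_sq_sum_of_nonneg fun _ _ => abs_nonneg _

lemma Kpiece_support {ψ : EuclideanSpace ℝ (Fin d) → ℝ} (hψ : IsDyadicPartition ψ)
    (K : EuclideanSpace ℝ (Fin d) → ℂ) (j : ℕ) {t : EuclideanSpace ℝ (Fin d)}
    (ht : Kpiece ψ K j t ≠ 0) : 2 ^ j / 2 ≤ ‖t‖ ∧ ‖t‖ ≤ 2 ^ (j + 1) := by
  have h : ψ (((2 : ℝ) ^ j)⁻¹ • t) ≠ 0 := by
    intro h; apply ht; simp [Kpiece, h]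
  have := hψ.supp _ h
  rw [norm_smul, norm_inv, norm_pow, Real.norm_ofNat, inv_mul_eq_div] at this
  have h2 : (0 : ℝ) < 2 ^ j := by positivity
  rw [le_div_iff₀ h2, div_le_iff₀ h2] at this
  rw [pow_succ]
  exact ⟨by linarith [this.1], by linarith [this.2]⟩

/-- Size and regularity of the dyadic pieces. The constant depends on the cutoff only. Since
`ψ (2⁻ʲ x)` vanishes for `|x| < 1` when `j ≥ 1`, the pieces are differentiable everywhere. -/
lemma exists_Kpiece_bounds {ψ : EuclideanSpace ℝ (Fin d) → ℝ} (hψ : IsDyadicPartition ψ) :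
    ∃ B : ℝ, 1 ≤ B ∧ ∀ K : EuclideanSpace ℝ (Fin d) → ℂ, IsCZKernel K → ∀ j : ℕ, 1 ≤ j →
      (∀ t, ‖Kpiece ψ K j t‖ ≤ B / (2 ^ j) ^ d) ∧
      (∀ s t, ‖Kpiece ψ K j t - Kpiece ψ K j s‖ ≤ B / (2 ^ j) ^ (d + 1) * ‖t - s‖) ∧
      Continuous (Kpiece ψ K j) := by
  have hcs : HasCompactSupport ψ := by
    apply HasCompactSupport.intro (isCompact_closedBall (0 : EuclideanSpace ℝ (Fin d)) 2)
    intro x hx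
    by_contra h
    exact hx (by simpa using (hψ.supp x h).2)
  have hfc : Continuous (fderiv ℝ ψ) := hψ.smooth.continuous_fderiv (by simp)
  obtain ⟨c, hc⟩ := hfc.bounded_above_of_compact_support (hcs.fderiv ℝ)
  have hc0 : 0 ≤ c := (norm_nonneg _).trans (hc 0)
  have hψd : Differentiable ℝ ψ := hψ.smooth.differentiable (by simp)
  refine ⟨(1 + c) * 2 ^ (d + 1), ?_, fun K hK j hj => ?_⟩
  · have : (1 : ℝ) ≤ 2 ^ (d + 1) := one_le_pow₀ (by norm_num)
    nlinarith
  have h2j : (0 : ℝ) < 2 ^ j := by positivity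
  have hj1 : (1 : ℝ) ≤ 2 ^ j / 2 := by
    rw [le_div_iff₀ (by norm_num), one_mul]
    calc (2 : ℝ) = 2 ^ 1 := by norm_num
      _ ≤ 2 ^ j := pow_le_pow_right₀ (by norm_num) hj
  -- kernel bounds on the support of the cutoff
  have hKs : ∀ t : EuclideanSpace ℝ (Fin d), 2 ^ j / 2 ≤ ‖t‖ →
      ‖K t‖ ≤ 2 ^ d / (2 ^ j) ^ d ∧ ‖fderiv ℝ K t‖ ≤ 2 ^ (d + 1) / (2 ^ j) ^ (d + 1) := by
    intro t ht
    have hs := hK.size t (hj1.trans ht)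
    have e : ∀ m : ℕ, (2 : ℝ) ^ m / (2 ^ j) ^ m = 1 / (2 ^ j / 2) ^ m := by
      intro m; rw [div_pow]; field_simp
    have hp : ∀ m : ℕ, (2 ^ j / 2 : ℝ) ^ m ≤ ‖t‖ ^ m := fun m =>
      pow_le_pow_left₀ (by positivity) ht m
    rw [e, e]
    constructor
    · rw [le_div_iff₀ (by positivity)]
      have h1 : 0 ≤ ‖t‖ ^ (d + 1) * ‖fderiv ℝ K t‖ := by positivity
      nlinarith [mul_le_mul_of_nonneg_right (hp d) (norm_nonneg (K t))]
    · rw [le_div_iff₀ (by positivity)]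
      have h1 : 0 ≤ ‖t‖ ^ d * ‖K t‖ := by positivity
      nlinarith [mul_le_mul_of_nonneg_right (hp (d + 1)) (norm_nonneg (fderiv ℝ K t))]
  have hψle : ∀ x, ‖(ψ x : ℂ)‖ ≤ 1 := fun x => by
    rw [Complex.norm_real, Real.norm_of_nonneg (hψ.range x).1]; exact (hψ.range x).2
  have hsize : ∀ t, ‖Kpiece ψ K j t‖ ≤ (1 + c) * 2 ^ (d + 1) / (2 ^ j) ^ d := by
    intro t
    by_cases h : Kpiece ψ K j t = 0
    · rw [h, norm_zero]; positivity
    · have := (hKs t (Kpiece_support hψ K j h).1).1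
      rw [Kpiece, norm_mul]
      calc _ ≤ 1 * (2 ^ d / (2 ^ j) ^ d) :=
            mul_le_mul (hψle _) this (norm_nonneg _) zero_le_one
        _ ≤ _ := by
            rw [one_mul]; gcongr
            have : (0 : ℝ) < 2 ^ d := by positivity
            rw [pow_succ]; nlinarith
  have hderiv : ∀ t, ∃ f' : EuclideanSpace ℝ (Fin d) →L[ℝ] ℂ,
      HasFDerivAt (Kpiece ψ K j) f' t ∧ ‖f'‖ ≤ (1 + c) * 2 ^ (d + 1) / (2 ^ j) ^ (d + 1) := by
    intro t
    by_cases ht : 2 ^ j / 2 ≤ ‖t‖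
    · obtain ⟨h1, h2⟩ := hKs t ht
      have hKd := (hK.differentiable t (hj1.trans ht)).hasFDerivAt
      have hψ1 : HasFDerivAt (fun x : EuclideanSpace ℝ (Fin d) => ψ (((2 : ℝ) ^ j)⁻¹ • x))
          ((fderiv ℝ ψ (((2 : ℝ) ^ j)⁻¹ • t)).comp
            (((2 : ℝ) ^ j)⁻¹ • ContinuousLinearMap.id ℝ _)) t :=
        (hψd _).hasFDerivAt.comp t
          (((2 : ℝ) ^ j)⁻¹ • ContinuousLinearMap.id ℝ (EuclideanSpace ℝ (Fin d))).hasFDerivAt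
      have hψ2 := (Complex.ofRealCLM.hasFDerivAt (x := ψ (((2 : ℝ) ^ j)⁻¹ • t))).comp t hψ1
      have hprod := hψ2.mul hKd
      refine ⟨_, hprod, ?_⟩
      refine (norm_add_le _ _).trans ?_
      rw [norm_smul, norm_smul]
      have hA : ‖(Complex.ofRealCLM ∘ fun x : EuclideanSpace ℝ (Fin d) =>
          ψ (((2 : ℝ) ^ j)⁻¹ • x)) t‖ ≤ 1 := hψle _
      have hB : ‖Complex.ofRealCLM.comp ((fderiv ℝ ψ (((2 : ℝ) ^ j)⁻¹ • t)).comp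
            (((2 : ℝ) ^ j)⁻¹ • ContinuousLinearMap.id ℝ (EuclideanSpace ℝ (Fin d))))‖
          ≤ c * (1 / 2 ^ j) := by
        refine (ContinuousLinearMap.opNorm_comp_le _ _).trans ?_
        rw [Complex.ofRealCLM_norm, one_mul]
        refine (ContinuousLinearMap.opNorm_comp_le _ _).trans ?_
        refine mul_le_mul (hc _) ?_ (norm_nonneg _) hc0
        rw [norm_smul, norm_inv, norm_pow, Real.norm_ofNat, one_div]
        have : ‖ContinuousLinearMap.id ℝ (EuclideanSpace ℝ (Fin d))‖ ≤ 1 :=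
          ContinuousLinearMap.norm_id_le
        have h0 : (0 : ℝ) ≤ (2 ^ j)⁻¹ := by positivity
        nlinarith
      calc _ ≤ 1 * (2 ^ (d + 1) / (2 ^ j) ^ (d + 1)) + 2 ^ d / (2 ^ j) ^ d * (c * (1 / 2 ^ j)) :=
            add_le_add (mul_le_mul hA h2 (norm_nonneg _) zero_le_one)
              (mul_le_mul h1 hB (norm_nonneg _) (by positivity))
        _ = (2 ^ (d + 1) + c * 2 ^ d) / (2 ^ j) ^ (d + 1) := by
            rw [pow_succ ((2 : ℝ) ^ j) d]; field_simp
        _ ≤ _ := by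
            gcongr
            have h3 : c * (2 : ℝ) ^ d ≤ c * 2 ^ (d + 1) := by
              gcongr <;> norm_num
            linarith
    · refine ⟨0, ?_, by rw [norm_zero]; positivity⟩
      have hev : Kpiece ψ K j =ᶠ[nhds t] fun _ => 0 := by
        have : ∀ᶠ x in nhds t, ‖x‖ < 2 ^ j / 2 :=
          continuous_norm.continuousAt.eventually_lt continuousAt_const (not_le.1 ht)
        filter_upwards [this] with x hx
        by_contra h
        exact absurd (Kpiece_support hψ K j h).1 (not_le.2 hx)
      exact (hasFDerivAt_const (0 : ℂ) t).congr_of_eventuallyEq hev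
  choose f' hf1 hf2 using hderiv
  refine ⟨hsize, fun s t => ?_, ?_⟩
  · exact convex_univ.norm_image_sub_le_of_norm_hasFDerivWithin_le
      (fun x _ => (hf1 x).hasFDerivWithinAt) (fun x _ => hf2 x) (mem_univ s) (mem_univ t)
  · exact continuous_iff_continuousAt.2 fun t => (hf1 t).continuousAt

end Kernel

/-! ### Unit cubes and Riemann sums -/

/-- The half-open unit cube with lower corner `l`. -/
def cubeAt {d : ℕ} (l : Fin d → ℤ) : Set (EuclideanSpace ℝ (Fin d)) :=
  {x | ∀ i, x i ∈ Set.Ico (l i : ℝ) (l i + 1)}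

lemma cubeAt_eq_preimage {d : ℕ} (l : Fin d → ℤ) :
    cubeAt l = WithLp.ofLp ⁻¹' (Set.univ.pi fun i => Set.Ico (l i : ℝ) (l i + 1)) := by
  ext x; simp [cubeAt]

lemma measurableSet_cubeAt {d : ℕ} (l : Fin d → ℤ) : MeasurableSet (cubeAt l) := by
  rw [cubeAt_eq_preimage]
  exact (PiLp.volume_preserving_ofLp (Fin d)).measurable
    (MeasurableSet.univ_pi fun _ => measurableSet_Ico)

lemma volume_cubeAt {d : ℕ} (l : Fin d → ℤ) : volume (cubeAt l) = 1 := by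
  rw [cubeAt_eq_preimage, (PiLp.volume_preserving_ofLp (Fin d)).measure_preimage
    (MeasurableSet.univ_pi fun _ => measurableSet_Ico).nullMeasurableSet, Real.volume_pi_Ico]
  simp

lemma iUnion_cubeAt (d : ℕ) : ⋃ l : Fin d → ℤ, cubeAt l = univ := by
  refine eq_univ_of_forall fun x => mem_iUnion.2 ⟨fun i => ⌊x i⌋, fun i => ?_⟩
  exact ⟨Int.floor_le _, Int.lt_floor_add_one _⟩

lemma pairwise_disjoint_cubeAt (d : ℕ) :
    Pairwise (Function.onFun Disjoint (fun l : Fin d → ℤ => cubeAt l)) := by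
  intro l l' hne
  rw [Function.onFun, Set.disjoint_left]
  intro x hx hx'
  apply hne
  funext i
  have h1 := Int.floor_eq_iff.2 (hx i)
  have h2 := Int.floor_eq_iff.2 (hx' i)
  rw [← h1, h2]

lemma hasSum_setIntegral_cubeAt {d : ℕ} {F : EuclideanSpace ℝ (Fin d) → ℂ} (hF : Integrable F) :
    HasSum (fun l => ∫ x in cubeAt l, F x) (∫ x, F x) := by
  have := hasSum_integral_iUnion (μ := volume) (f := F) (fun l : Fin d → ℤ => measurableSet_cubeAt l)
    (pairwise_disjoint_cubeAt d) hF.integrableOn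
  rwa [iUnion_cubeAt, setIntegral_univ] at this

lemma latticePt_apply {d : ℕ} (y : Fin d → ℤ) (i : Fin d) : latticePt y i = y i := rfl

lemma abs_intCast_le_iff {z : ℤ} {N : ℕ} : |(z : ℝ)| ≤ N ↔ |z| ≤ (N : ℤ) := by
  rw [← Int.cast_abs]; exact_mod_cast Iff.rfl

/-- Comparison of the sum over the lattice with the integral for a Lipschitz function supported in
a cube of side `2R`. -/
lemma norm_tsum_sub_integral_le {d : ℕ} {G : EuclideanSpace ℝ (Fin d) → ℂ} (hG : Continuous G)
    {L : ℝ} (hL0 : 0 ≤ L) (hL : ∀ s t, ‖G t - G s‖ ≤ L * ∑ l, |t l - s l|) (R : ℕ)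
    (hR : ∀ t, G t ≠ 0 → ∀ l, |t l| ≤ R) :
    ‖∑' y : Fin d → ℤ, G (latticePt y) - ∫ t, G t‖ ≤ L * d * (2 * R + 3) ^ d := by
  have hcs : HasCompactSupport G := by
    apply HasCompactSupport.intro
      (isCompact_closedBall (0 : EuclideanSpace ℝ (Fin d)) (∑ _l : Fin d, (R : ℝ)))
    intro x hx
    by_contra h
    apply hx
    rw [mem_closedBall_zero_iff]
    exact (norm_le_sum_abs x).trans (Finset.sum_le_sum fun l _ => hR x h l)
  have hint := hasSum_setIntegral_cubeAt (hG.integrable_of_hasCompactSupport hcs)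
  have hz1 : ∀ y ∉ box d (R + 1), G (latticePt y) = 0 := by
    intro y hy
    by_contra h
    apply hy
    rw [mem_box]
    intro i
    have := hR _ h i
    have h2 : |y i| ≤ (R : ℤ) := abs_intCast_le_iff.1 this
    push_cast; omega
  have hz2 : ∀ y ∉ box d (R + 1), ∫ x in cubeAt y, G x = 0 := by
    intro y hy
    rw [setIntegral_eq_zero_of_forall_eq_zero]
    intro x hx
    by_contra h
    apply hy
    rw [mem_box]
    intro i
    have h1 := abs_le.1 (hR _ h i)
    have h2 := hx i
    rw [Set.mem_Ico] at h2
    rw [abs_le]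
    constructor
    · have : (-(R : ℤ) - 1 : ℤ) < (y i : ℝ) := by push_cast; linarith
      have : -(R : ℤ) - 1 < y i := by exact_mod_cast this
      push_cast; omega
    · have : (y i : ℝ) ≤ (R : ℤ) := by push_cast; linarith
      have : y i ≤ (R : ℤ) := by exact_mod_cast this
      push_cast; omega
  rw [← hint.tsum_eq, tsum_eq_sum hz1, tsum_eq_sum hz2, ← Finset.sum_sub_distrib]
  have hterm : ∀ y ∈ box d (R + 1), ‖G (latticePt y) - ∫ x in cubeAt y, G x‖ ≤ L * d := by
    intro y _
    have h1 : G (latticePt y) - ∫ x in cubeAt y, G x = ∫ x in cubeAt y, (G (latticePt y) - G x) := by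
      rw [integral_sub]
      · rw [setIntegral_const, Measure.real, volume_cubeAt]; simp
      · exact integrableOn_const (by rw [volume_cubeAt]; simp)
      · exact (hG.integrable_of_hasCompactSupport hcs).integrableOn
    rw [h1]
    have h2 := norm_setIntegral_le_of_norm_le_const (μ := volume) (s := cubeAt y)
      (f := fun x => G (latticePt y) - G x) (C := L * d) (by rw [volume_cubeAt]; simp) (by
        intro x hx
        refine (hL x (latticePt y)).trans ?_
        gcongr
        calc ∑ l, |latticePt y l - x l| ≤ ∑ l : Fin d, (1 : ℝ) := by
              refine Finset.sum_le_sum fun l _ => ?_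
              have := hx l
              rw [Set.mem_Ico] at this
              rw [latticePt_apply, abs_le]; constructor <;> linarith
          _ = d := by simp)
    rwa [Measure.real, volume_cubeAt, ENNReal.toReal_one, mul_one] at h2
  refine (norm_sum_le_of_le _ hterm).trans (le_of_eq ?_)
  rw [Finset.sum_const, card_box, nsmul_eq_mul]
  push_cast; ring

/-- The version of `norm_tsum_sub_integral_le` for the lattice `a ℤ^d + r`. -/
lemma norm_tsum_smul_sub_integral_le {d : ℕ} {G : EuclideanSpace ℝ (Fin d) → ℂ}
    (hG : Continuous G) {L : ℝ} (hL0 : 0 ≤ L) (hL : ∀ s t, ‖G t - G s‖ ≤ L * ∑ l, |t l - s l|)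
    {a : ℝ} (ha : 0 < a) (r : EuclideanSpace ℝ (Fin d)) (R : ℕ)
    (hR : ∀ t, G (a • t + r) ≠ 0 → ∀ l, |t l| ≤ R) :
    ‖∑' y : Fin d → ℤ, G (a • latticePt y + r) - ((a ^ d)⁻¹ : ℝ) • ∫ t, G t‖
      ≤ a * L * d * (2 * R + 3) ^ d := by
  have h1 := norm_tsum_sub_integral_le (G := fun t => G (a • t + r)) (by fun_prop) (L := a * L)
    (by positivity) (by
      intro s t
      refine (hL _ _).trans (le_of_eq ?_)
      have e : ∀ l, |(a • t + r) l - (a • s + r) l| = a * |t l - s l| := by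
        intro l
        simp only [PiLp.add_apply, PiLp.smul_apply, smul_eq_mul]
        rw [show a * t l + r l - (a * s l + r l) = a * (t l - s l) by ring, abs_mul, abs_of_pos ha]
      simp only [e]
      rw [← Finset.mul_sum]; ring)
    R hR
  have h2 : ∫ t, G (a • t + r) = ((a ^ d)⁻¹ : ℝ) • ∫ t, G t := by
    rw [Measure.integral_comp_smul volume (fun t => G (t + r)) a, finrank_euclideanSpace_fin,
      integral_add_right_eq_self, abs_of_pos (by positivity)]
  rwa [h2] at h1

/-! ### The exponential sums and oscillatory integrals of the dyadic pieces -/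

section Multipliers

variable {d n : ℕ} {P : Fin n → MvPolynomial (Fin d) ℤ}

/-- Weyl's inequality for the dyadic pieces, sampled on the lattice `M⁻¹ ℤ^d`. The exponent depends
on `P` only. -/
lemma exists_weyl_Kpiece (hP : IsAdmissible P) : ∃ C : ℕ,
    ∀ ψ : EuclideanSpace ℝ (Fin d) → ℝ, IsDyadicPartition ψ → ∃ C₀ : ℝ, 1 ≤ C₀ ∧
    ∀ K : EuclideanSpace ℝ (Fin d) → ℂ, IsCZKernel K → ∀ j : ℕ, 1 ≤ j → ∀ M : ℕ, 1 ≤ M →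
    ∀ (ξ : EuclideanSpace ℝ (Fin n)) (δ : ℝ), 0 < δ → δ ≤ 1 →
    δ * M ^ d ≤ ‖∑' y : Fin d → ℤ, expPhase (phase P ((M : ℝ)⁻¹ • latticePt y) ξ)
      * Kpiece ψ K j ((M : ℝ)⁻¹ • latticePt y)‖ →
    ∃ q : ℕ, 1 ≤ q ∧ (q : ℝ) ≤ (C₀ / δ) ^ C ∧
      ∀ i, NearInt ((C₀ / δ) ^ C / (M * 2 ^ j) ^ degs P i) (q * (ξ i / M ^ degs P i)) := by
  set D := Finset.univ.sup (degs P) with hD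
  have hDi : ∀ i, degs P i ≤ D := fun i => Finset.le_sup (Finset.mem_univ i)
  obtain ⟨C, hC⟩ := weyl_inverse d D
  refine ⟨C, fun ψ hψ => ?_⟩
  obtain ⟨B, hB1, hB⟩ := exists_Kpiece_bounds hψ
  refine ⟨2 * 2 ^ d * B, ?_, fun K hK j hj M hM ξ δ hδ0 hδ1 hsum => ?_⟩
  · have : (1 : ℝ) ≤ 2 ^ d := one_le_pow₀ (by norm_num)
    nlinarith
  obtain ⟨hb1, hb2, -⟩ := hB K hK j hj
  have hMr : (1 : ℝ) ≤ M := by exact_mod_cast hM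
  have hM0 : (0 : ℝ) < M := by linarith
  set N := M * 2 ^ (j + 1) with hN
  have hNr : (N : ℝ) = 2 * (M * 2 ^ j) := by rw [hN]; push_cast; ring
  set A := 2 * 2 ^ d * B / δ with hA
  have hA2 : 2 ≤ A := by
    rw [hA, le_div_iff₀ hδ0]
    have : (1 : ℝ) ≤ 2 ^ d := one_le_pow₀ (by norm_num)
    nlinarith
  set w : (Fin d → ℤ) → ℂ := fun y =>
    (((2 ^ j) ^ d / B : ℝ) : ℂ) * Kpiece ψ K j ((M : ℝ)⁻¹ • latticePt y) with hw
  have hsc : ‖(((2 ^ j) ^ d / B : ℝ) : ℂ)‖ = (2 ^ j) ^ d / B := by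
    rw [Complex.norm_real, Real.norm_of_nonneg (by positivity)]
  have hsupp : ∀ y, y ∉ box d N → Kpiece ψ K j ((M : ℝ)⁻¹ • latticePt y) = 0 := by
    intro y hy
    by_contra h
    apply hy
    rw [mem_box]
    intro i
    have h1 := (abs_coord_le_norm _ i).trans (Kpiece_support hψ K j h).2
    rw [PiLp.smul_apply, smul_eq_mul, latticePt_apply, abs_mul, abs_inv, Nat.abs_cast,
      inv_mul_le_iff₀ hM0] at h1
    rw [hN]
    exact_mod_cast h1
  have hlip : LipWeight N A 1 w := by
    refine ⟨fun y => ?_, fun y hy => by simp only [hw, hsupp y hy, mul_zero], fun x y _ => ?_⟩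
    · simp only [hw]
      rw [norm_mul, hsc]
      calc (2 ^ j) ^ d / B * ‖Kpiece ψ K j ((M : ℝ)⁻¹ • latticePt y)‖
          ≤ (2 ^ j) ^ d / B * (B / (2 ^ j) ^ d) := by gcongr; exact hb1 _
        _ = 1 := by field_simp
    · simp only [hw]
      rw [← mul_sub, norm_mul, hsc]
      have h1 := hb2 ((M : ℝ)⁻¹ • latticePt x) ((M : ℝ)⁻¹ • latticePt y)
      rw [← smul_sub, norm_smul, norm_inv, Real.norm_natCast] at h1
      have h2 : ‖latticePt y - latticePt x‖ ≤ ∑ i, |(y i : ℝ) - x i| := by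
        refine (norm_le_sum_abs _).trans (le_of_eq ?_)
        rfl
      have h0 : 0 ≤ ∑ i, |(y i : ℝ) - x i| := Finset.sum_nonneg fun _ _ => abs_nonneg _
      calc (2 ^ j) ^ d / B * ‖Kpiece ψ K j ((M : ℝ)⁻¹ • latticePt y)
            - Kpiece ψ K j ((M : ℝ)⁻¹ • latticePt x)‖
          ≤ (2 ^ j) ^ d / B * (B / (2 ^ j) ^ (d + 1)
            * ((M : ℝ)⁻¹ * ∑ i, |(y i : ℝ) - x i|)) := by
            gcongr; exact h1.trans (by gcongr)
        _ = 2 / N * ∑ i, |(y i : ℝ) - x i| := by rw [hNr, pow_succ]; field_simp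
        _ ≤ A / N * ∑ i, |(y i : ℝ) - x i| := by gcongr
  have htsum : ∑' y : Fin d → ℤ, expPhase (phase P ((M : ℝ)⁻¹ • latticePt y) ξ)
      * Kpiece ψ K j ((M : ℝ)⁻¹ • latticePt y) = ∑ y ∈ box d N,
      expPhase (phase P ((M : ℝ)⁻¹ • latticePt y) ξ) * Kpiece ψ K j ((M : ℝ)⁻¹ • latticePt y) :=
    tsum_eq_sum fun y hy => by rw [hsupp y hy, mul_zero]
  rw [htsum] at hsum
  obtain ⟨q, hq1, hq2, hq3⟩ := hC A hA2 N (Nat.mul_pos hM (by positivity)) 1 le_rfl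
    (by push_cast; linarith) w hlip
    (fun α => (M : ℝ)⁻¹ ^ (∑ l, α l) * phaseCoeff P ξ α) (by
      have e : ∑ y ∈ box d N, w y * expPhase (polySum D
          (fun α => (M : ℝ)⁻¹ ^ (∑ l, α l) * phaseCoeff P ξ α) (fun i => (y i : ℝ)))
          = (((2 ^ j) ^ d / B : ℝ) : ℂ) * ∑ y ∈ box d N,
            expPhase (phase P ((M : ℝ)⁻¹ • latticePt y) ξ)
              * Kpiece ψ K j ((M : ℝ)⁻¹ • latticePt y) := by
        rw [Finset.mul_sum]
        refine Finset.sum_congr rfl fun y _ => ?_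
        rw [phase_smul_eq_polySum P hDi]
        simp only [hw, latticePt_apply]
        ring
      rw [e, norm_mul, hsc]
      calc (N : ℝ) ^ d / A = (2 ^ j) ^ d / B * (δ * M ^ d) / 2 := by
            rw [hNr, hA, mul_pow, mul_pow]; field_simp
        _ ≤ (2 ^ j) ^ d / B * (δ * M ^ d) := by
            have : 0 ≤ (2 ^ j) ^ d / B * (δ * M ^ d) := by positivity
            linarith
        _ ≤ _ := by gcongr)
  refine ⟨q, hq1, hq2, fun i => ?_⟩
  obtain ⟨α, hα, hc⟩ := hP.exists_phaseCoeff i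
  have h3 := hq3 (degs P i) (hP.one_le_degs i) (hDi i) α hα
  rw [(Finset.mem_piAntidiag.1 hα).1, hc] at h3
  have e : (q : ℝ) * (ξ i / M ^ degs P i) = q * ((M : ℝ)⁻¹ ^ degs P i * ξ i) := by
    rw [inv_pow]; ring
  rw [e]
  refine h3.mono ?_
  gcongr
  rw [hNr]
  have : (0 : ℝ) ≤ M * 2 ^ j := by positivity
  linarith

variable (P) in
/-- Regularity of the integrand of `Phi`. -/
lemma exists_lipschitz_integrand {ψ : EuclideanSpace ℝ (Fin d) → ℝ} (hψ : IsDyadicPartition ψ) :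
    ∃ C : ℝ, 1 ≤ C ∧ ∀ K : EuclideanSpace ℝ (Fin d) → ℂ, IsCZKernel K → ∀ j : ℕ, 1 ≤ j →
    ∀ ξ : EuclideanSpace ℝ (Fin n), ∀ s t : EuclideanSpace ℝ (Fin d),
    ‖expPhase (phase P t ξ) * Kpiece ψ K j t - expPhase (phase P s ξ) * Kpiece ψ K j s‖
      ≤ C * (1 + ∑ i, (2 ^ (j + 1)) ^ degs P i * |ξ i|) / (2 ^ j) ^ (d + 1)
        * ∑ l, |t l - s l| := by
  obtain ⟨B, hB1, hB⟩ := exists_Kpiece_bounds hψ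
  obtain ⟨c, hc1, hc⟩ := exists_abs_polyMap_sub_le P
  refine ⟨B * (7 * c), by nlinarith, fun K hK j hj ξ s t => ?_⟩
  obtain ⟨hb1, hb2, -⟩ := hB K hK j hj
  set σ := ∑ l, |t l - s l| with hσ
  set T := ∑ i, ((2 : ℝ) ^ (j + 1)) ^ degs P i * |ξ i| with hT
  have hT0 : 0 ≤ T := Finset.sum_nonneg fun _ _ => by positivity
  have hσ0 : 0 ≤ σ := Finset.sum_nonneg fun _ _ => abs_nonneg _
  have hKd : ‖Kpiece ψ K j t - Kpiece ψ K j s‖ ≤ B / (2 ^ j) ^ (d + 1) * σ := by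
    refine (hb2 s t).trans ?_
    gcongr
    exact norm_le_sum_abs (t - s)
  have hle : B / (2 ^ j) ^ (d + 1) * σ ≤ B * (7 * c) * (1 + T) / (2 ^ j) ^ (d + 1) * σ := by
    gcongr
    have h1 : B ≤ B * (7 * c) := by nlinarith
    have h2 : B * (7 * c) ≤ B * (7 * c) * (1 + T) := by
      have : 0 ≤ B * (7 * c) * T := by positivity
      linarith
    linarith
  by_cases h0t : Kpiece ψ K j t = 0
  · rw [h0t, zero_sub, norm_neg] at hKd
    rw [h0t, mul_zero, zero_sub, norm_neg, norm_mul, norm_expPhase, one_mul]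
    exact hKd.trans hle
  by_cases h0s : Kpiece ψ K j s = 0
  · rw [h0s, sub_zero] at hKd
    rw [h0s, mul_zero, sub_zero, norm_mul, norm_expPhase, one_mul]
    exact hKd.trans hle
  have hst : ∀ u, Kpiece ψ K j u ≠ 0 → ∀ l, |u l| ≤ 2 ^ (j + 1) := fun u hu l =>
    (abs_coord_le_norm u l).trans (Kpiece_support hψ K j hu).2
  have hR : (1 : ℝ) ≤ 2 ^ (j + 1) := one_le_pow₀ (by norm_num)
  have hcσ : ∀ i, 2 ^ (j + 1) * |polyMap P t i - polyMap P s i|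
      ≤ c * (2 ^ (j + 1)) ^ degs P i * σ := fun i => hc _ hR s t (hst s h0s) (hst t h0t) i
  clear_value σ
  have hph : 2 ^ (j + 1) * |phase P t ξ - phase P s ξ| ≤ c * T * σ := by
    have e : phase P t ξ - phase P s ξ = ∑ i, (polyMap P t i - polyMap P s i) * ξ i := by
      simp only [phase, ← Finset.sum_sub_distrib]
      exact Finset.sum_congr rfl fun _ _ => by ring
    rw [e]
    calc (2 : ℝ) ^ (j + 1) * |∑ i, (polyMap P t i - polyMap P s i) * ξ i|
        ≤ 2 ^ (j + 1) * ∑ i, |polyMap P t i - polyMap P s i| * |ξ i| := by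
          gcongr
          refine (Finset.abs_sum_le_sum_abs _ _).trans (le_of_eq ?_)
          exact Finset.sum_congr rfl fun _ _ => abs_mul _ _
      _ = ∑ i, 2 ^ (j + 1) * |polyMap P t i - polyMap P s i| * |ξ i| := by
          rw [Finset.mul_sum]; exact Finset.sum_congr rfl fun _ _ => by ring
      _ ≤ ∑ i, c * (2 ^ (j + 1)) ^ degs P i * σ * |ξ i| := by
          exact Finset.sum_le_sum fun i _ => mul_le_mul_of_nonneg_right (hcσ i) (abs_nonneg _)
      _ = c * T * σ := by
          rw [hT, mul_assoc, Finset.sum_mul, Finset.mul_sum]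
          exact Finset.sum_congr rfl fun _ _ => by ring
  have he : ‖expPhase (phase P t ξ) - expPhase (phase P s ξ)‖ ≤ 7 * (c * T * σ / 2 ^ j) := by
    have h1 := norm_expPhase_sub_le (phase P t ξ) (phase P s ξ) 0
    rw [Int.cast_zero, sub_zero] at h1
    refine h1.trans ?_
    gcongr
    rw [le_div_iff₀ (by positivity)]
    rw [pow_succ] at hph
    have h2 : 0 ≤ 2 ^ j * |phase P t ξ - phase P s ξ| := by positivity
    nlinarith
  have e : expPhase (phase P t ξ) * Kpiece ψ K j t - expPhase (phase P s ξ) * Kpiece ψ K j s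
      = expPhase (phase P t ξ) * (Kpiece ψ K j t - Kpiece ψ K j s)
        + (expPhase (phase P t ξ) - expPhase (phase P s ξ)) * Kpiece ψ K j s := by ring
  rw [e]
  refine (norm_add_le _ _).trans ?_
  rw [norm_mul, norm_mul, norm_expPhase, one_mul]
  calc ‖Kpiece ψ K j t - Kpiece ψ K j s‖
        + ‖expPhase (phase P t ξ) - expPhase (phase P s ξ)‖ * ‖Kpiece ψ K j s‖
      ≤ B / (2 ^ j) ^ (d + 1) * σ + 7 * (c * T * σ / 2 ^ j) * (B / (2 ^ j) ^ d) := by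
        gcongr
        exact hb1 s
    _ = (B + B * (7 * c) * T) / (2 ^ j) ^ (d + 1) * σ := by rw [pow_succ]; field_simp
    _ ≤ B * (7 * c) * (1 + T) / (2 ^ j) ^ (d + 1) * σ := by
        gcongr
        nlinarith

lemma integrand_support {ψ : EuclideanSpace ℝ (Fin d) → ℝ} (hψ : IsDyadicPartition ψ)
    (K : EuclideanSpace ℝ (Fin d) → ℂ) (j : ℕ) (ξ : EuclideanSpace ℝ (Fin n))
    (t : EuclideanSpace ℝ (Fin d)) (ht : expPhase (phase P t ξ) * Kpiece ψ K j t ≠ 0) (l : Fin d) :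
    |t l| ≤ 2 ^ (j + 1) :=
  (abs_coord_le_norm t l).trans (Kpiece_support hψ K j (right_ne_zero_of_mul ht)).2

/-- Decay of the oscillatory integrals. They are limits of normalized exponential sums over the
lattices `M⁻¹ ℤ^d`, for which Weyl's inequality holds uniformly; as `M → ∞` the rational
approximations it yields can only be zero. -/
lemma exists_Phi_decay (hP : IsAdmissible P) : ∃ C : ℕ,
    ∀ ψ : EuclideanSpace ℝ (Fin d) → ℝ, IsDyadicPartition ψ → ∃ C₀ : ℝ, 1 ≤ C₀ ∧
    ∀ K : EuclideanSpace ℝ (Fin d) → ℂ, IsCZKernel K → ∀ j : ℕ, 1 ≤ j →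
    ∀ (ξ : EuclideanSpace ℝ (Fin n)) (δ : ℝ), 0 < δ → δ ≤ 1 → δ < ‖Phi P ψ K j ξ‖ →
    ∀ i, |ξ i| ≤ (C₀ / δ) ^ C / (2 ^ j) ^ degs P i := by
  obtain ⟨C, hC⟩ := exists_weyl_Kpiece hP
  refine ⟨C, fun ψ hψ => ?_⟩
  obtain ⟨C₀, hC₀1, hC₀⟩ := hC ψ hψ
  obtain ⟨c, hc1, hc⟩ := exists_lipschitz_integrand P hψ
  obtain ⟨B, hB1, hB⟩ := exists_Kpiece_bounds hψ
  refine ⟨C₀, hC₀1, fun K hK j hj ξ δ hδ0 hδ1 hΦ i => ?_⟩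
  set G : EuclideanSpace ℝ (Fin d) → ℂ := fun t => expPhase (phase P t ξ) * Kpiece ψ K j t with hG
  have hGc : Continuous G :=
    (continuous_expPhase.comp (continuous_phase_left P ξ)).mul (hB K hK j hj).2.2
  set L := c * (1 + ∑ i, (2 ^ (j + 1)) ^ degs P i * |ξ i|) / (2 ^ j) ^ (d + 1) with hL
  have hL0 : 0 ≤ L := by positivity
  set A := (C₀ / δ) ^ C with hA
  have hA1 : 1 ≤ A := one_le_pow₀ (by rw [le_div_iff₀ hδ0]; linarith)
  set X := ∑ i, |ξ i| with hX
  have hX0 : 0 ≤ X := Finset.sum_nonneg fun _ _ => abs_nonneg _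
  have hgap : 0 < ‖Phi P ψ K j ξ‖ - δ := by linarith
  set Y := L * d * (2 * 2 ^ (j + 1) + 3) ^ d with hY
  have hY0 : 0 ≤ Y := by positivity
  -- The first term makes the error of the Riemann sum smaller than the gap `‖Φ‖ - δ`, the others force
  -- the integer close to `q ξ_i / M ^ D_i` to be zero.
  obtain ⟨M, hM⟩ := exists_nat_gt (Y / (‖Phi P ψ K j ξ‖ - δ) + 2 * A + 2 * A * X + 1)
  have hY1 : 0 ≤ Y / (‖Phi P ψ K j ξ‖ - δ) := by positivity
  have hAX : 0 ≤ 2 * A * X := by positivity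
  have hM1 : (1 : ℝ) ≤ M := by linarith
  have hM0 : (0 : ℝ) < M := by linarith
  have hriem := norm_tsum_smul_sub_integral_le hGc hL0 (hc K hK j hj ξ) (inv_pos.2 hM0) 0
    (M * 2 ^ (j + 1)) (by
      intro t ht l
      have h1 := integrand_support hψ K j ξ _ ht l
      rw [add_zero, PiLp.smul_apply, smul_eq_mul, abs_mul, abs_inv, Nat.abs_cast,
        inv_mul_le_iff₀ hM0] at h1
      push_cast; exact h1)
  simp only [add_zero] at hriem
  have hsum : δ * M ^ d ≤ ‖∑' y : Fin d → ℤ, G ((M : ℝ)⁻¹ • latticePt y)‖ := by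
    have e1 : (((M : ℝ)⁻¹ ^ d)⁻¹ : ℝ) = M ^ d := by rw [inv_pow, inv_inv]
    rw [e1] at hriem
    have e2 : (M : ℝ)⁻¹ * L * d * (2 * ((M * 2 ^ (j + 1) : ℕ) : ℝ) + 3) ^ d
        ≤ (‖Phi P ψ K j ξ‖ - δ) * M ^ d := by
      calc (M : ℝ)⁻¹ * L * d * (2 * ((M * 2 ^ (j + 1) : ℕ) : ℝ) + 3) ^ d
          ≤ (M : ℝ)⁻¹ * L * d * (M * (2 * 2 ^ (j + 1) + 3)) ^ d := by
            gcongr; push_cast; nlinarith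
        _ = Y / M * M ^ d := by rw [hY, mul_pow]; ring
        _ ≤ _ := by
            gcongr
            rw [div_le_iff₀ hM0, mul_comm, ← div_le_iff₀ hgap]
            linarith
    have e3 : ‖(M ^ d : ℝ) • ∫ t, G t‖ = M ^ d * ‖Phi P ψ K j ξ‖ := by
      rw [norm_smul, Real.norm_of_nonneg (by positivity)]; rfl
    have e4 := norm_sub_norm_le ((M ^ d : ℝ) • ∫ t, G t)
      (∑' y : Fin d → ℤ, G ((M : ℝ)⁻¹ • latticePt y))
    rw [norm_sub_rev, e3] at e4
    nlinarith
  obtain ⟨q, hq1, hq2, hq3⟩ := hC₀ K hK j hj M (by exact_mod_cast hM1) ξ δ hδ0 hδ1 hsum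
  obtain ⟨b, hb⟩ := hq3 i
  have hD := hP.one_le_degs i
  have hMD : (M : ℝ) ≤ M ^ degs P i := le_self_pow₀ hM1 (by omega)
  have hq0 : (1 : ℝ) ≤ q := by exact_mod_cast hq1
  have h2j : (1 : ℝ) ≤ 2 ^ j := one_le_pow₀ (by norm_num)
  have hb0 : b = 0 := by
    have h1 : |(q : ℝ) * (ξ i / M ^ degs P i)| < 1 / 2 := by
      rw [abs_mul, abs_div, Nat.abs_cast, abs_of_pos (by positivity : (0 : ℝ) < M ^ degs P i),
        mul_div_assoc', div_lt_iff₀ (by positivity)]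
      have hxi : |ξ i| ≤ X := Finset.single_le_sum (f := fun i => |ξ i|)
        (fun _ _ => abs_nonneg _) (Finset.mem_univ i)
      have : (q : ℝ) * |ξ i| ≤ A * X := by gcongr
      nlinarith
    have h2 : A / (M * 2 ^ j) ^ degs P i < 1 / 2 := by
      rw [div_lt_iff₀ (by positivity)]
      have : (M : ℝ) ≤ (M * 2 ^ j) ^ degs P i := by
        refine hMD.trans ?_
        gcongr
        nlinarith
      linarith
    have h3 : |(b : ℝ)| < 1 := by
      have := abs_sub_abs_le_abs_sub (b : ℝ) ((q : ℝ) * (ξ i / M ^ degs P i))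
      rw [abs_sub_comm] at this
      linarith
    exact Int.abs_lt_one_iff.1 (by exact_mod_cast h3)
  rw [hb0, Int.cast_zero, sub_zero, abs_mul, abs_div, Nat.abs_cast,
    abs_of_pos (by positivity : (0 : ℝ) < M ^ degs P i), mul_pow] at hb
  have h4 : |ξ i| / M ^ degs P i ≤ A / (M ^ degs P i * (2 ^ j) ^ degs P i) := by
    refine le_trans ?_ hb
    have : 0 ≤ |ξ i| / M ^ degs P i := by positivity
    nlinarith
  rw [div_le_iff₀ (by positivity)] at h4
  refine h4.trans (le_of_eq ?_)
  field_simp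

/-- Splitting a sum over `ℤ^d` into residue classes modulo `q`. -/
lemma tsum_eq_sum_residues {q : ℕ} (hq : 1 ≤ q) (f : (Fin d → ℤ) → ℂ) (hf : Summable f) :
    ∑' y, f y = ∑ r ∈ Fintype.piFinset (fun _ : Fin d => Finset.range q),
      ∑' u : Fin d → ℤ, f (fun i => q * u i + (r i : ℤ)) := by
  have : NeZero q := ⟨by omega⟩
  set e : (Fin d → ℤ) ≃ (Fin d → Fin q) × (Fin d → ℤ) :=
    ((Equiv.piCongrRight fun _ => Int.divModEquiv q).trans
      (Equiv.arrowProdEquivProdArrow _ _ _)).trans (Equiv.prodComm _ _) with he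
  have hes : ∀ p : (Fin d → Fin q) × (Fin d → ℤ),
      e.symm p = fun i => q * p.2 i + (((p.1 i : Fin q) : ℕ) : ℤ) := by
    intro p
    funext i
    change (Int.divModEquiv q).symm (p.2 i, p.1 i) = _
    simp [Int.divModEquiv, mul_comm]
  have hprod := Summable.tsum_prod (f := fun p => f (e.symm p)) (e.symm.summable_iff.2 hf)
  rw [← e.symm.tsum_eq f, hprod, tsum_fintype]
  refine Finset.sum_bij (fun r _ => fun i => ((r i : Fin q) : ℕ)) ?_ ?_ ?_ ?_
  · intro r _
    rw [Fintype.mem_piFinset]; intro i; rw [Finset.mem_range]; exact (r i).2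
  · intro r _ r' _ h
    funext i; exact Fin.ext (congrFun h i)
  · intro r hr
    rw [Fintype.mem_piFinset] at hr
    exact ⟨fun i => ⟨r i, Finset.mem_range.1 (hr i)⟩, Finset.mem_univ _, rfl⟩
  · intro r _
    simp only [hes]

lemma eval_modEq (p : MvPolynomial (Fin d) ℤ) {m : ℤ} {x y : Fin d → ℤ}
    (h : ∀ i, x i ≡ y i [ZMOD m]) :
    MvPolynomial.eval x p ≡ MvPolynomial.eval y p [ZMOD m] := by
  induction p using MvPolynomial.induction_on with
  | C a => simp
  | add p q hp hq => simpa using hp.add hq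
  | mul_X p i hp => simpa using hp.mul (h i)

/-- The phase at a lattice point modulo one depends on the frequency modulo the lattice, and at the
rational point `a / q` on the residue class modulo `q` only. -/
lemma expPhase_phase_residue {q : ℕ} (hq : 1 ≤ q) (a : Fin n → ℕ) (l : Fin n → ℤ)
    (y r : Fin d → ℤ) (hr : ∀ i, y i ≡ r i [ZMOD q]) (ξ : EuclideanSpace ℝ (Fin n)) :
    expPhase (phase P (latticePt y) ξ) = expPhase (phase P (latticePt r) (ratPt a q))
      * expPhase (phase P (latticePt y) (ξ - ratPt a q + latticePt l)) := by
  have hq0 : (q : ℝ) ≠ 0 := by positivity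
  choose m hm using fun i => (eval_modEq (P i) hr).symm.dvd
  rw [← expPhase_add]
  have e : phase P (latticePt y) ξ = phase P (latticePt r) (ratPt a q)
      + phase P (latticePt y) (ξ - ratPt a q + latticePt l)
      + ((∑ i, (m i * a i - MvPolynomial.eval y (P i) * l i) : ℤ) : ℝ) := by
    simp only [phase, polyMap_latticePt, PiLp.add_apply, PiLp.sub_apply, latticePt_apply]
    push_cast
    rw [← Finset.sum_add_distrib, ← Finset.sum_add_distrib]
    refine Finset.sum_congr rfl fun i _ => ?_
    have h1 : ((MvPolynomial.eval y (P i) : ℤ) : ℝ)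
        = (MvPolynomial.eval r (P i) : ℤ) + q * m i := by
      have := hm i
      have : MvPolynomial.eval y (P i) = MvPolynomial.eval r (P i) + q * m i := by linarith
      exact_mod_cast this
    have h2 : ratPt a q i = (a i : ℝ) / q := rfl
    rw [h1, h2]
    field_simp
    ring
  rw [e, expPhase_add_int]

/-- The asymptotics of the exponential sum near a rational point: on every residue class modulo the
denominator the sum is a Riemann sum for `Phi`. -/
lemma exists_major_arc_bound {ψ : EuclideanSpace ℝ (Fin d) → ℝ} (hψ : IsDyadicPartition ψ) :
    ∃ C : ℝ, 1 ≤ C ∧ ∀ K : EuclideanSpace ℝ (Fin d) → ℂ, IsCZKernel K → ∀ j : ℕ, 1 ≤ j →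
    ∀ q : ℕ, 1 ≤ q → q ≤ 2 ^ j → ∀ (a : Fin n → ℕ) (l : Fin n → ℤ)
    (ξ : EuclideanSpace ℝ (Fin n)) (ρ : ℝ), 0 ≤ ρ →
    (∀ i, |(ξ - ratPt a q + latticePt l) i| ≤ ρ / (2 ^ j) ^ degs P i) →
    ‖mMult P ψ K j ξ - gaussS P a q * Phi P ψ K j (ξ - ratPt a q + latticePt l)‖
      ≤ C * q * (1 + ρ) / 2 ^ j := by
  obtain ⟨c, hc1, hc⟩ := exists_lipschitz_integrand P hψ
  obtain ⟨B, hB1, hB⟩ := exists_Kpiece_bounds hψ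
  set T := ∑ i : Fin n, (2 : ℝ) ^ degs P i with hT
  have hT0 : 0 ≤ T := Finset.sum_nonneg fun _ _ => by positivity
  refine ⟨c * (1 + T) * (1 + d) * 11 ^ d, ?_, fun K hK j hj q hq hqj a l ξ ρ hρ hη => ?_⟩
  · have h1 : (1 : ℝ) ≤ 11 ^ d := one_le_pow₀ (by norm_num)
    have h2 : (1 : ℝ) ≤ 1 + d := by have : (0 : ℝ) ≤ d := Nat.cast_nonneg d; linarith
    have h3 : 1 ≤ 1 + T := by linarith
    exact one_le_mul_of_one_le_of_one_le
      (one_le_mul_of_one_le_of_one_le (one_le_mul_of_one_le_of_one_le hc1 h3) h2) h1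
  set η := ξ - ratPt a q + latticePt l with hηdef
  set G : EuclideanSpace ℝ (Fin d) → ℂ := fun t => expPhase (phase P t η) * Kpiece ψ K j t with hG
  have hGc : Continuous G :=
    (continuous_expPhase.comp (continuous_phase_left P η)).mul (hB K hK j hj).2.2
  have hqr : (1 : ℝ) ≤ q := by exact_mod_cast hq
  have hq0 : (0 : ℝ) < q := by linarith
  have hqjr : (q : ℝ) ≤ 2 ^ j := by exact_mod_cast hqj
  set L := c * (1 + T) * (1 + ρ) / (2 ^ j) ^ (d + 1) with hL
  have hL0 : 0 ≤ L := by positivity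
  have hGL : ∀ s t, ‖G t - G s‖ ≤ L * ∑ l, |t l - s l| := by
    intro s t
    refine (hc K hK j hj η s t).trans ?_
    have h0 : 0 ≤ ∑ l, |t l - s l| := Finset.sum_nonneg fun _ _ => abs_nonneg _
    rw [hL, mul_assoc c]
    gcongr
    have h1 : ∑ i, ((2 : ℝ) ^ (j + 1)) ^ degs P i * |η i| ≤ T * ρ := by
      rw [hT, Finset.sum_mul]
      refine Finset.sum_le_sum fun i _ => ?_
      calc ((2 : ℝ) ^ (j + 1)) ^ degs P i * |η i|
          ≤ (2 ^ (j + 1)) ^ degs P i * (ρ / (2 ^ j) ^ degs P i) := by gcongr; exact hη i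
        _ = 2 ^ degs P i * ρ := by rw [pow_succ, mul_pow]; field_simp
    have : 0 ≤ T := hT0
    nlinarith
  set f : (Fin d → ℤ) → ℂ := fun y => expPhase (phase P (latticePt y) ξ)
    * Kpiece ψ K j (latticePt y) with hf
  have hfs : Summable f := by
    apply summable_of_ne_finset_zero (s := box d (2 ^ (j + 1)))
    intro y hy
    by_contra h
    apply hy
    rw [mem_box]
    intro i
    have := integrand_support hψ K j ξ _ h i
    exact abs_intCast_le_iff.1 (by push_cast; exact this)
  set Rs := Fintype.piFinset (fun _ : Fin d => Finset.range q) with hRs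
  have hcard : (Rs.card : ℝ) = q ^ d := by rw [hRs, Fintype.card_piFinset]; simp
  -- On each residue class modulo `q` the arithmetic part of the phase is constant, and what remains is a
  -- Riemann sum with mesh `q`.
  have h1 : mMult P ψ K j ξ = ∑ r ∈ Rs,
      expPhase (phase P (latticePt (fun l => (r l : ℤ))) (ratPt a q))
        * ∑' u : Fin d → ℤ, G ((q : ℝ) • latticePt u + latticePt (fun l => (r l : ℤ))) := by
    change ∑' y, f y = _
    rw [tsum_eq_sum_residues hq f hfs]
    refine Finset.sum_congr rfl fun r _ => ?_
    rw [← tsum_mul_left]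
    congr 1
    funext u
    have e1 : (q : ℝ) • latticePt u + latticePt (fun l => (r l : ℤ))
        = latticePt (fun i => q * u i + (r i : ℤ)) := by
      ext i; simp [latticePt]
    rw [e1]
    simp only [hf, hG]
    rw [expPhase_phase_residue hq a l (fun i => q * u i + (r i : ℤ)) (fun i => (r i : ℤ))
      (fun i => by simp) ξ]
    rw [← hηdef]; ring
  have h2 : gaussS P a q * Phi P ψ K j η = ∑ r ∈ Rs,
      expPhase (phase P (latticePt (fun l => (r l : ℤ))) (ratPt a q))
        * ((((q : ℝ) ^ d)⁻¹ : ℝ) • ∫ t, G t) := by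
    rw [gaussS, ← Finset.sum_mul, Complex.real_smul]
    push_cast
    change _ * _ * (∫ t, G t) = _
    ring
  rw [h1, h2, ← Finset.sum_sub_distrib]
  have hterm : ∀ r ∈ Rs, ‖expPhase (phase P (latticePt (fun l => (r l : ℤ))) (ratPt a q))
        * ∑' u : Fin d → ℤ, G ((q : ℝ) • latticePt u + latticePt (fun l => (r l : ℤ)))
      - expPhase (phase P (latticePt (fun l => (r l : ℤ))) (ratPt a q))
        * ((((q : ℝ) ^ d)⁻¹ : ℝ) • ∫ t, G t)‖ ≤ q * L * d * (11 * 2 ^ j / q) ^ d := by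
    intro r hr
    rw [← mul_sub, norm_mul, norm_expPhase, one_mul]
    rw [hRs, Fintype.mem_piFinset] at hr
    refine (norm_tsum_smul_sub_integral_le hGc hL0 hGL hq0 _ (2 ^ (j + 1) / q + 2) ?_).trans ?_
    · intro t ht l
      have h3 := integrand_support hψ K j η _ ht l
      rw [PiLp.add_apply, PiLp.smul_apply, smul_eq_mul, latticePt_apply] at h3
      have h4 : (r l : ℝ) ≤ q := by exact_mod_cast (Finset.mem_range.1 (hr l)).le
      have h5 : q * |t l| ≤ 2 ^ (j + 1) + q := by
        have e1 : (q : ℝ) * t l = (q * t l + ((r l : ℤ) : ℝ)) - r l := by push_cast; ring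
        have e2 : (q : ℝ) * |t l| = |(q : ℝ) * t l| := by rw [abs_mul, Nat.abs_cast]
        rw [e2, e1]
        refine (abs_sub _ _).trans ?_
        rw [Nat.abs_cast]
        linarith
      have h6 : (2 : ℝ) ^ (j + 1) ≤ q * ((2 ^ (j + 1) / q : ℕ) + 1) := by
        have := Nat.lt_mul_div_succ (2 ^ (j + 1)) (show 0 < q by omega)
        exact_mod_cast this.le
      refine le_of_mul_le_mul_left (h5.trans ?_) hq0
      push_cast
      linarith
    · gcongr
      rw [le_div_iff₀ hq0]
      have h7 : ((2 ^ (j + 1) / q : ℕ) : ℝ) * q ≤ 2 ^ (j + 1) := by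
        exact_mod_cast Nat.div_mul_le_self (2 ^ (j + 1)) q
      have e1 : (2 : ℝ) ^ (j + 1) = 2 * 2 ^ j := by ring
      rw [e1] at h7
      rw [Nat.cast_add, Nat.cast_ofNat]
      nlinarith
  refine (norm_sum_le_of_le _ hterm).trans ?_
  rw [Finset.sum_const, nsmul_eq_mul, hcard, hL]
  have hd : (d : ℝ) ≤ 1 + d := by linarith
  calc (q : ℝ) ^ d * (q * (c * (1 + T) * (1 + ρ) / (2 ^ j) ^ (d + 1)) * d * (11 * 2 ^ j / q) ^ d)
      = c * (1 + T) * d * 11 ^ d * q * (1 + ρ) / 2 ^ j := by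
        rw [div_pow, mul_pow, pow_succ]; field_simp
    _ ≤ _ := by gcongr

end Multipliers

/-! ### Reduced fractions -/

lemma mem_numerators {n q : ℕ} {a : Fin n → ℕ} :
    a ∈ numerators n q ↔ (∀ i, a i < q) ∧ Nat.gcd (Finset.univ.gcd a) q = 1 := by
  simp [numerators]

lemma dvd_of_mem_numerators {n q m : ℕ} {a : Fin n → ℕ} (ha : a ∈ numerators n q)
    (h : ∀ i, q ∣ a i * m) : q ∣ m := by
  have h1 : q ∣ Finset.univ.gcd a * m := by
    have := Finset.dvd_gcd (s := Finset.univ) (f := fun i => a i * m) fun i _ => h i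
    rwa [Finset.gcd_mul_right, normalize_eq] at this
  have h2 : q ∣ Nat.gcd (Finset.univ.gcd a * m) (q * m) := Nat.dvd_gcd h1 (dvd_mul_right _ _)
  rwa [Nat.gcd_mul_right, (mem_numerators.1 ha).2, one_mul] at h2

/-- Distinct reduced fractions with denominators `q` and `q'` are separated by `1 / (q q')` modulo
the lattice. -/
lemma fraction_unique {n q q' : ℕ} (hq : 1 ≤ q) (hq' : 1 ≤ q') {a a' : Fin n → ℕ}
    (ha : a ∈ numerators n q) (ha' : a' ∈ numerators n q') {l l' : Fin n → ℤ}
    {ξ : EuclideanSpace ℝ (Fin n)}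
    (h : ∀ i, |(ξ - ratPt a q + latticePt l) i| + |(ξ - ratPt a' q' + latticePt l') i|
      < 1 / (q * q')) : q = q' ∧ a = a' ∧ l = l' := by
  have hq0 : (0 : ℝ) < q := by exact_mod_cast hq
  have hq0' : (0 : ℝ) < q' := by exact_mod_cast hq'
  have key : ∀ i, (a i - l i * q) * q' = (a' i - l' i * q') * (q : ℤ) := by
    intro i
    have h1 := h i
    simp only [PiLp.add_apply, PiLp.sub_apply, latticePt_apply] at h1
    have h2 : |((a i - l i * q) * q' - (a' i - l' i * q') * q : ℝ)| < 1 := by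
      have e : ((a i - l i * q) * q' - (a' i - l' i * q') * q : ℝ)
          = ((ξ i - ratPt a' q' i + l' i) - (ξ i - ratPt a q i + l i)) * (q * q') := by
        have e1 : ratPt a q i = (a i : ℝ) / q := rfl
        have e2 : ratPt a' q' i = (a' i : ℝ) / q' := rfl
        rw [e1, e2]; field_simp; ring
      rw [e, abs_mul, abs_of_pos (by positivity : (0 : ℝ) < q * q')]
      rw [lt_div_iff₀ (by positivity)] at h1
      refine lt_of_le_of_lt ?_ h1
      gcongr
      refine (abs_sub _ _).trans (le_of_eq ?_)
      ring
    have h3 : |((a i - l i * q) * q' - (a' i - l' i * q') * q : ℤ)| < 1 := by exact_mod_cast h2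
    have := Int.abs_lt_one_iff.1 h3
    linarith
  have hqq' : q = q' := by
    apply Nat.dvd_antisymm
    · apply dvd_of_mem_numerators ha
      intro i
      have : ((a i * q' : ℕ) : ℤ) = q * (a' i - l' i * q' + l i * q') := by
        push_cast; linarith [key i]
      exact_mod_cast Dvd.intro _ this.symm
    · apply dvd_of_mem_numerators ha'
      intro i
      have : ((a' i * q : ℕ) : ℤ) = q' * (a i - l i * q + l' i * q) := by
        push_cast; linarith [key i]
      exact_mod_cast Dvd.intro _ this.symm
  subst hqq'
  have hal : ∀ i, a i = a' i ∧ l i = l' i := by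
    intro i
    have h1 : (a i : ℤ) - l i * q = a' i - l' i * q :=
      mul_right_cancel₀ (by positivity) (key i)
    have h2 := (mem_numerators.1 ha).1 i
    have h3 := (mem_numerators.1 ha').1 i
    have h4 : l i = l' i := by
      have e1 : (a i : ℤ) / q = 0 := Int.ediv_eq_zero_of_lt (by positivity) (by exact_mod_cast h2)
      have e2 : (a' i : ℤ) / q = 0 := Int.ediv_eq_zero_of_lt (by positivity) (by exact_mod_cast h3)
      have e3 : (a i : ℤ) = a' i + (l i - l' i) * q := by linarith
      rw [e3, Int.add_mul_ediv_right _ _ (by positivity), e2] at e1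
      linarith
    rw [h4] at h1
    exact ⟨by exact_mod_cast (by linarith : (a i : ℤ) = a' i), h4⟩
  exact ⟨rfl, funext fun i => (hal i).1, funext fun i => (hal i).2⟩

/-- Every rational point is, modulo the lattice, a reduced fraction in the unit cube. -/
lemma exists_reduced_fraction {n q : ℕ} (hq : 1 ≤ q) (b : Fin n → ℤ) :
    ∃ q' : ℕ, 1 ≤ q' ∧ q' ≤ q ∧ ∃ a ∈ numerators n q', ∃ l : Fin n → ℤ,
      ∀ i, (b i : ℝ) / q = (a i : ℝ) / q' - l i := by
  set g := Nat.gcd (Finset.univ.gcd fun i => (b i).natAbs) q with hg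
  have hgpos : 0 < g := Nat.gcd_pos_of_pos_right _ hq
  obtain ⟨q', hq'⟩ : g ∣ q := Nat.gcd_dvd_right _ _
  have hgb : ∀ i, (g : ℤ) ∣ b i := fun i => by
    have : g ∣ (b i).natAbs := (Nat.gcd_dvd_left _ _).trans (Finset.gcd_dvd (Finset.mem_univ i))
    exact Int.natCast_dvd.2 this
  choose b' hb' using hgb
  have hq'1 : 1 ≤ q' := by
    rcases Nat.eq_zero_or_pos q' with h | h
    · rw [h, mul_zero] at hq'; omega
    · exact h
  have hq'z : (q' : ℤ) ≠ 0 := by positivity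
  have hpos : ∀ i, 0 ≤ b' i % q' := fun i => Int.emod_nonneg _ hq'z
  refine ⟨q', hq'1, by rw [hq']; exact Nat.le_mul_of_pos_left _ hgpos,
    fun i => (b' i % q').toNat, ?_, fun i => -(b' i / q'), fun i => ?_⟩
  · rw [mem_numerators]
    constructor
    · intro i
      have := Int.emod_lt_of_pos (b' i) (by positivity : (0 : ℤ) < q')
      have := hpos i
      omega
    · set e := Nat.gcd (Finset.univ.gcd fun i => (b' i % q').toNat) q' with he
      have he1 : e ∣ q' := Nat.gcd_dvd_right _ _
      have he2 : ∀ i, (e : ℤ) ∣ b' i := by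
        intro i
        have h1 : e ∣ (b' i % q').toNat :=
          (Nat.gcd_dvd_left _ _).trans (Finset.gcd_dvd (Finset.mem_univ i))
        have h2 : (e : ℤ) ∣ b' i % q' := by
          rw [← Int.toNat_of_nonneg (hpos i)]; exact_mod_cast h1
        have h3 : (e : ℤ) ∣ q' := by exact_mod_cast he1
        rw [← Int.emod_add_mul_ediv (b' i) q']
        exact dvd_add h2 (h3.mul_right _)
      have h4 : g * e ∣ g := by
        have hd : g * e ∣ Nat.gcd (Finset.univ.gcd fun i => (b i).natAbs) q := by
          apply Nat.dvd_gcd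
          · apply Finset.dvd_gcd
            intro i _
            rw [← Int.natCast_dvd, hb' i]
            push_cast
            exact mul_dvd_mul_left _ (he2 i)
          · rw [hq']; exact mul_dvd_mul_left _ he1
        exact hd
      have h5 : g * e ∣ g * 1 := by rwa [mul_one]
      exact Nat.dvd_one.1 (Nat.dvd_of_mul_dvd_mul_left hgpos h5)
  · have h1 : ((b' i % q').toNat : ℝ) = ((b' i % q' : ℤ) : ℝ) := by
      rw [← Int.cast_natCast, Int.toNat_of_nonneg (hpos i)]
    have h2 : ((b' i % q' : ℤ) : ℝ) = b' i - q' * ((b' i / q' : ℤ) : ℝ) := by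
      have := Int.emod_def (b' i) q'
      rw [this]; push_cast; ring
    have hq'r : (q' : ℝ) ≠ 0 := by positivity
    have hgr : (g : ℝ) ≠ 0 := by positivity
    rw [h1, h2, hb' i, hq']
    push_cast
    field_simp
    ring

/-! ### The approximating multipliers at a fixed frequency -/

section Pieces

variable {d n : ℕ} {P : Fin n → MvPolynomial (Fin d) ℤ}

lemma norm_gaussS_le (P : Fin n → MvPolynomial (Fin d) ℤ) (a : Fin n → ℕ) (q : ℕ) :
    ‖gaussS P a q‖ ≤ 1 := by
  rw [gaussS, norm_mul, norm_inv, norm_pow, Complex.norm_natCast]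
  have h : ‖∑ r ∈ Fintype.piFinset (fun _ : Fin d => Finset.range q),
      expPhase (phase P (latticePt (fun l => (r l : ℤ))) (ratPt a q))‖ ≤ (q : ℝ) ^ d := by
    refine (norm_sum_le _ _).trans ?_
    simp [Fintype.card_piFinset]
  rw [inv_mul_eq_div]
  exact div_le_one_of_le₀ h (by positivity)

lemma IsCutoff.exists_bound {χ : EuclideanSpace ℝ (Fin n) → ℂ} (hχ : IsCutoff χ) :
    ∃ X : ℝ, 1 ≤ X ∧ ∀ ξ, ‖χ ξ‖ ≤ X := by
  have hcs : HasCompactSupport χ := by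
    apply HasCompactSupport.intro (isCompact_closedBall (0 : EuclideanSpace ℝ (Fin n)) 2)
    intro x hx
    by_contra h
    exact hx (by simpa using hχ.supp x h)
  obtain ⟨X, hX⟩ := hχ.smooth.continuous.bounded_above_of_compact_support hcs
  exact ⟨max X 1, le_max_right _ _, fun ξ => (hX ξ).trans (le_max_left _ _)⟩

lemma IsCutoff.norm_le_of_ne {χ : EuclideanSpace ℝ (Fin n) → ℂ} (hχ : IsCutoff χ) {k : ℕ}
    {η : EuclideanSpace ℝ (Fin n)} (h : χ ((2 : ℝ) ^ (10 * k) • η) ≠ 0) :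
    ‖η‖ ≤ 2 / 2 ^ (10 * k) := by
  have := hχ.supp _ h
  rw [norm_smul, norm_pow, Real.norm_ofNat] at this
  rw [le_div_iff₀ (by positivity)]
  linarith

/-- At each frequency at most one fraction contributes to `Lpiece`. -/
lemma Lpiece_eq_single {χ : EuclideanSpace ℝ (Fin n) → ℂ} (hχ : IsCutoff χ)
    (ψ : EuclideanSpace ℝ (Fin d) → ℝ) (K : EuclideanSpace ℝ (Fin d) → ℂ) (j : ℕ) {k : ℕ}
    (hk : 1 ≤ k) {q₀ : ℕ} (hq₀ : q₀ ∈ Finset.Ico (2 ^ (k - 1)) (2 ^ k)) {a₀ : Fin n → ℕ}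
    (ha₀ : a₀ ∈ numerators n q₀) (l₀ : Fin n → ℤ) (ξ : EuclideanSpace ℝ (Fin n))
    (hη : ‖ξ - ratPt a₀ q₀ + latticePt l₀‖ ≤ 2 / 2 ^ (10 * k)) :
    Lpiece P ψ χ K j k ξ = gaussS P a₀ q₀ * (Phi P ψ K j (ξ - ratPt a₀ q₀ + latticePt l₀)
      * χ ((2 : ℝ) ^ (10 * k) • (ξ - ratPt a₀ q₀ + latticePt l₀))) := by
  have huniq : ∀ q ∈ Finset.Ico (2 ^ (k - 1)) (2 ^ k), ∀ a ∈ numerators n q, ∀ l : Fin n → ℤ,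
      χ ((2 : ℝ) ^ (10 * k) • (ξ - ratPt a q + latticePt l)) ≠ 0 → q = q₀ ∧ a = a₀ ∧ l = l₀ := by
    intro q hq a ha l h
    rw [Finset.mem_Ico] at hq hq₀
    have h2 : 1 ≤ 2 ^ (k - 1) := Nat.one_le_two_pow
    refine fraction_unique (by omega) (by omega) ha ha₀ (ξ := ξ) fun i => ?_
    have h3 := (abs_coord_le_norm _ i).trans (hχ.norm_le_of_ne h)
    have h4 := (abs_coord_le_norm _ i).trans hη
    have h5 : (q : ℝ) < 2 ^ k := by exact_mod_cast hq.2
    have h6 : (q₀ : ℝ) < 2 ^ k := by exact_mod_cast hq₀.2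
    have h7 : (1 : ℝ) ≤ q := by exact_mod_cast h2.trans hq.1
    have h8 : (1 : ℝ) ≤ q₀ := by exact_mod_cast h2.trans hq₀.1
    have h9 : (q : ℝ) * q₀ < 2 ^ k * 2 ^ k := mul_lt_mul'' h5 h6 (by linarith) (by linarith)
    have h10 : (4 : ℝ) * (2 ^ k * 2 ^ k) ≤ 2 ^ (10 * k) := by
      have : (4 : ℝ) * (2 ^ k * 2 ^ k) = 2 ^ (2 + (k + k)) := by rw [pow_add, pow_add]; norm_num
      rw [this]; exact pow_le_pow_right₀ (by norm_num) (by omega)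
    calc _ ≤ (2 : ℝ) / 2 ^ (10 * k) + 2 / 2 ^ (10 * k) := add_le_add h3 h4
      _ = 4 / 2 ^ (10 * k) := by ring
      _ ≤ 4 / (4 * (2 ^ k * 2 ^ k)) := by gcongr
      _ = 1 / (2 ^ k * 2 ^ k) := by field_simp
      _ < _ := by gcongr
  have hper : ∀ q ∈ Finset.Ico (2 ^ (k - 1)) (2 ^ k), ∀ a ∈ numerators n q, (q ≠ q₀ ∨ a ≠ a₀) →
      periodize (fun η => Phi P ψ K j η * χ ((2 : ℝ) ^ (10 * k) • η)) (ξ - ratPt a q) = 0 := by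
    intro q hq a ha hne
    unfold periodize
    refine (tsum_congr fun l => ?_).trans tsum_zero
    by_contra h
    obtain ⟨h1, h2, -⟩ := huniq q hq a ha l (right_ne_zero_of_mul h)
    rcases hne with hne | hne
    · exact hne h1
    · exact hne h2
  unfold Lpiece
  rw [Finset.sum_eq_single_of_mem q₀ hq₀, Finset.sum_eq_single_of_mem a₀ ha₀]
  · congr 1
    unfold periodize
    rw [tsum_eq_single l₀]
    intro l hl
    by_contra h
    exact hl (huniq q₀ hq₀ a₀ ha₀ l (right_ne_zero_of_mul h)).2.2
  · intro a ha hne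
    rw [hper q₀ hq₀ a ha (Or.inr hne), mul_zero]
  · intro q hq hne
    refine Finset.sum_eq_zero fun a ha => ?_
    rw [hper q hq a ha (Or.inl hne), mul_zero]

/-- To bound `Lpiece` it suffices to bound `Phi` at the fractions within reach of the cutoff. -/
lemma norm_Lpiece_le {χ : EuclideanSpace ℝ (Fin n) → ℂ} (hχ : IsCutoff χ) {X : ℝ} (hX1 : 0 ≤ X)
    (hX : ∀ ξ, ‖χ ξ‖ ≤ X)
    (ψ : EuclideanSpace ℝ (Fin d) → ℝ) (K : EuclideanSpace ℝ (Fin d) → ℂ) (j : ℕ) {k : ℕ}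
    (hk : 1 ≤ k) (ξ : EuclideanSpace ℝ (Fin n)) {δ : ℝ} (hδ : 0 ≤ δ)
    (h : ∀ q ∈ Finset.Ico (2 ^ (k - 1)) (2 ^ k), ∀ a ∈ numerators n q, ∀ l : Fin n → ℤ,
      ‖Phi P ψ K j (ξ - ratPt a q + latticePt l)‖ ≤ δ) :
    ‖Lpiece P ψ χ K j k ξ‖ ≤ δ * X := by
  by_cases hex : ∃ q ∈ Finset.Ico (2 ^ (k - 1)) (2 ^ k), ∃ a ∈ numerators n q, ∃ l : Fin n → ℤ,
      χ ((2 : ℝ) ^ (10 * k) • (ξ - ratPt a q + latticePt l)) ≠ 0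
  · obtain ⟨q, hq, a, ha, l, hne⟩ := hex
    rw [Lpiece_eq_single hχ ψ K j hk hq ha l ξ (hχ.norm_le_of_ne hne), norm_mul, norm_mul]
    calc _ ≤ 1 * (δ * X) := by
          gcongr
          · exact norm_gaussS_le P a q
          · exact h q hq a ha l
          · exact hX _
      _ = δ * X := one_mul _
  · push Not at hex
    have : Lpiece P ψ χ K j k ξ = 0 := by
      unfold Lpiece
      refine Finset.sum_eq_zero fun q hq => Finset.sum_eq_zero fun a ha => ?_
      unfold periodize
      have h0 : ∀ l : Fin n → ℤ, (fun η => Phi P ψ K j η * χ ((2 : ℝ) ^ (10 * k) • η))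
          (ξ - ratPt a q + latticePt l) = 0 := fun l => by
        simp only [hex q hq a ha l, mul_zero]
      rw [tsum_congr h0, tsum_zero, mul_zero]
    rw [this, norm_zero]; positivity

/-! ### The uniform bound of the error multiplier -/

lemma integral_norm_Kpiece_le {ψ : EuclideanSpace ℝ (Fin d) → ℝ} (hψ : IsDyadicPartition ψ)
    (K : EuclideanSpace ℝ (Fin d) → ℂ) (j : ℕ) {B : ℝ}
    (hB : ∀ t, ‖Kpiece ψ K j t‖ ≤ B / (2 ^ j) ^ d) :
    ∫ t, ‖Kpiece ψ K j t‖ ≤ 4 ^ d * B := by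
  set Q : Set (EuclideanSpace ℝ (Fin d)) := WithLp.ofLp ⁻¹'
    (Set.univ.pi fun _ => Set.Icc (-(2 : ℝ) ^ (j + 1)) (2 ^ (j + 1))) with hQ
  have hvol : volume Q = ENNReal.ofReal ((4 * 2 ^ j) ^ d) := by
    rw [hQ, (PiLp.volume_preserving_ofLp (Fin d)).measure_preimage
      (MeasurableSet.univ_pi fun _ => measurableSet_Icc).nullMeasurableSet, volume_pi_pi]
    simp only [Real.volume_Icc, Finset.prod_const, Finset.card_univ, Fintype.card_fin]
    rw [ENNReal.ofReal_pow (by positivity)]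
    congr 2; ring
  have h1 : ∫ t, ‖Kpiece ψ K j t‖ = ∫ t in Q, ‖Kpiece ψ K j t‖ := by
    symm
    apply setIntegral_eq_integral_of_forall_compl_eq_zero
    intro t ht
    by_contra h
    apply ht
    rw [hQ, mem_preimage, mem_univ_pi]
    intro l
    have := (abs_coord_le_norm t l).trans (Kpiece_support hψ K j (norm_ne_zero_iff.1 h)).2
    exact abs_le.1 this
  have h2 := norm_setIntegral_le_of_norm_le_const (μ := volume) (s := Q)
    (f := fun t => ‖Kpiece ψ K j t‖) (C := B / (2 ^ j) ^ d) (by rw [hvol]; exact ENNReal.ofReal_lt_top)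
    (fun t _ => by rw [norm_norm]; exact hB t)
  rw [h1]
  refine (Real.le_norm_self _).trans (h2.trans (le_of_eq ?_))
  rw [Measure.real, hvol, ENNReal.toReal_ofReal (by positivity), mul_pow]
  field_simp

lemma norm_Phi_le {ψ : EuclideanSpace ℝ (Fin d) → ℝ} (hψ : IsDyadicPartition ψ)
    (K : EuclideanSpace ℝ (Fin d) → ℂ) (j : ℕ) {B : ℝ}
    (hB : ∀ t, ‖Kpiece ψ K j t‖ ≤ B / (2 ^ j) ^ d) (ξ : EuclideanSpace ℝ (Fin n)) :
    ‖Phi P ψ K j ξ‖ ≤ 4 ^ d * B := by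
  refine (norm_integral_le_integral_norm _).trans ?_
  simp only [norm_mul, norm_expPhase, one_mul]
  exact integral_norm_Kpiece_le hψ K j hB

lemma norm_mMult_le {ψ : EuclideanSpace ℝ (Fin d) → ℝ} (hψ : IsDyadicPartition ψ)
    (K : EuclideanSpace ℝ (Fin d) → ℂ) (j : ℕ) {B : ℝ} (hB0 : 0 ≤ B)
    (hB : ∀ t, ‖Kpiece ψ K j t‖ ≤ B / (2 ^ j) ^ d) (ξ : EuclideanSpace ℝ (Fin n)) :
    ‖mMult P ψ K j ξ‖ ≤ 5 ^ d * B := by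
  have hz : ∀ y ∉ box d (2 ^ (j + 1)),
      expPhase (phase P (latticePt y) ξ) * Kpiece ψ K j (latticePt y) = 0 := by
    intro y hy
    by_contra h
    apply hy
    rw [mem_box]
    intro i
    have := integrand_support hψ K j ξ _ h i
    exact abs_intCast_le_iff.1 (by push_cast; exact this)
  rw [mMult, tsum_eq_sum hz]
  refine (norm_sum_le_of_le _ (n := fun _ => B / (2 ^ j) ^ d) fun y _ => by
    rw [norm_mul, norm_expPhase, one_mul]; exact hB _).trans ?_
  rw [Finset.sum_const, card_box, nsmul_eq_mul]
  have h1 : ((2 * 2 ^ (j + 1) + 1 : ℕ) : ℝ) ≤ 5 * 2 ^ j := by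
    have : (1 : ℝ) ≤ 2 ^ j := one_le_pow₀ (by norm_num)
    push_cast
    rw [pow_succ]; linarith
  push_cast at h1 ⊢
  calc (2 * 2 ^ (j + 1) + 1 : ℝ) ^ d * (B / (2 ^ j) ^ d)
      ≤ (5 * 2 ^ j) ^ d * (B / (2 ^ j) ^ d) := by gcongr
    _ = 5 ^ d * B := by rw [mul_pow]; field_simp

/-- The circle method at one frequency. Let `T = 2 ^ ⌊j δ₁⌋`, and suppose that exponential sums and
oscillatory integrals exceeding `δ` force frequencies within `B 2^{-j D_i}` of the origin modulo
rationals with denominator at most `B < T`. If the frequency is that close to a reduced fraction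
with denominator below `T`, then this fraction contributes the main term of the exponential sum, and
all other fractions contribute at most `δ` each; otherwise everything is at most `δ`. -/
lemma norm_EMult_le_of_alternatives (hP : IsAdmissible P) {δ₁ : ℝ} (hδ₁0 : 0 < δ₁)
    (hδ₁ : δ₁ < 1 / 1000) {ψ : EuclideanSpace ℝ (Fin d) → ℝ}
    {χ : EuclideanSpace ℝ (Fin n) → ℂ} (hχ : IsCutoff χ) {X : ℝ} (hX1 : 1 ≤ X)
    (hX : ∀ ξ, ‖χ ξ‖ ≤ X) {K : EuclideanSpace ℝ (Fin d) → ℂ} {j : ℕ}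
    {B δ C₁ : ℝ} (hδ0 : 0 < δ) (hB1 : 1 ≤ B) (hBδ : 1 / δ ≤ B) (hC₁ : 0 ≤ C₁)
    (hBT : B < 2 ^ ⌊(j : ℝ) * δ₁⌋₊) (hnT : (n : ℝ) + 4 ≤ 2 ^ ⌊(j : ℝ) * δ₁⌋₊)
    (ξ : EuclideanSpace ℝ (Fin n))
    (hm : δ < ‖mMult P ψ K j ξ‖ → ∃ q : ℕ, 1 ≤ q ∧ (q : ℝ) ≤ B ∧
      ∀ i, NearInt (B / (2 ^ j) ^ degs P i) (q * ξ i))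
    (hΦ : ∀ η, δ < ‖Phi P ψ K j η‖ → ∀ i, |η i| ≤ B / (2 ^ j) ^ degs P i)
    (hmaj : ∀ q : ℕ, 1 ≤ q → q ≤ 2 ^ j → ∀ (a : Fin n → ℕ) (l : Fin n → ℤ),
      (∀ i, |(ξ - ratPt a q + latticePt l) i| ≤ B / (2 ^ j) ^ degs P i) →
      ‖mMult P ψ K j ξ - gaussS P a q * Phi P ψ K j (ξ - ratPt a q + latticePt l)‖
        ≤ C₁ * q * (1 + B) / 2 ^ j) :
    ‖EMult P δ₁ ψ χ K j ξ‖ ≤ (1 + C₁ + j) * X * δ := by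
  set J := ⌊(j : ℝ) * δ₁⌋₊ with hJ
  have hJj : 1000 * J ≤ j := by
    have h1 : (J : ℝ) ≤ j * δ₁ := Nat.floor_le (by positivity)
    have h2 : (j : ℝ) * δ₁ ≤ j * (1 / 1000) := by gcongr
    have : (1000 : ℝ) * J ≤ j := by linarith
    exact_mod_cast this
  have hJj' : J ≤ j := by omega
  set T : ℝ := 2 ^ J with hT
  have hn0 : (0 : ℝ) ≤ n := Nat.cast_nonneg n
  have hT4 : 4 ≤ T := by linarith
  have hTpow : ∀ m ≤ 1000, T ^ m ≤ 2 ^ j := by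
    intro m hm
    rw [hT, ← pow_mul]
    exact pow_le_pow_right₀ (by norm_num) (by nlinarith)
  have h2j : (1 : ℝ) ≤ 2 ^ j := one_le_pow₀ (by norm_num)
  have hdecay : ∀ i, B / (2 ^ j) ^ degs P i ≤ T / 2 ^ j := by
    intro i
    have hD := hP.one_le_degs i
    have : (2 : ℝ) ^ j ≤ (2 ^ j) ^ degs P i := le_self_pow₀ h2j (by omega)
    gcongr
  have hqT : ∀ k ∈ Finset.Icc 1 J, ∀ q : ℕ, q ∈ Finset.Ico (2 ^ (k - 1)) (2 ^ k) → (q : ℝ) < T := by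
    intro k hk q hq
    rw [Finset.mem_Icc] at hk
    rw [Finset.mem_Ico] at hq
    have h1 : (q : ℝ) < 2 ^ k := by exact_mod_cast hq.2
    exact h1.trans_le (pow_le_pow_right₀ (by norm_num) hk.2)
  have hq1 : ∀ k q : ℕ, q ∈ Finset.Ico (2 ^ (k - 1)) (2 ^ k) → 1 ≤ q := by
    intro k q hq
    rw [Finset.mem_Ico] at hq
    exact Nat.one_le_two_pow.trans hq.1
  have hδX : δ ≤ δ * X := by nlinarith
  -- major arcs against minor arcs
  by_cases hnear : ∃ q : ℕ, 1 ≤ q ∧ (q : ℝ) < T ∧ ∃ a ∈ numerators n q, ∃ l : Fin n → ℤ,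
      ∀ i, |(ξ - ratPt a q + latticePt l) i| ≤ B / (2 ^ j) ^ degs P i
  · obtain ⟨q₀, hq₀1, hq₀T, a₀, ha₀, l₀, hη₀⟩ := hnear
    set η₀ := ξ - ratPt a₀ q₀ + latticePt l₀ with hη₀def
    set k₀ := Nat.log 2 q₀ + 1 with hk₀
    have hq₀N : q₀ < 2 ^ J := by rw [hT] at hq₀T; exact_mod_cast hq₀T
    have hk₀J : k₀ ≤ J := Nat.log_lt_of_lt_pow (by omega) hq₀N
    have hq₀mem : q₀ ∈ Finset.Ico (2 ^ (k₀ - 1)) (2 ^ k₀) := by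
      rw [Finset.mem_Ico, hk₀, Nat.add_sub_cancel]
      exact ⟨Nat.pow_log_le_self 2 (by omega), Nat.lt_pow_succ_log_self (by norm_num) _⟩
    have hk₀mem : k₀ ∈ Finset.Icc 1 J := Finset.mem_Icc.2 ⟨by omega, hk₀J⟩
    have hηn : (2 : ℝ) ^ (10 * k₀) * ‖η₀‖ ≤ 1 := by
      have h1 : ‖η₀‖ ≤ n * (T / 2 ^ j) := by
        refine (norm_le_sum_abs η₀).trans ?_
        calc ∑ i, |η₀ i| ≤ ∑ _i : Fin n, T / 2 ^ j :=
              Finset.sum_le_sum fun i _ => (hη₀ i).trans (hdecay i)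
          _ = n * (T / 2 ^ j) := by simp
      have h2 : (2 : ℝ) ^ (10 * k₀) ≤ T ^ 10 := by
        rw [hT, ← pow_mul]; exact pow_le_pow_right₀ (by norm_num) (by omega)
      calc (2 : ℝ) ^ (10 * k₀) * ‖η₀‖ ≤ T ^ 10 * (T * (T / 2 ^ j)) := by
            gcongr; refine h1.trans ?_; gcongr; linarith
        _ = T ^ 12 / 2 ^ j := by ring
        _ ≤ 1 := div_le_one_of_le₀ (hTpow 12 (by norm_num)) (by positivity)
    have hmain : Lpiece P ψ χ K j k₀ ξ = gaussS P a₀ q₀ * Phi P ψ K j η₀ := by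
      rw [Lpiece_eq_single hχ ψ K j (by omega) hq₀mem ha₀ l₀ ξ, hχ.one, mul_one]
      · rw [norm_smul, norm_pow, Real.norm_ofNat]; exact hηn
      · rw [le_div_iff₀ (by positivity)]
        have : ‖η₀‖ * 2 ^ (10 * k₀) ≤ 1 := by rw [mul_comm]; exact hηn
        linarith
    -- Two reduced fractions of small denominator cannot both be close to `ξ`, so `Phi` is small at the
    -- others.
    have hother : ∀ k ∈ (Finset.Icc 1 J).erase k₀, ‖Lpiece P ψ χ K j k ξ‖ ≤ δ * X := by
      intro k hk
      rw [Finset.mem_erase] at hk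
      refine norm_Lpiece_le hχ (by linarith) hX ψ K j (Finset.mem_Icc.1 hk.2).1 ξ hδ0.le ?_
      intro q hq a ha l
      by_contra hgt
      have hη := hΦ _ (not_le.1 hgt)
      have hqT' := hqT k hk.2 q hq
      have hq1' := hq1 k q hq
      obtain ⟨rfl, -, -⟩ := fraction_unique hq1' hq₀1 ha ha₀ (ξ := ξ) (l := l) (l' := l₀) (by
        intro i
        have h1 := (hη i).trans (hdecay i)
        have h2 := (hη₀ i).trans (hdecay i)
        have h3 : (0 : ℝ) < q := by exact_mod_cast hq1'
        have h4 : (0 : ℝ) < q₀ := by exact_mod_cast hq₀1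
        refine (add_le_add h1 h2).trans_lt ?_
        rw [← add_div, div_lt_div_iff₀ (by positivity) (by positivity), one_mul]
        calc (T + T) * (q * q₀) < (T + T) * (T * T) := by
              have := mul_lt_mul'' hqT' hq₀T h3.le h4.le
              gcongr
          _ ≤ T ^ 4 := by nlinarith [pow_nonneg (by linarith : 0 ≤ T) 3]
          _ ≤ 2 ^ j := hTpow 4 (by norm_num))
      apply hk.1
      rw [Finset.mem_Ico] at hq
      have e := (Nat.log_eq_iff (b := 2) (m := k - 1) (n := q) (Or.inr ⟨by norm_num, by omega⟩)).2
        ⟨hq.1, by rw [Nat.sub_add_cancel (Finset.mem_Icc.1 hk.2).1]; exact hq.2⟩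
      have := (Finset.mem_Icc.1 hk.2).1
      omega
    have hE : EMult P δ₁ ψ χ K j ξ = (mMult P ψ K j ξ - gaussS P a₀ q₀ * Phi P ψ K j η₀)
        - ∑ k ∈ (Finset.Icc 1 J).erase k₀, Lpiece P ψ χ K j k ξ := by
      rw [EMult, LMult, ← hJ, ← Finset.add_sum_erase _ _ hk₀mem, hmain]; ring
    have hq₀j : q₀ ≤ 2 ^ j := hq₀N.le.trans (Nat.pow_le_pow_right (by norm_num) hJj')
    have hmaj' := hmaj q₀ hq₀1 hq₀j a₀ l₀ hη₀
    have herr : C₁ * q₀ * (1 + B) / 2 ^ j ≤ C₁ * δ := by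
      have h1 : (q₀ : ℝ) * (1 + B) / 2 ^ j ≤ δ := by
        rw [div_le_iff₀ (by positivity)]
        have h5 : 1 ≤ δ * T := by
          rw [div_le_iff₀ hδ0] at hBδ; nlinarith
        calc (q₀ : ℝ) * (1 + B) ≤ T * (T + T) := by gcongr; linarith
          _ ≤ 1 * T ^ 3 := by nlinarith [sq_nonneg T]
          _ ≤ (δ * T) * T ^ 3 := by gcongr
          _ = δ * T ^ 4 := by ring
          _ ≤ δ * 2 ^ j := by gcongr; exact hTpow 4 (by norm_num)
      calc C₁ * q₀ * (1 + B) / 2 ^ j = C₁ * (q₀ * (1 + B) / 2 ^ j) := by ring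
        _ ≤ _ := by gcongr
    rw [hE]
    refine (norm_sub_le _ _).trans ?_
    have hsum : ‖∑ k ∈ (Finset.Icc 1 J).erase k₀, Lpiece P ψ χ K j k ξ‖ ≤ j * (δ * X) := by
      refine (norm_sum_le_of_le _ hother).trans ?_
      rw [Finset.sum_const, nsmul_eq_mul]
      gcongr
      have : ((Finset.Icc 1 J).erase k₀).card ≤ J := by
        refine (Finset.card_le_card (Finset.erase_subset _ _)).trans ?_
        simp
      exact_mod_cast this.trans hJj'
    have h7 : C₁ * δ ≤ C₁ * (δ * X) := by gcongr
    have h8 : 0 ≤ X * δ := by positivity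
    have h9 := hmaj'.trans (herr.trans h7)
    calc _ ≤ C₁ * (δ * X) + j * (δ * X) := add_le_add h9 hsum
      _ ≤ (1 + C₁ + j) * X * δ := by nlinarith
  · have hmle : ‖mMult P ψ K j ξ‖ ≤ δ := by
      by_contra hgt
      obtain ⟨q, hq1', hqB, hqn⟩ := hm (not_le.1 hgt)
      apply hnear
      choose b hb using hqn
      obtain ⟨q', hq'1, hq'q, a, ha, l, hal⟩ := exists_reduced_fraction hq1' b
      have hq'B : (q' : ℝ) ≤ B := le_trans (by exact_mod_cast hq'q) hqB
      refine ⟨q', hq'1, hq'B.trans_lt hBT, a, ha, l, fun i => ?_⟩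
      have e1 : (ξ - ratPt a q' + latticePt l) i = ξ i - (b i : ℝ) / q := by
        have e2 : ratPt a q' i = (a i : ℝ) / q' := rfl
        simp only [PiLp.add_apply, PiLp.sub_apply, latticePt_apply]
        rw [hal, e2]; ring
      have hq0 : (1 : ℝ) ≤ q := by exact_mod_cast hq1'
      have e3 : ξ i - (b i : ℝ) / q = (q * ξ i - b i) / q := by field_simp
      rw [e1, e3, abs_div, Nat.abs_cast]
      refine (div_le_self (abs_nonneg _) hq0).trans (hb i)
    have hL : ∀ k ∈ Finset.Icc 1 J, ‖Lpiece P ψ χ K j k ξ‖ ≤ δ * X := by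
      intro k hk
      refine norm_Lpiece_le hχ (by linarith) hX ψ K j (Finset.mem_Icc.1 hk).1 ξ hδ0.le ?_
      intro q hq a ha l
      by_contra hgt
      exact hnear ⟨q, hq1 k q hq, hqT k hk q hq, a, ha, l, hΦ _ (not_le.1 hgt)⟩
    rw [EMult, LMult, ← hJ]
    refine (norm_sub_le _ _).trans ?_
    have hsum : ‖∑ k ∈ Finset.Icc 1 J, Lpiece P ψ χ K j k ξ‖ ≤ j * (δ * X) := by
      refine (norm_sum_le_of_le _ hL).trans ?_
      rw [Finset.sum_const, nsmul_eq_mul, Nat.card_Icc, Nat.add_sub_cancel]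
      gcongr
    have h8 : 0 ≤ C₁ * (X * δ) := by positivity
    nlinarith

end Pieces

section Pieces

variable {d n : ℕ} {P : Fin n → MvPolynomial (Fin d) ℤ}

/-- The trivial bound, from the integrability of the pieces of the kernel. -/
lemma norm_EMult_le_linear {ψ : EuclideanSpace ℝ (Fin d) → ℝ} (hψ : IsDyadicPartition ψ)
    {χ : EuclideanSpace ℝ (Fin n) → ℂ} (hχ : IsCutoff χ) {X : ℝ} (hX1 : 1 ≤ X)
    (hX : ∀ ξ, ‖χ ξ‖ ≤ X) {δ₁ : ℝ} (hδ₁ : δ₁ ≤ 1)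
    (K : EuclideanSpace ℝ (Fin d) → ℂ) (j : ℕ) {B : ℝ} (hB0 : 0 ≤ B)
    (hB : ∀ t, ‖Kpiece ψ K j t‖ ≤ B / (2 ^ j) ^ d) (ξ : EuclideanSpace ℝ (Fin n)) :
    ‖EMult P δ₁ ψ χ K j ξ‖ ≤ 5 ^ d * B * X * (1 + j) := by
  have hΦ := fun η => norm_Phi_le (P := P) hψ K j hB η
  have hm := norm_mMult_le (P := P) hψ K j hB0 hB ξ
  have hL : ‖LMult P δ₁ ψ χ K j ξ‖ ≤ j * (4 ^ d * B * X) := by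
    rw [LMult]
    refine (norm_sum_le_of_le _ (n := fun _ => 4 ^ d * B * X) fun k hk => ?_).trans ?_
    · exact norm_Lpiece_le hχ (by linarith) hX ψ K j (Finset.mem_Icc.1 hk).1 ξ (by positivity)
        fun q _ a _ l => hΦ _
    · rw [Finset.sum_const, nsmul_eq_mul, Nat.card_Icc, Nat.add_sub_cancel]
      have h1 : ((⌊(j : ℝ) * δ₁⌋₊ : ℕ) : ℝ) ≤ j := by
        have : ⌊(j : ℝ) * δ₁⌋₊ ≤ j :=
          Nat.floor_le_of_le (mul_le_of_le_one_right (Nat.cast_nonneg j) hδ₁)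
        exact_mod_cast this
      exact mul_le_mul_of_nonneg_right h1 (by positivity)
  have h45 : (4 : ℝ) ^ d ≤ 5 ^ d := by gcongr; norm_num
  rw [EMult]
  refine (norm_sub_le _ _).trans ((add_le_add hm hL).trans ?_)
  have h1 : 5 ^ d * B ≤ 5 ^ d * B * X := le_mul_of_one_le_right (by positivity) hX1
  have h2 : 4 ^ d * B * X ≤ 5 ^ d * B * X := by gcongr
  have h3 := mul_le_mul_of_nonneg_left h2 (Nat.cast_nonneg (α := ℝ) j)
  linarith

/-- A linear factor is absorbed by an arbitrarily small power. -/
lemma one_add_le_rpow {a : ℝ} (ha : 0 < a) {x : ℝ} (hx : 0 ≤ x) :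
    1 + x ≤ (1 + 1 / (a * Real.log 2)) * (2 : ℝ) ^ (a * x) := by
  have hlog : 0 < a * Real.log 2 := mul_pos ha (Real.log_pos (by norm_num))
  have h2 : 1 + a * Real.log 2 * x ≤ (2 : ℝ) ^ (a * x) := by
    rw [Real.rpow_def_of_pos (by norm_num)]
    have := Real.add_one_le_exp (Real.log 2 * (a * x))
    linarith
  refine le_trans ?_ (mul_le_mul_of_nonneg_left h2 (by positivity))
  have : (1 + 1 / (a * Real.log 2)) * (1 + a * Real.log 2 * x)
      = 1 + x + (1 / (a * Real.log 2) + a * Real.log 2 * x) := by field_simp; ring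
  rw [this]
  have : 0 ≤ 1 / (a * Real.log 2) + a * Real.log 2 * x := by positivity
  linarith

/-- Scales `j` beyond a fixed threshold. The exponent `γ = δ₁ / (2 E)` is such that the loss
`(1 / δ) ^ E` in Weyl's inequality at `δ = 2 ^ (-γ j)` is `2 ^ (δ₁ j / 2)`, which is smaller than
the largest denominator `2 ^ (δ₁ j)` of the approximating fractions. -/
lemma norm_EMult_le_of_large (hP : IsAdmissible P) {δ₁ : ℝ} (hδ₁0 : 0 < δ₁)
    (hδ₁ : δ₁ < 1 / 1000) {ψ : EuclideanSpace ℝ (Fin d) → ℝ}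
    {χ : EuclideanSpace ℝ (Fin n) → ℂ} (hχ : IsCutoff χ) {X : ℝ} (hX1 : 1 ≤ X)
    (hX : ∀ ξ, ‖χ ξ‖ ≤ X) {K : EuclideanSpace ℝ (Fin d) → ℂ} {j : ℕ} {C₁ c : ℝ} (hC₁ : 0 ≤ C₁)
    (hc1 : 1 ≤ c) {E : ℕ} (hE : 1 ≤ E) (ξ : EuclideanSpace ℝ (Fin n))
    (hm : ∀ δ : ℝ, 0 < δ → δ ≤ 1 → δ < ‖mMult P ψ K j ξ‖ → ∃ q : ℕ, 1 ≤ q ∧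
      (q : ℝ) ≤ (c / δ) ^ E ∧ ∀ i, NearInt ((c / δ) ^ E / (2 ^ j) ^ degs P i) (q * ξ i))
    (hΦ : ∀ η, ∀ δ : ℝ, 0 < δ → δ ≤ 1 → δ < ‖Phi P ψ K j η‖ →
      ∀ i, |η i| ≤ (c / δ) ^ E / (2 ^ j) ^ degs P i)
    (hmaj : ∀ q : ℕ, 1 ≤ q → q ≤ 2 ^ j → ∀ (a : Fin n → ℕ) (l : Fin n → ℤ), ∀ B : ℝ, 0 ≤ B →
      (∀ i, |(ξ - ratPt a q + latticePt l) i| ≤ B / (2 ^ j) ^ degs P i) →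
      ‖mMult P ψ K j ξ - gaussS P a q * Phi P ψ K j (ξ - ratPt a q + latticePt l)‖
        ≤ C₁ * q * (1 + B) / 2 ^ j)
    (hlarge : 2 * (c ^ E + n + 4) < (2 : ℝ) ^ (δ₁ * j / 2)) :
    ‖EMult P δ₁ ψ χ K j ξ‖ ≤ (1 + C₁ + j) * X * (2 : ℝ) ^ (-(δ₁ / (2 * E)) * (j : ℝ)) := by
  have hEr : (0 : ℝ) < E := by exact_mod_cast hE
  have hj0 : (0 : ℝ) ≤ j := Nat.cast_nonneg j
  obtain ⟨δ, hδ⟩ : ∃ δ : ℝ, δ = (2 : ℝ) ^ (-(δ₁ / (2 * E)) * (j : ℝ)) := ⟨_, rfl⟩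
  rw [← hδ]
  have hδ0 : 0 < δ := by rw [hδ]; positivity
  have hδ1 : δ ≤ 1 := by
    rw [hδ]
    refine Real.rpow_le_one_of_one_le_of_nonpos (by norm_num) ?_
    have : 0 ≤ δ₁ / (2 * E) * j := by positivity
    linarith
  obtain ⟨Y, hY⟩ : ∃ Y : ℝ, Y = (2 : ℝ) ^ (δ₁ * j / 2) := ⟨_, rfl⟩
  have hAeq : (c / δ) ^ E = c ^ E * Y := by
    rw [div_pow, div_eq_mul_inv]
    congr 1
    rw [hδ, hY, ← Real.rpow_natCast, ← Real.rpow_mul (by norm_num), ← Real.rpow_neg (by norm_num)]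
    congr 1
    field_simp
  have hTlow : Y * Y ≤ 2 * 2 ^ ⌊(j : ℝ) * δ₁⌋₊ := by
    rw [hY, ← Real.rpow_add (by norm_num), ← pow_succ', ← Real.rpow_natCast]
    apply Real.rpow_le_rpow_of_exponent_le (by norm_num)
    have := (Nat.lt_floor_add_one ((j : ℝ) * δ₁)).le
    push_cast
    linarith
  rw [← hY] at hlarge
  have hn0 : (0 : ℝ) ≤ n := Nat.cast_nonneg n
  have hcE : 0 < c ^ E := by positivity
  have hY1 : 1 ≤ Y := by linarith
  have hcδ : 1 ≤ c / δ := by rw [le_div_iff₀ hδ0]; linarith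
  have hT1 : (c ^ E + n + 4) * Y < 2 ^ ⌊(j : ℝ) * δ₁⌋₊ := by
    have : 2 * (c ^ E + n + 4) * Y < Y * Y := mul_lt_mul_of_pos_right hlarge (by linarith)
    linarith
  have hT2 : c ^ E * Y ≤ (c ^ E + n + 4) * Y :=
    mul_le_mul_of_nonneg_right (by linarith) (by linarith)
  have hT3 : (n : ℝ) + 4 ≤ (c ^ E + n + 4) * Y :=
    (by linarith : (n : ℝ) + 4 ≤ c ^ E + n + 4).trans (le_mul_of_one_le_right (by linarith) hY1)
  have hinv : 1 / δ ≤ (c / δ) ^ E := by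
    have h1 : 1 / δ ≤ c / δ := by gcongr
    exact h1.trans (le_self_pow₀ hcδ (by omega))
  exact norm_EMult_le_of_alternatives hP hδ₁0 hδ₁ hχ hX1 hX hδ0 (one_le_pow₀ hcδ) hinv hC₁
    (by rw [hAeq]; exact hT2.trans_lt hT1) (hT3.trans hT1.le) ξ (hm δ hδ0 hδ1)
    (fun η => hΦ η δ hδ0 hδ1) (fun q hq1 hqj a l => hmaj q hq1 hqj a l _ (by positivity))

/-- The error multiplier is exponentially small, uniformly in the frequency. -/
theorem exists_norm_EMult_le (hP : IsAdmissible P) {δ₁ : ℝ} (hδ₁0 : 0 < δ₁)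
    (hδ₁ : δ₁ < 1 / 1000) : ∃ γ : ℝ, 0 < γ ∧
    ∀ ψ : EuclideanSpace ℝ (Fin d) → ℝ, IsDyadicPartition ψ →
    ∀ χ : EuclideanSpace ℝ (Fin n) → ℂ, IsCutoff χ → ∃ C : ℝ, 0 < C ∧
    ∀ K : EuclideanSpace ℝ (Fin d) → ℂ, IsCZKernel K → ∀ j : ℕ, 1 ≤ j → ∀ ξ,
      ‖EMult P δ₁ ψ χ K j ξ‖ ≤ C * (2 : ℝ) ^ (-γ * (j : ℝ)) := by
  obtain ⟨Cw, hCw⟩ := exists_weyl_Kpiece hP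
  obtain ⟨Cp, hCp⟩ := exists_Phi_decay hP
  obtain ⟨E, hE1, hEw, hEp⟩ : ∃ E : ℕ, 1 ≤ E ∧ Cw ≤ E ∧ Cp ≤ E :=
    ⟨Cw + Cp + 1, by omega, by omega, by omega⟩
  have hEr : (1 : ℝ) ≤ E := by exact_mod_cast hE1
  obtain ⟨γ₁, hγ₁⟩ : ∃ γ₁ : ℝ, γ₁ = δ₁ / (2 * E) := ⟨_, rfl⟩
  have hγ₁0 : 0 < γ₁ := by rw [hγ₁]; positivity
  have hγle : γ₁ ≤ δ₁ / 2 := by rw [hγ₁]; gcongr; linarith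
  refine ⟨γ₁ / 2, by positivity, fun ψ hψ χ hχ => ?_⟩
  obtain ⟨c₁, hc₁1, hc₁⟩ := hCw ψ hψ
  obtain ⟨c₂, hc₂1, hc₂⟩ := hCp ψ hψ
  obtain ⟨B, hB1, hB⟩ := exists_Kpiece_bounds hψ
  obtain ⟨C₁, hC₁1, hC₁⟩ := exists_major_arc_bound (P := P) hψ
  obtain ⟨X, hX1, hX⟩ := hχ.exists_bound
  obtain ⟨c, hcc₁, hcc₂⟩ : ∃ c : ℝ, c₁ ≤ c ∧ c₂ ≤ c := ⟨max c₁ c₂, le_max_left _ _, le_max_right _ _⟩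
  have hc1 : 1 ≤ c := hc₁1.trans hcc₁
  obtain ⟨Z, hZ⟩ : ∃ Z : ℝ, Z = 2 * (c ^ E + n + 4) := ⟨_, rfl⟩
  have hZ1 : 1 ≤ Z := by
    have h1 : (0 : ℝ) ≤ n := Nat.cast_nonneg n
    have h2 : 0 ≤ c ^ E := by positivity
    rw [hZ]; linarith
  have h5 : (1 : ℝ) ≤ 5 ^ d := one_le_pow₀ (by norm_num)
  obtain ⟨W, hW1, hW2⟩ : ∃ W : ℝ, (1 + C₁) * X ≤ W ∧ 5 ^ d * B * X * Z ≤ W :=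
    ⟨max _ _, le_max_left _ _, le_max_right _ _⟩
  have hW0 : 0 < W := lt_of_lt_of_le (by positivity) hW1
  have hmain : ∀ K : EuclideanSpace ℝ (Fin d) → ℂ, IsCZKernel K → ∀ j : ℕ, 1 ≤ j → ∀ ξ,
      ‖EMult P δ₁ ψ χ K j ξ‖ ≤ W * (1 + j) * (2 : ℝ) ^ (-γ₁ * (j : ℝ)) := by
    intro K hK j hj ξ
    have hj0 : (0 : ℝ) ≤ j := Nat.cast_nonneg j
    have hpow : ∀ δ : ℝ, 0 < δ → δ ≤ 1 → ∀ m ≤ E, ∀ b, 1 ≤ b → b ≤ c →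
        (b / δ) ^ m ≤ (c / δ) ^ E := by
      intro δ hδ0 hδ1 m hm b hb1 hbc
      have hcδ : 1 ≤ c / δ := by rw [le_div_iff₀ hδ0]; linarith
      have h1 : (b / δ) ^ m ≤ (c / δ) ^ m := by gcongr
      exact h1.trans (pow_le_pow_right₀ hcδ hm)
    -- Below the threshold the linear bound suffices, as `2 ^ (-γ₁ j)` is bounded below there.
    by_cases hlarge : Z < (2 : ℝ) ^ (δ₁ * j / 2)
    · have := norm_EMult_le_of_large hP hδ₁0 hδ₁ (ψ := ψ) (K := K) (j := j) (C₁ := C₁) (c := c)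
        (E := E) hχ hX1 hX (by linarith) hc1 hE1 ξ
        (fun δ hδ0 hδ1 hlt => by
          obtain ⟨q, h1, h2, h3⟩ := hc₁ K hK j hj 1 le_rfl ξ δ hδ0 hδ1 (by
            simp only [Nat.cast_one, one_pow, mul_one, inv_one, one_smul]
            exact hlt.le)
          have hle := hpow δ hδ0 hδ1 Cw hEw c₁ hc₁1 hcc₁
          refine ⟨q, h1, h2.trans hle, fun i => ?_⟩
          have := h3 i
          simp only [Nat.cast_one, one_pow, div_one, one_mul] at this
          exact this.mono (by gcongr))
        (fun η δ hδ0 hδ1 hη i => by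
          refine (hc₂ K hK j hj η δ hδ0 hδ1 hη i).trans ?_
          have hle := hpow δ hδ0 hδ1 Cp hEp c₂ hc₂1 hcc₂
          gcongr)
        (fun q hq1 hqj a l B hB0 hη => hC₁ K hK j hj q hq1 hqj a l ξ B hB0 hη)
        (by rw [← hZ]; exact hlarge)
      rw [← hγ₁] at this
      refine this.trans (mul_le_mul_of_nonneg_right ?_ (by positivity))
      have h1 : (1 + C₁ + j) * X ≤ (1 + C₁) * X * (1 + j) := by
        have : 0 ≤ C₁ * X * j := by positivity
        linarith
      exact h1.trans (mul_le_mul_of_nonneg_right hW1 (by positivity))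
    · push Not at hlarge
      refine (norm_EMult_le_linear hψ hχ hX1 hX (by linarith) K j (by linarith) (hB K hK j hj).1
        ξ).trans ?_
      have hδZ : 1 ≤ Z * (2 : ℝ) ^ (-γ₁ * (j : ℝ)) := by
        have h1 : 1 ≤ (2 : ℝ) ^ (δ₁ * j / 2) * (2 : ℝ) ^ (-γ₁ * (j : ℝ)) := by
          rw [← Real.rpow_add (by norm_num)]
          apply Real.one_le_rpow (by norm_num)
          have h3 : γ₁ * j ≤ δ₁ / 2 * j := by gcongr
          linarith
        exact h1.trans (mul_le_mul_of_nonneg_right hlarge (by positivity))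
      calc 5 ^ d * B * X * (1 + j)
          ≤ 5 ^ d * B * X * (1 + j) * (Z * (2 : ℝ) ^ (-γ₁ * (j : ℝ))) :=
            le_mul_of_one_le_right (by positivity) hδZ
        _ = 5 ^ d * B * X * Z * ((1 + j) * (2 : ℝ) ^ (-γ₁ * (j : ℝ))) := by ring
        _ ≤ W * ((1 + j) * (2 : ℝ) ^ (-γ₁ * (j : ℝ))) :=
            mul_le_mul_of_nonneg_right hW2 (by positivity)
        _ = _ := by ring
  have hlog : 0 < γ₁ / 2 * Real.log 2 := mul_pos (by positivity) (Real.log_pos (by norm_num))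
  refine ⟨W * (1 + 1 / (γ₁ / 2 * Real.log 2)), by positivity, fun K hK j hj ξ => ?_⟩
  refine (hmain K hK j hj ξ).trans ?_
  have hj0 : (0 : ℝ) ≤ j := Nat.cast_nonneg j
  have h1 := one_add_le_rpow (a := γ₁ / 2) (by positivity) hj0
  have h2 : (2 : ℝ) ^ (γ₁ / 2 * j) * (2 : ℝ) ^ (-γ₁ * (j : ℝ))
      = (2 : ℝ) ^ (-(γ₁ / 2) * (j : ℝ)) := by
    rw [← Real.rpow_add (by norm_num)]; congr 1; ring
  rw [← h2, mul_assoc, mul_assoc]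
  refine mul_le_mul_of_nonneg_left ?_ hW0.le
  rw [← mul_assoc]
  exact mul_le_mul_of_nonneg_right h1 (by positivity)

end Pieces

/-! ### Fourier multipliers on the lattice -/

section Fourier

variable {n : ℕ}

lemma cubeAt_zero_ae_eq : (cubeAt 0 : Set (EuclideanSpace ℝ (Fin n))) =ᵐ[volume]
    {ξ : EuclideanSpace ℝ (Fin n) | ∀ i, ξ i ∈ Set.Icc (0 : ℝ) 1} := by
  have hpre : {ξ : EuclideanSpace ℝ (Fin n) | ∀ i, ξ i ∈ Set.Icc (0 : ℝ) 1}
      = WithLp.ofLp ⁻¹' (Set.univ.pi fun _ => Set.Icc (0 : ℝ) 1) := by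
    ext ξ; simp only [mem_preimage, mem_univ_pi]; rfl
  have hmeas : MeasurableSet (Set.univ.pi fun _ : Fin n => Set.Icc (0 : ℝ) 1) :=
    MeasurableSet.univ_pi fun _ => measurableSet_Icc
  have hvol : volume {ξ : EuclideanSpace ℝ (Fin n) | ∀ i, ξ i ∈ Set.Icc (0 : ℝ) 1} = 1 := by
    rw [hpre, (PiLp.volume_preserving_ofLp (Fin n)).measure_preimage hmeas.nullMeasurableSet,
      volume_pi_pi]
    simp
  apply ae_eq_of_subset_of_measure_ge
  · intro ξ hξ i
    have := hξ i
    simp only [Pi.zero_apply, Int.cast_zero, zero_add] at this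
    exact ⟨this.1, this.2.le⟩
  · rw [hvol, volume_cubeAt]
  · exact (measurableSet_cubeAt 0).nullMeasurableSet
  · rw [hvol]; exact ENNReal.one_ne_top

lemma multOp_eq (m : EuclideanSpace ℝ (Fin n) → ℂ) (f : (Fin n → ℤ) →₀ ℂ) (x : Fin n → ℤ) :
    multOp m f x = ∫ ξ in cubeAt 0, m ξ * latticeFourier f ξ * expPhase (dotLattice ξ x) :=
  (setIntegral_congr_set cubeAt_zero_ae_eq).symm

lemma dotLattice_sub (ξ : EuclideanSpace ℝ (Fin n)) (x y : Fin n → ℤ) :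
    dotLattice ξ (x - y) = dotLattice ξ x - dotLattice ξ y := by
  simp [dotLattice, mul_sub, Finset.sum_sub_distrib]

lemma dotLattice_add (ξ : EuclideanSpace ℝ (Fin n)) (x y : Fin n → ℤ) :
    dotLattice ξ (x + y) = dotLattice ξ x + dotLattice ξ y := by
  simp [dotLattice, mul_add, Finset.sum_add_distrib]

lemma dotLattice_add_left (ξ η : EuclideanSpace ℝ (Fin n)) (x : Fin n → ℤ) :
    dotLattice (ξ + η) x = dotLattice ξ x + dotLattice η x := by
  simp [dotLattice, add_mul, Finset.sum_add_distrib]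

lemma dotLattice_latticePt (l x : Fin n → ℤ) :
    dotLattice (latticePt l) x = ((∑ i, l i * x i : ℤ) : ℝ) := by
  simp [dotLattice, latticePt_apply]

lemma continuous_dotLattice (x : Fin n → ℤ) :
    Continuous fun ξ : EuclideanSpace ℝ (Fin n) => dotLattice ξ x := by
  simp only [dotLattice]; fun_prop

lemma continuous_latticeFourier (f : (Fin n → ℤ) →₀ ℂ) : Continuous (latticeFourier f) := by
  unfold latticeFourier Finsupp.sum
  refine continuous_finsetSum _ fun x _ => continuous_const.mul ?_
  exact continuous_expPhase.comp (continuous_dotLattice x).neg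

lemma norm_latticeFourier_le (f : (Fin n → ℤ) →₀ ℂ) (ξ : EuclideanSpace ℝ (Fin n)) :
    ‖latticeFourier f ξ‖ ≤ ∑ x ∈ f.support, ‖f x‖ := by
  unfold latticeFourier Finsupp.sum
  refine norm_sum_le_of_le _ fun x _ => ?_
  rw [norm_mul, norm_expPhase, mul_one]

lemma integral_Ico_expPhase (k : ℤ) :
    ∫ x in Set.Ico (0 : ℝ) 1, expPhase (x * k) = if k = 0 then 1 else 0 := by
  rw [integral_Ico_eq_integral_Ioc, ← intervalIntegral.integral_of_le (by norm_num)]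
  split_ifs with hk
  · simp [hk, expPhase_zero]
  · have hc : (2 * Real.pi * Complex.I * k : ℂ) ≠ 0 := by
      simp [Real.pi_ne_zero, hk]
    have : ∀ x : ℝ, expPhase (x * k) = Complex.exp (2 * Real.pi * Complex.I * k * x) := by
      intro x; unfold expPhase; congr 1; push_cast; ring
    simp only [this]
    rw [integral_exp_mul_complex hc]
    have h1 : Complex.exp (2 * Real.pi * Complex.I * k * (1 : ℝ)) = 1 := by
      rw [Complex.exp_eq_one_iff]
      exact ⟨k, by push_cast; ring⟩
    rw [h1]; simp

/-- Orthogonality of the characters of the torus. -/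
lemma integral_cubeAt_expPhase (z : Fin n → ℤ) :
    ∫ ξ in cubeAt 0, expPhase (dotLattice ξ z) = if z = 0 then 1 else 0 := by
  have h1 : ∫ ξ in cubeAt (0 : Fin n → ℤ), expPhase (dotLattice ξ z)
      = ∫ x in (Set.univ.pi fun _ : Fin n => Set.Ico (0 : ℝ) 1), ∏ i, expPhase (x i * z i) := by
    rw [cubeAt_eq_preimage]
    simp only [Pi.zero_apply, Int.cast_zero, zero_add]
    rw [← (PiLp.volume_preserving_ofLp (Fin n)).setIntegral_preimage_emb
      (MeasurableEquiv.toLp 2 (Fin n → ℝ)).symm.measurableEmbedding]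
    refine integral_congr_ae (Filter.Eventually.of_forall fun ξ => ?_)
    simp only [dotLattice]
    rw [expPhase_sum]
  rw [h1, volume_pi, Measure.restrict_pi_pi]
  rw [integral_fintype_prod_eq_prod (𝕜 := ℂ) (fun i (x : ℝ) => expPhase (x * z i))]
  simp only [integral_Ico_expPhase]
  split_ifs with hz
  · simp [hz]
  · obtain ⟨i, hi⟩ : ∃ i, z i ≠ 0 := by
      by_contra h; push Not at h; exact hz (funext h)
    exact Finset.prod_eq_zero (Finset.mem_univ i) (by simp [hi])

instance : IsFiniteMeasure (volume.restrict (cubeAt (0 : Fin n → ℤ))) :=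
  ⟨by rw [Measure.restrict_apply_univ, volume_cubeAt]; exact ENNReal.one_lt_top⟩

/-- The convolution kernel of the Fourier multiplier operator `m(∇)`. -/
noncomputable def multKernel (m : EuclideanSpace ℝ (Fin n) → ℂ) (z : Fin n → ℤ) : ℂ :=
  ∫ ξ in cubeAt 0, m ξ * expPhase (dotLattice ξ z)

lemma integrableOn_mul_expPhase {m : EuclideanSpace ℝ (Fin n) → ℂ}
    (hm : IntegrableOn m (cubeAt 0)) (z : Fin n → ℤ) :
    IntegrableOn (fun ξ => m ξ * expPhase (dotLattice ξ z)) (cubeAt 0) := by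
  refine hm.mul_bdd (c := 1) ?_ ?_
  · exact (continuous_expPhase.comp (continuous_dotLattice z)).aestronglyMeasurable
  · exact Filter.Eventually.of_forall fun ξ => by rw [norm_expPhase]

lemma pairing_multOp_eq_integral {m : EuclideanSpace ℝ (Fin n) → ℂ}
    (hm : IntegrableOn m (cubeAt 0)) (f g : (Fin n → ℤ) →₀ ℂ) :
    pairing (multOp m f) g
      = ∫ ξ in cubeAt 0, m ξ * latticeFourier f ξ * (starRingEnd ℂ) (latticeFourier g ξ) := by
  have hmf : IntegrableOn (fun ξ => m ξ * latticeFourier f ξ) (cubeAt 0) :=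
    hm.mul_bdd (c := ∑ x ∈ f.support, ‖f x‖)
      (continuous_latticeFourier f).aestronglyMeasurable
      (Filter.Eventually.of_forall fun ξ => norm_latticeFourier_le f ξ)
  have h : ∀ ξ : EuclideanSpace ℝ (Fin n),
      m ξ * latticeFourier f ξ * (starRingEnd ℂ) (latticeFourier g ξ)
        = ∑ x ∈ g.support, m ξ * latticeFourier f ξ * expPhase (dotLattice ξ x)
          * (starRingEnd ℂ) (g x) := by
    intro ξ
    rw [latticeFourier, latticeFourier, Finsupp.sum, Finsupp.sum, map_sum, Finset.mul_sum]
    refine Finset.sum_congr rfl fun x _ => ?_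
    rw [map_mul, conj_expPhase, neg_neg]; ring
  simp only [h]
  rw [integral_finsetSum _ fun x _ => (integrableOn_mul_expPhase hmf x).mul_const _]
  rw [pairing, Finsupp.sum]
  refine Finset.sum_congr rfl fun x _ => ?_
  rw [multOp_eq, integral_mul_const]

/-- The multiplier operator is the convolution with its kernel. -/
lemma pairing_multOp_eq_sum {m : EuclideanSpace ℝ (Fin n) → ℂ}
    (hm : IntegrableOn m (cubeAt 0)) (f g : (Fin n → ℤ) →₀ ℂ) :
    pairing (multOp m f) g = ∑ x ∈ g.support, ∑ y ∈ f.support,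
      f y * (starRingEnd ℂ) (g x) * multKernel m (x - y) := by
  rw [pairing, Finsupp.sum]
  refine Finset.sum_congr rfl fun x _ => ?_
  have h : ∀ ξ : EuclideanSpace ℝ (Fin n),
      m ξ * latticeFourier f ξ * expPhase (dotLattice ξ x)
        = ∑ y ∈ f.support, f y * (m ξ * expPhase (dotLattice ξ (x - y))) := by
    intro ξ
    rw [latticeFourier, Finsupp.sum, Finset.mul_sum, Finset.sum_mul]
    refine Finset.sum_congr rfl fun y _ => ?_
    rw [dotLattice_sub, sub_eq_add_neg, expPhase_add]; ring
  rw [multOp_eq]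
  simp only [h]
  rw [integral_finsetSum _ fun y _ => (integrableOn_mul_expPhase hm (x - y)).const_mul _,
    Finset.sum_mul]
  refine Finset.sum_congr rfl fun y _ => ?_
  rw [integral_const_mul, multKernel]; ring

/-- Parseval's identity. -/
lemma integral_norm_sq_latticeFourier (f : (Fin n → ℤ) →₀ ℂ) :
    ∫ ξ in cubeAt 0, ‖latticeFourier f ξ‖ ^ 2 = ∑ x ∈ f.support, ‖f x‖ ^ 2 := by
  have hint : IntegrableOn (fun _ : EuclideanSpace ℝ (Fin n) => (1 : ℂ)) (cubeAt 0) :=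
    integrable_const _
  have h1 := pairing_multOp_eq_integral hint f f
  rw [pairing_multOp_eq_sum hint f f] at h1
  have h2 : ∀ z : Fin n → ℤ, multKernel (fun _ => 1) z = if z = 0 then 1 else 0 := by
    intro z; simp only [multKernel, one_mul]; exact integral_cubeAt_expPhase z
  simp only [h2, one_mul, Complex.mul_conj', sub_eq_zero, mul_ite, mul_one, mul_zero] at h1
  have h3 : ∀ x ∈ f.support, (∑ y ∈ f.support,
      if x = y then f y * (starRingEnd ℂ) (f x) else 0) = ((‖f x‖ ^ 2 : ℝ) : ℂ) := by
    intro x hx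
    rw [Finset.sum_ite_eq, if_pos hx, Complex.mul_conj']
    push_cast; rfl
  rw [Finset.sum_congr rfl h3] at h1
  have h4 : ∫ ξ in cubeAt (0 : Fin n → ℤ), (‖latticeFourier f ξ‖ : ℂ) ^ 2
      = ((∫ ξ in cubeAt (0 : Fin n → ℤ), ‖latticeFourier f ξ‖ ^ 2 : ℝ) : ℂ) := by
    rw [← integral_complex_ofReal]
    push_cast; rfl
  rw [h4] at h1
  exact_mod_cast h1.symm

/-- A bounded multiplier is bounded on `ℓ²`. -/
lemma norm_pairing_multOp_le {m : EuclideanSpace ℝ (Fin n) → ℂ}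
    (hm : IntegrableOn m (cubeAt 0)) {S : ℝ} (hS : ∀ ξ, ‖m ξ‖ ≤ S) (f g : (Fin n → ℤ) →₀ ℂ) :
    ‖pairing (multOp m f) g‖ ≤
      S * (√(∑ x ∈ f.support, ‖f x‖ ^ 2) * √(∑ x ∈ g.support, ‖g x‖ ^ 2)) := by
  have hS0 : 0 ≤ S := (norm_nonneg _).trans (hS 0)
  rw [pairing_multOp_eq_integral hm]
  have hmem : ∀ f : (Fin n → ℤ) →₀ ℂ, MemLp (latticeFourier f) (ENNReal.ofReal 2)
      (volume.restrict (cubeAt 0)) := fun f =>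
    MemLp.of_bound (continuous_latticeFourier f).aestronglyMeasurable _
      (Filter.Eventually.of_forall fun ξ => norm_latticeFourier_le f ξ)
  have hcs := integral_mul_norm_le_Lp_mul_Lq (μ := volume.restrict (cubeAt 0))
    (Real.holderConjugate_iff.2 ⟨by norm_num, by norm_num⟩ : Real.HolderConjugate 2 2)
    (hmem f) (hmem g)
  have hsq : ∀ f : (Fin n → ℤ) →₀ ℂ,
      (∫ ξ in cubeAt 0, ‖latticeFourier f ξ‖ ^ (2 : ℝ)) ^ (1 / (2 : ℝ))
        = √(∑ x ∈ f.support, ‖f x‖ ^ 2) := by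
    intro f
    rw [← integral_norm_sq_latticeFourier, Real.sqrt_eq_rpow]
    simp only [Real.rpow_two]
  rw [hsq, hsq] at hcs
  refine (norm_integral_le_of_norm_le (g := fun ξ =>
    S * (‖latticeFourier f ξ‖ * ‖latticeFourier g ξ‖)) ?_ ?_).trans ?_
  · refine Integrable.const_mul ?_ _
    refine Integrable.mono' (integrable_const
      ((∑ x ∈ f.support, ‖f x‖) * ∑ x ∈ g.support, ‖g x‖)) ?_ ?_
    · exact ((continuous_latticeFourier f).norm.mul
        (continuous_latticeFourier g).norm).aestronglyMeasurable
    · refine Filter.Eventually.of_forall fun ξ => ?_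
      rw [norm_mul, norm_norm, norm_norm]
      exact mul_le_mul (norm_latticeFourier_le f ξ) (norm_latticeFourier_le g ξ) (norm_nonneg _)
        (Finset.sum_nonneg fun _ _ => norm_nonneg _)
  · refine Filter.Eventually.of_forall fun ξ => ?_
    simp only [norm_mul, RCLike.norm_conj, mul_assoc]
    exact mul_le_mul_of_nonneg_right (hS ξ) (by positivity)
  · rw [integral_const_mul]
    exact mul_le_mul_of_nonneg_left hcs hS0

/-- Unfolding of a periodization against a character of the torus. -/
lemma multKernel_periodize {g : EuclideanSpace ℝ (Fin n) → ℂ} (hg : Integrable g) {N : ℕ}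
    (ρ : EuclideanSpace ℝ (Fin n))
    (hN : ∀ ξ ∈ cubeAt (0 : Fin n → ℤ), ∀ l ∉ box n N, g (ξ - ρ + latticePt l) = 0)
    (z : Fin n → ℤ) :
    IntegrableOn (fun ξ => periodize g (ξ - ρ)) (cubeAt 0) ∧
    multKernel (fun ξ => periodize g (ξ - ρ)) z
      = expPhase (dotLattice ρ z) * ∫ ξ, g ξ * expPhase (dotLattice ξ z) := by
  have hper : ∀ ξ ∈ cubeAt (0 : Fin n → ℤ),
      periodize g (ξ - ρ) = ∑ l ∈ box n N, g (ξ - ρ + latticePt l) := fun ξ hξ =>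
    tsum_eq_sum fun l hl => hN ξ hξ l hl
  have hgl : ∀ l : Fin n → ℤ, Integrable fun ξ => g (ξ - ρ + latticePt l) := fun l => by
    have := hg.comp_add_right (latticePt l - ρ)
    refine this.congr (Filter.Eventually.of_forall fun ξ => ?_)
    simp only; congr 1; abel
  have hint : IntegrableOn (fun ξ => periodize g (ξ - ρ)) (cubeAt 0) := by
    refine IntegrableOn.congr_fun (f := fun ξ => ∑ l ∈ box n N, g (ξ - ρ + latticePt l)) ?_
      (fun ξ hξ => (hper ξ hξ).symm) (measurableSet_cubeAt 0)
    exact integrable_finsetSum _ fun l _ => (hgl l).integrableOn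
  refine ⟨hint, ?_⟩
  set F : EuclideanSpace ℝ (Fin n) → ℂ := fun ξ => g (ξ - ρ) * expPhase (dotLattice ξ z) with hF
  have hFint : Integrable F := by
    refine (hg.comp_sub_right ρ).mul_bdd (c := 1) ?_ ?_
    · exact (continuous_expPhase.comp (continuous_dotLattice z)).aestronglyMeasurable
    · exact Filter.Eventually.of_forall fun ξ => by rw [norm_expPhase]
  have hFl : ∀ l ξ, F (ξ + latticePt l) = g (ξ - ρ + latticePt l) * expPhase (dotLattice ξ z) := by
    intro l ξ
    simp only [hF]
    rw [dotLattice_add_left, dotLattice_latticePt, expPhase_add_int]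
    congr 2; abel
  have htrans : ∀ l, ∫ ξ in cubeAt l, F ξ = ∫ ξ in cubeAt 0, F (ξ + latticePt l) := by
    intro l
    have hpre : (fun ξ => ξ + latticePt l) ⁻¹' cubeAt l = cubeAt 0 := by
      ext ξ
      simp only [cubeAt, mem_preimage, mem_ofPred_eq, PiLp.add_apply, latticePt_apply, Pi.zero_apply,
        Int.cast_zero, zero_add, mem_Ico]
      refine forall_congr' fun i => ?_
      constructor <;> rintro ⟨h1, h2⟩ <;> constructor <;> linarith
    rw [← hpre, (measurePreserving_add_right volume (latticePt l)).setIntegral_preimage_emb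
      (measurableEmbedding_addRight _)]
  have hsum := hasSum_setIntegral_cubeAt hFint
  have hsum' : ∫ ξ, F ξ = ∑ l ∈ box n N, ∫ ξ in cubeAt l, F ξ := by
    rw [← hsum.tsum_eq]
    refine tsum_eq_sum fun l hl => ?_
    rw [htrans]
    rw [setIntegral_congr_fun (measurableSet_cubeAt 0) (g := fun _ => 0)]
    · simp
    · intro ξ hξ
      simp only [hFl]
      rw [hN ξ hξ l hl, zero_mul]
  calc multKernel (fun ξ => periodize g (ξ - ρ)) z
      = ∫ ξ in cubeAt 0, ∑ l ∈ box n N, F (ξ + latticePt l) := by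
        refine setIntegral_congr_fun (measurableSet_cubeAt 0) fun ξ hξ => ?_
        simp only [hFl]
        rw [hper ξ hξ, Finset.sum_mul]
    _ = ∑ l ∈ box n N, ∫ ξ in cubeAt 0, F (ξ + latticePt l) :=
        integral_finsetSum _ fun l _ => (hFint.comp_add_right _).integrableOn
    _ = ∫ ξ, F ξ := by rw [hsum']; exact Finset.sum_congr rfl fun l _ => (htrans l).symm
    _ = ∫ ξ, F (ξ + ρ) := (integral_add_right_eq_self F ρ).symm
    _ = ∫ ξ, expPhase (dotLattice ρ z) * (g ξ * expPhase (dotLattice ξ z)) := by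
        refine integral_congr_ae (Filter.Eventually.of_forall fun ξ => ?_)
        simp only [hF, add_sub_cancel_right]
        rw [dotLattice_add_left, expPhase_add]; ring
    _ = _ := integral_const_mul _ _

end Fourier

/-! ### Off-diagonal decay of the kernel of the error multiplier -/

section Decay

variable {d n : ℕ} {P : Fin n → MvPolynomial (Fin d) ℤ}

lemma IsCutoff.hasCompactSupport {χ : EuclideanSpace ℝ (Fin n) → ℂ} (hχ : IsCutoff χ) :
    HasCompactSupport χ := by
  apply HasCompactSupport.intro (isCompact_closedBall (0 : EuclideanSpace ℝ (Fin n)) 2)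
  intro x hx
  by_contra h
  exact hx (by simpa using hχ.supp x h)

open FourierTransform in
/-- Rapid decay of the Fourier transform of a dilated cutoff. -/
lemma IsCutoff.exists_fourier_decay {χ : EuclideanSpace ℝ (Fin n) → ℂ} (hχ : IsCutoff χ) (M : ℕ) :
    ∃ C : ℝ, 0 < C ∧ ∀ a : ℝ, 1 ≤ a → ∀ w : EuclideanSpace ℝ (Fin n),
      ‖∫ η : EuclideanSpace ℝ (Fin n), χ (a • η) * expPhase (∑ i, w i * η i)‖ * ‖w‖ ^ M
        ≤ C * a ^ M := by
  obtain ⟨C, hC0, hC⟩ := (𝓕⁻ (hχ.hasCompactSupport.toSchwartzMap hχ.smooth)).decay M 0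
  refine ⟨C, hC0, fun a ha w => ?_⟩
  have ha0 : 0 < a := by linarith
  have h1 : ∫ η : EuclideanSpace ℝ (Fin n), χ (a • η) * expPhase (∑ i, w i * η i)
      = |(a ^ n)⁻¹| • (𝓕⁻ χ) (a⁻¹ • w) := by
    have h2 : ∀ η : EuclideanSpace ℝ (Fin n), χ (a • η) * expPhase (∑ i, w i * η i)
        = (fun u : EuclideanSpace ℝ (Fin n) =>
            Complex.exp (↑(2 * Real.pi * inner ℝ u (a⁻¹ • w)) * Complex.I) • χ u) (a • η) := by
      intro η
      have h3 : inner ℝ (a • η) (a⁻¹ • w) = ∑ i, w i * η i := by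
        rw [inner_smul_left, inner_smul_right, ← mul_assoc]
        simp only [conj_trivial]
        rw [mul_inv_cancel₀ ha0.ne', one_mul]
        simp [PiLp.inner_apply]
      simp only [h3, smul_eq_mul]
      rw [mul_comm, expPhase]
      congr 2; push_cast; ring
    refine (integral_congr_ae (Filter.Eventually.of_forall h2)).trans
      ((Measure.integral_comp_smul volume (fun u : EuclideanSpace ℝ (Fin n) =>
        Complex.exp (↑(2 * Real.pi * inner ℝ u (a⁻¹ • w)) * Complex.I) • χ u) a).trans ?_)
    rw [Real.fourierInv_eq', finrank_euclideanSpace_fin]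
  have h2 := hC (a⁻¹ • w)
  rw [norm_iteratedFDeriv_zero, SchwartzMap.fourierInv_coe, norm_smul, Real.norm_eq_abs,
    abs_of_pos (inv_pos.2 ha0), mul_pow] at h2
  have h3 : ((hχ.hasCompactSupport.toSchwartzMap hχ.smooth : SchwartzMap _ _) :
      EuclideanSpace ℝ (Fin n) → ℂ) = χ := rfl
  rw [h3] at h2
  have h4 : |(a ^ n)⁻¹| ≤ 1 := by
    rw [abs_of_pos (by positivity)]
    exact inv_le_one_of_one_le₀ (one_le_pow₀ ha)
  rw [h1, norm_smul, Real.norm_eq_abs, abs_abs]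
  calc |(a ^ n)⁻¹| * ‖(𝓕⁻ χ) (a⁻¹ • w)‖ * ‖w‖ ^ M
      ≤ 1 * ‖(𝓕⁻ χ) (a⁻¹ • w)‖ * ‖w‖ ^ M := by gcongr
    _ = (a⁻¹ ^ M * ‖w‖ ^ M * ‖(𝓕⁻ χ) (a⁻¹ • w)‖) * a ^ M := by
        rw [inv_pow]; field_simp
    _ ≤ C * a ^ M := by gcongr

lemma Kpiece_hasCompactSupport {ψ : EuclideanSpace ℝ (Fin d) → ℝ} (hψ : IsDyadicPartition ψ)
    (K : EuclideanSpace ℝ (Fin d) → ℂ) (j : ℕ) : HasCompactSupport (Kpiece ψ K j) := by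
  apply HasCompactSupport.intro (isCompact_closedBall (0 : EuclideanSpace ℝ (Fin d)) (2 ^ (j + 1)))
  intro x hx
  by_contra h
  exact hx (by simpa using (Kpiece_support hψ K j h).2)

lemma continuous_Phi {ψ : EuclideanSpace ℝ (Fin d) → ℝ} {K : EuclideanSpace ℝ (Fin d) → ℂ} {j : ℕ}
    (hK : Integrable (Kpiece ψ K j)) : Continuous (Phi P ψ K j) := by
  unfold Phi
  refine continuous_of_dominated (bound := fun t => ‖Kpiece ψ K j t‖) ?_ ?_ hK.norm ?_
  · intro ξ
    exact (continuous_expPhase.comp (continuous_phase_left P ξ)).aestronglyMeasurable.mul hK.1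
  · intro ξ
    exact Filter.Eventually.of_forall fun t => by rw [norm_mul, norm_expPhase, one_mul]
  · exact Filter.Eventually.of_forall fun t =>
      (continuous_expPhase.comp (continuous_phase_right t)).mul continuous_const

lemma phase_add_dotLattice (t : EuclideanSpace ℝ (Fin d)) (η : EuclideanSpace ℝ (Fin n))
    (z : Fin n → ℤ) :
    phase P t η + dotLattice η z = ∑ i, (polyMap P t + latticePt z) i * η i := by
  rw [phase, dotLattice, ← Finset.sum_add_distrib]
  refine Finset.sum_congr rfl fun i _ => ?_
  rw [PiLp.add_apply, latticePt_apply]; ring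

/-- Fubini: the inverse Fourier transform of `Phi` times a cutoff averages that of the cutoff over the
image of `P`. -/
lemma integral_Phi_mul_cutoff {ψ : EuclideanSpace ℝ (Fin d) → ℝ}
    {K : EuclideanSpace ℝ (Fin d) → ℂ} {j : ℕ} (hK : Integrable (Kpiece ψ K j))
    {g : EuclideanSpace ℝ (Fin n) → ℂ} (hg : Integrable g) (z : Fin n → ℤ) :
    ∫ η, Phi P ψ K j η * g η * expPhase (dotLattice η z)
      = ∫ t, Kpiece ψ K j t *
        ∫ η, g η * expPhase (∑ i, (polyMap P t + latticePt z) i * η i) := by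
  have h1 : ∀ η : EuclideanSpace ℝ (Fin n), Phi P ψ K j η * g η * expPhase (dotLattice η z)
      = ∫ t, (g η * Kpiece ψ K j t) *
          expPhase (∑ i, (polyMap P t + latticePt z) i * η i) := by
    intro η
    rw [Phi, mul_assoc, ← integral_mul_const]
    refine integral_congr_ae (Filter.Eventually.of_forall fun t => ?_)
    simp only
    rw [← phase_add_dotLattice, expPhase_add]; ring
  simp only [h1]
  rw [integral_integral_swap]
  · refine integral_congr_ae (Filter.Eventually.of_forall fun t => ?_)
    simp only
    rw [← integral_const_mul]
    refine integral_congr_ae (Filter.Eventually.of_forall fun η => ?_)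
    simp only; ring
  · refine (hg.mul_prod hK).mul_bdd (c := 1) ?_ ?_
    · refine (continuous_expPhase.comp ?_).aestronglyMeasurable
      refine continuous_finsetSum _ fun i _ => ?_
      have h2 : Continuous fun p : EuclideanSpace ℝ (Fin n) × EuclideanSpace ℝ (Fin d) =>
          polyMap P p.2 i := (continuous_polyMap_apply P i).comp continuous_snd
      simp only [PiLp.add_apply]
      fun_prop
    · exact Filter.Eventually.of_forall fun p => by rw [norm_expPhase]

lemma multKernel_const_mul (c : ℂ) (m : EuclideanSpace ℝ (Fin n) → ℂ) (z : Fin n → ℤ) :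
    multKernel (fun ξ => c * m ξ) z = c * multKernel m z := by
  simp only [multKernel, mul_assoc]
  exact integral_const_mul _ _

lemma multKernel_sum {ι : Type*} (s : Finset ι) (m : ι → EuclideanSpace ℝ (Fin n) → ℂ)
    (hm : ∀ i ∈ s, IntegrableOn (m i) (cubeAt 0)) (z : Fin n → ℤ) :
    multKernel (fun ξ => ∑ i ∈ s, m i ξ) z = ∑ i ∈ s, multKernel (m i) z := by
  simp only [multKernel, Finset.sum_mul]
  exact integral_finsetSum _ fun i hi => integrableOn_mul_expPhase (hm i hi) z

lemma IsCutoff.integrable_dilate {χ : EuclideanSpace ℝ (Fin n) → ℂ} (hχ : IsCutoff χ) (k : ℕ) :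
    Integrable fun η : EuclideanSpace ℝ (Fin n) => χ ((2 : ℝ) ^ (10 * k) • η) :=
  (hχ.smooth.continuous.integrable_of_hasCompactSupport hχ.hasCompactSupport).comp_smul
    (by positivity)

lemma IsCutoff.norm_le_two {χ : EuclideanSpace ℝ (Fin n) → ℂ} (hχ : IsCutoff χ) {k : ℕ}
    {η : EuclideanSpace ℝ (Fin n)} (h : χ ((2 : ℝ) ^ (10 * k) • η) ≠ 0) : ‖η‖ ≤ 2 :=
  (hχ.norm_le_of_ne h).trans (div_le_self (by norm_num) (one_le_pow₀ (by norm_num)))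

/-- The kernel of a summand of `Lpiece`. -/
lemma multKernel_fraction {ψ : EuclideanSpace ℝ (Fin d) → ℝ} (hψ : IsDyadicPartition ψ)
    {χ : EuclideanSpace ℝ (Fin n) → ℂ} (hχ : IsCutoff χ)
    {K : EuclideanSpace ℝ (Fin d) → ℂ} {j : ℕ} (hK : Continuous (Kpiece ψ K j)) (k : ℕ)
    {q : ℕ} {a : Fin n → ℕ} (ha : a ∈ numerators n q) (z : Fin n → ℤ) :
    IntegrableOn (fun ξ => periodize (fun η => Phi P ψ K j η * χ ((2 : ℝ) ^ (10 * k) • η))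
      (ξ - ratPt a q)) (cubeAt 0) ∧
    multKernel (fun ξ => periodize (fun η => Phi P ψ K j η * χ ((2 : ℝ) ^ (10 * k) • η))
      (ξ - ratPt a q)) z = expPhase (dotLattice (ratPt a q) z) *
        ∫ t, Kpiece ψ K j t * ∫ η, χ ((2 : ℝ) ^ (10 * k) • η) *
          expPhase (∑ i, (polyMap P t + latticePt z) i * η i) := by
  have hKi : Integrable (Kpiece ψ K j) :=
    hK.integrable_of_hasCompactSupport (Kpiece_hasCompactSupport hψ K j)
  have hgi : Integrable fun η : EuclideanSpace ℝ (Fin n) =>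
      Phi P ψ K j η * χ ((2 : ℝ) ^ (10 * k) • η) := by
    refine (hχ.integrable_dilate k).bdd_mul (c := ∫ t, ‖Kpiece ψ K j t‖)
      (continuous_Phi hKi).aestronglyMeasurable (Filter.Eventually.of_forall fun η => ?_)
    refine (norm_integral_le_integral_norm _).trans (le_of_eq ?_)
    simp only [norm_mul, norm_expPhase, one_mul]
  have := multKernel_periodize hgi (N := 3) (ratPt a q) (by
    intro ξ hξ l hl
    by_contra h
    apply hl
    rw [mem_box]
    intro i
    have h1 := (abs_coord_le_norm _ i).trans (hχ.norm_le_two (right_ne_zero_of_mul h))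
    rw [PiLp.add_apply, PiLp.sub_apply, latticePt_apply] at h1
    have h2 := hξ i
    simp only [Pi.zero_apply, Int.cast_zero, zero_add, mem_Ico] at h2
    have h3 := (mem_numerators.1 ha).1 i
    have hq0 : (0 : ℝ) < q := by exact_mod_cast (Nat.zero_le _).trans_lt h3
    have h4 : 0 ≤ ratPt a q i := by
      change 0 ≤ (a i : ℝ) / q
      positivity
    have h5 : ratPt a q i ≤ 1 := by
      change (a i : ℝ) / q ≤ 1
      rw [div_le_one hq0]
      exact_mod_cast h3.le
    rw [abs_le] at h1
    apply abs_intCast_le_iff.1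
    rw [abs_le]
    push_cast
    constructor <;> linarith) z
  exact ⟨this.1, this.2.trans (by rw [integral_Phi_mul_cutoff hKi (hχ.integrable_dilate k)])⟩

lemma mMult_eq_sum {ψ : EuclideanSpace ℝ (Fin d) → ℝ} (hψ : IsDyadicPartition ψ)
    (K : EuclideanSpace ℝ (Fin d) → ℂ) (j : ℕ) (ξ : EuclideanSpace ℝ (Fin n)) :
    mMult P ψ K j ξ = ∑ y ∈ box d (2 ^ (j + 1)), Kpiece ψ K j (latticePt y) *
      expPhase (dotLattice ξ fun i => MvPolynomial.eval y (P i)) := by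
  rw [mMult, tsum_eq_sum (s := box d (2 ^ (j + 1)))]
  · refine Finset.sum_congr rfl fun y _ => ?_
    rw [mul_comm]
    congr 2
    simp only [phase, dotLattice, polyMap_latticePt]
    exact Finset.sum_congr rfl fun i _ => mul_comm _ _
  · intro y hy
    by_contra h
    apply hy
    rw [mem_box]
    intro i
    have := integrand_support hψ K j ξ _ h i
    exact abs_intCast_le_iff.1 (by push_cast; exact this)

lemma integrableOn_expPhase (x : Fin n → ℤ) :
    IntegrableOn (fun ξ : EuclideanSpace ℝ (Fin n) => expPhase (dotLattice ξ x)) (cubeAt 0) :=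
  Integrable.of_bound (continuous_expPhase.comp (continuous_dotLattice x)).aestronglyMeasurable 1
    (Filter.Eventually.of_forall fun ξ => by rw [norm_expPhase])

lemma multKernel_mMult {ψ : EuclideanSpace ℝ (Fin d) → ℝ} (hψ : IsDyadicPartition ψ)
    (K : EuclideanSpace ℝ (Fin d) → ℂ) (j : ℕ) {z : Fin n → ℤ}
    (hz : ∀ y : Fin d → ℤ, Kpiece ψ K j (latticePt y) ≠ 0 →
      ∃ i, MvPolynomial.eval y (P i) + z i ≠ 0) :
    IntegrableOn (mMult P ψ K j) (cubeAt 0) ∧ multKernel (mMult P ψ K j) z = 0 := by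
  have hfun : mMult P ψ K j = fun ξ => ∑ y ∈ box d (2 ^ (j + 1)), Kpiece ψ K j (latticePt y) *
      expPhase (dotLattice ξ fun i => MvPolynomial.eval y (P i)) :=
    funext fun ξ => mMult_eq_sum hψ K j ξ
  have hint : ∀ y ∈ box d (2 ^ (j + 1)), IntegrableOn (fun ξ : EuclideanSpace ℝ (Fin n) =>
      Kpiece ψ K j (latticePt y) * expPhase (dotLattice ξ fun i => MvPolynomial.eval y (P i)))
      (cubeAt 0) := fun y _ => (integrableOn_expPhase _).const_mul _
  rw [hfun]
  refine ⟨integrable_finsetSum _ hint, ?_⟩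
  rw [multKernel_sum _ _ hint]
  refine Finset.sum_eq_zero fun y _ => ?_
  rw [multKernel_const_mul, mul_eq_zero, or_iff_not_imp_left]
  intro hy
  obtain ⟨i, hi⟩ := hz y hy
  simp only [multKernel, ← expPhase_add, ← dotLattice_add]
  rw [integral_cubeAt_expPhase, if_neg]
  intro h
  exact hi (congrFun h i)

lemma card_numerators_le (n q : ℕ) : (numerators n q).card ≤ q ^ n := by
  refine (Finset.card_filter_le _ _).trans ?_
  simp [Fintype.card_piFinset]

lemma integrableOn_LMult {ψ : EuclideanSpace ℝ (Fin d) → ℝ} (hψ : IsDyadicPartition ψ)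
    {χ : EuclideanSpace ℝ (Fin n) → ℂ} (hχ : IsCutoff χ)
    {K : EuclideanSpace ℝ (Fin d) → ℂ} {j : ℕ} (hK : Continuous (Kpiece ψ K j)) (δ₁ : ℝ) :
    IntegrableOn (LMult P δ₁ ψ χ K j) (cubeAt 0) := by
  unfold LMult Lpiece
  exact integrable_finsetSum _ fun k _ => integrable_finsetSum _ fun q _ =>
    integrable_finsetSum _ fun a ha => (multKernel_fraction hψ hχ hK k ha 0).1.const_mul _

/-- The kernel of `LMult` at a point whose distance to `-P(t)` is at least `U / 2` throughout the
support of the kernel. -/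
lemma norm_multKernel_LMult_le {ψ : EuclideanSpace ℝ (Fin d) → ℝ} (hψ : IsDyadicPartition ψ)
    {χ : EuclideanSpace ℝ (Fin n) → ℂ} (hχ : IsCutoff χ)
    {K : EuclideanSpace ℝ (Fin d) → ℂ} {j : ℕ} (hK : Continuous (Kpiece ψ K j)) (δ₁ : ℝ)
    {B : ℝ} (hB : ∀ t, ‖Kpiece ψ K j t‖ ≤ B / (2 ^ j) ^ d) {M : ℕ} {C : ℝ} (hC0 : 0 ≤ C)
    (hC : ∀ a : ℝ, 1 ≤ a → ∀ w : EuclideanSpace ℝ (Fin n),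
      ‖∫ η : EuclideanSpace ℝ (Fin n), χ (a • η) * expPhase (∑ i, w i * η i)‖ * ‖w‖ ^ M
        ≤ C * a ^ M) {z : Fin n → ℤ} {U : ℝ} (hU0 : 0 < U)
    (hU : ∀ t, Kpiece ψ K j t ≠ 0 → U ≤ 2 * ‖polyMap P t + latticePt z‖) :
    ‖multKernel (LMult P δ₁ ψ χ K j) z‖ ≤
      2 ^ (⌊(j : ℝ) * δ₁⌋₊ * (n + 2)) *
        (4 ^ d * B * (C * (2 ^ (10 * ⌊(j : ℝ) * δ₁⌋₊)) ^ M * 2 ^ M / U ^ M)) := by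
  obtain ⟨J, hJ⟩ : ∃ J : ℕ, J = ⌊(j : ℝ) * δ₁⌋₊ := ⟨_, rfl⟩
  have hKi : Integrable (Kpiece ψ K j) :=
    hK.integrable_of_hasCompactSupport (Kpiece_hasCompactSupport hψ K j)
  have hB0 : 0 ≤ B := by
    have h := (norm_nonneg _).trans (hB 0)
    by_contra hneg
    exact absurd h (not_le.2 (div_neg_of_neg_of_pos (not_le.1 hneg) (by positivity)))
  have hinner : ∀ k ≤ J, ∀ t, ‖Kpiece ψ K j t * ∫ η, χ ((2 : ℝ) ^ (10 * k) • η) *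
        expPhase (∑ i, (polyMap P t + latticePt z) i * η i)‖
      ≤ ‖Kpiece ψ K j t‖ * (C * (2 ^ (10 * J)) ^ M * 2 ^ M / U ^ M) := by
    intro k hk t
    rw [norm_mul]
    by_cases ht : Kpiece ψ K j t = 0
    · rw [ht, norm_zero, zero_mul, zero_mul]
    · refine mul_le_mul_of_nonneg_left ?_ (norm_nonneg _)
      have h1 := hC ((2 : ℝ) ^ (10 * k)) (one_le_pow₀ (by norm_num)) (polyMap P t + latticePt z)
      have h2 := hU t ht
      rw [le_div_iff₀ (by positivity)]
      calc _ ≤ _ * (2 * ‖polyMap P t + latticePt z‖) ^ M := by gcongr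
        _ = (_ * ‖polyMap P t + latticePt z‖ ^ M) * 2 ^ M := by rw [mul_pow]; ring
        _ ≤ C * (2 ^ (10 * k)) ^ M * 2 ^ M := by gcongr
        _ ≤ C * (2 ^ (10 * J)) ^ M * 2 ^ M := by gcongr; norm_num
  have hterm : ∀ k ≤ J, ∀ q, ∀ a ∈ numerators n q,
      ‖multKernel (fun ξ => gaussS P a q * periodize (fun η => Phi P ψ K j η *
        χ ((2 : ℝ) ^ (10 * k) • η)) (ξ - ratPt a q)) z‖
        ≤ 4 ^ d * B * (C * (2 ^ (10 * J)) ^ M * 2 ^ M / U ^ M) := by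
    intro k hk q a ha
    rw [multKernel_const_mul, (multKernel_fraction hψ hχ hK k ha z).2, norm_mul, norm_mul,
      norm_expPhase, one_mul]
    refine (mul_le_of_le_one_left (norm_nonneg _) (norm_gaussS_le P a q)).trans ?_
    refine (norm_integral_le_of_norm_le (hKi.norm.mul_const _)
      (Filter.Eventually.of_forall (hinner k hk))).trans ?_
    rw [integral_mul_const]
    exact mul_le_mul_of_nonneg_right (integral_norm_Kpiece_le hψ K j hB) (by positivity)
  have hR : 0 ≤ 4 ^ d * B * (C * (2 ^ (10 * J)) ^ M * 2 ^ M / U ^ M) := by positivity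
  rw [← hJ]
  unfold LMult Lpiece
  rw [← hJ]
  rw [multKernel_sum _ _ fun k _ => integrable_finsetSum _ fun q _ => integrable_finsetSum _
    fun a ha => (multKernel_fraction hψ hχ hK k ha 0).1.const_mul _]
  refine (norm_sum_le_of_le _ (n := fun _ => 2 ^ J * ((2 ^ J) ^ n *
    (4 ^ d * B * (C * (2 ^ (10 * J)) ^ M * 2 ^ M / U ^ M)))) fun k hk => ?_).trans ?_
  · rw [Finset.mem_Icc] at hk
    rw [multKernel_sum _ _ fun q _ => integrable_finsetSum _
      fun a ha => (multKernel_fraction hψ hχ hK k ha 0).1.const_mul _]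
    have h2k : (2 : ℕ) ^ k ≤ 2 ^ J := Nat.pow_le_pow_right (by norm_num) hk.2
    refine (norm_sum_le_of_le _ (n := fun _ => (2 ^ J) ^ n *
      (4 ^ d * B * (C * (2 ^ (10 * J)) ^ M * 2 ^ M / U ^ M))) fun q hq => ?_).trans ?_
    · rw [Finset.mem_Ico] at hq
      rw [multKernel_sum _ _ fun a ha => (multKernel_fraction hψ hχ hK k ha 0).1.const_mul _]
      refine (norm_sum_le_of_le _ fun a ha => hterm k hk.2 q a ha).trans ?_
      rw [Finset.sum_const, nsmul_eq_mul]
      refine mul_le_mul_of_nonneg_right ?_ hR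
      have : (numerators n q).card ≤ (2 ^ J) ^ n :=
        (card_numerators_le n q).trans (Nat.pow_le_pow_left (hq.2.le.trans h2k) n)
      exact_mod_cast this
    · rw [Finset.sum_const, nsmul_eq_mul, Nat.card_Ico]
      refine mul_le_mul_of_nonneg_right ?_ (by positivity)
      have : 2 ^ k - 2 ^ (k - 1) ≤ 2 ^ J := (Nat.sub_le _ _).trans h2k
      exact_mod_cast this
  · rw [Finset.sum_const, nsmul_eq_mul, Nat.card_Icc, Nat.add_sub_cancel]
    have h1 : (J : ℝ) ≤ 2 ^ J := by exact_mod_cast Nat.lt_two_pow_self.le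
    have h2 : (2 : ℝ) ^ (J * (n + 2)) = 2 ^ J * (2 ^ J * (2 ^ J) ^ n) := by
      rw [← pow_mul, ← pow_add, ← pow_add]; congr 1; ring
    rw [h2, ← mul_assoc (2 ^ J : ℝ) ((2 ^ J) ^ n), mul_assoc (2 ^ J : ℝ) (2 ^ J * (2 ^ J) ^ n)]
    exact mul_le_mul_of_nonneg_right h1 (by positivity)

lemma integrableOn_EMult {ψ : EuclideanSpace ℝ (Fin d) → ℝ} (hψ : IsDyadicPartition ψ)
    {χ : EuclideanSpace ℝ (Fin n) → ℂ} (hχ : IsCutoff χ)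
    {K : EuclideanSpace ℝ (Fin d) → ℂ} {j : ℕ} (hK : Continuous (Kpiece ψ K j)) (δ₁ : ℝ) :
    IntegrableOn (EMult P δ₁ ψ χ K j) (cubeAt 0) := by
  refine Integrable.sub ?_ (integrableOn_LMult hψ hχ hK δ₁)
  have hfun : mMult P ψ K j = fun ξ => ∑ y ∈ box d (2 ^ (j + 1)), Kpiece ψ K j (latticePt y) *
      expPhase (dotLattice ξ fun i => MvPolynomial.eval y (P i)) :=
    funext fun ξ => mMult_eq_sum hψ K j ξ
  rw [hfun]
  exact integrable_finsetSum _ fun y _ => (integrableOn_expPhase _).const_mul _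

/-- A dilation factor `L₀` such that `P` maps the support of the `j`-th piece of the kernel into the
box with half-widths `(L₀ 2 ^ j) ^ D_i / 2`. -/
lemma IsAdmissible.exists_scale (hP : IsAdmissible P) : ∃ L₀ : ℕ, 1 ≤ L₀ ∧ ∀ j : ℕ,
    ∀ t : EuclideanSpace ℝ (Fin d), ‖t‖ ≤ 2 ^ (j + 1) → ∀ i,
      2 * |polyMap P t i| ≤ ((L₀ * 2 ^ j : ℕ) : ℝ) ^ degs P i := by
  obtain ⟨C, hC⟩ := hP.exists_abs_polyMap_le
  refine ⟨4 * (C + 1), by omega, fun j t ht i => ?_⟩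
  have h1 := hC (2 ^ (j + 1)) (one_le_pow₀ (by norm_num)) t
    (fun l => (abs_coord_le_norm t l).trans ht) i
  have hD := hP.one_le_degs i
  have h2 : (2 : ℝ) * (C + 1) ≤ (2 * (C + 1)) ^ degs P i := by
    have : (0 : ℝ) ≤ C := Nat.cast_nonneg C
    exact le_self_pow₀ (by linarith) (by omega)
  have h3 : ((4 * (C + 1) * 2 ^ j : ℕ) : ℝ) ^ degs P i
      = (2 * (C + 1)) ^ degs P i * (2 ^ (j + 1)) ^ degs P i := by
    rw [← mul_pow]; congr 1; push_cast; rw [pow_succ]; ring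
  rw [h3]
  calc 2 * |polyMap P t i| ≤ 2 * (C * (2 ^ (j + 1)) ^ degs P i) := by gcongr
    _ ≤ (2 * (C + 1)) * (2 ^ (j + 1)) ^ degs P i := by
        have : (0 : ℝ) ≤ (2 ^ (j + 1)) ^ degs P i := by positivity
        nlinarith
    _ ≤ _ := by gcongr

/-- Beyond the scale of the support of the kernel, the kernel of the error multiplier decays faster
than any power, and exponentially in `j`. -/
theorem exists_multKernel_EMult_decay (hP : IsAdmissible P) {δ₁ : ℝ} (hδ₁0 : 0 < δ₁)
    (hδ₁ : δ₁ < 1 / 1000) : ∃ L₀ : ℕ, 1 ≤ L₀ ∧ ∀ M : ℕ,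
    ∀ ψ : EuclideanSpace ℝ (Fin d) → ℝ, IsDyadicPartition ψ →
    ∀ χ : EuclideanSpace ℝ (Fin n) → ℂ, IsCutoff χ → ∃ C : ℝ, 0 < C ∧
    ∀ K : EuclideanSpace ℝ (Fin d) → ℂ, IsCZKernel K → ∀ j : ℕ, 1 ≤ j →
    ∀ z : Fin n → ℤ, (∃ i, ((L₀ * 2 ^ j : ℕ) : ℝ) ^ degs P i ≤ |(z i : ℝ)|) →
      ‖multKernel (EMult P δ₁ ψ χ K j) z‖ ≤ C / (2 ^ j * (1 + ∑ i, |(z i : ℝ)|) ^ M) := by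
  obtain ⟨L₀, hL₀1, hL₀⟩ := hP.exists_scale
  refine ⟨L₀, hL₀1, fun M ψ hψ χ hχ => ?_⟩
  obtain ⟨B, hB1, hB⟩ := exists_Kpiece_bounds hψ
  obtain ⟨D, hD⟩ : ∃ D : ℕ, ∀ i, degs P i ≤ D :=
    ⟨Finset.univ.sup (degs P), fun i => Finset.le_sup (Finset.mem_univ i)⟩
  -- the powers of `U` spent on the number of fractions, on `2 ^ j` and on `|z| ^ M`
  obtain ⟨R, hR⟩ : ∃ R : ℕ, R = (n + 2) + (1 + D * M) := ⟨_, rfl⟩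
  obtain ⟨C, hC0, hC⟩ := hχ.exists_fourier_decay (2 * R)
  refine ⟨4 ^ d * B * (C * 2 ^ (2 * R)) * (n + 1) ^ M, by positivity,
    fun K hK j hj z hz => ?_⟩
  obtain ⟨hKb, -, hKc⟩ := hB K hK j hj
  obtain ⟨L, hL⟩ : ∃ L : ℝ, L = ((L₀ * 2 ^ j : ℕ) : ℝ) := ⟨_, rfl⟩
  have hLj : (2 : ℝ) ^ j ≤ L := by
    rw [hL]
    have : 2 ^ j ≤ L₀ * 2 ^ j := Nat.le_mul_of_pos_left _ hL₀1
    exact_mod_cast this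
  have h2j : (1 : ℝ) ≤ 2 ^ j := one_le_pow₀ (by norm_num)
  have hL1 : 1 ≤ L := h2j.trans hLj
  rw [← hL] at hz
  -- the largest coordinate of `z` among those beyond the scale of the support
  obtain ⟨i₀, hi₀, hmax⟩ := Finset.exists_max_image
    (Finset.univ.filter fun i => L ^ degs P i ≤ |(z i : ℝ)|) (fun i => |(z i : ℝ)|)
    (by obtain ⟨i, hi⟩ := hz; exact ⟨i, by simpa using hi⟩)
  rw [Finset.mem_filter] at hi₀
  obtain ⟨U, hU⟩ : ∃ U : ℝ, U = |(z i₀ : ℝ)| := ⟨_, rfl⟩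
  have hLU : L ≤ U := by
    rw [hU]
    exact (le_self_pow₀ hL1 (by have := hP.one_le_degs i₀; omega)).trans hi₀.2
  have hU1 : 1 ≤ U := hL1.trans hLU
  have hU0 : 0 < U := by linarith
  have hfar : ∀ t, Kpiece ψ K j t ≠ 0 → U ≤ 2 * ‖polyMap P t + latticePt z‖ := by
    intro t ht
    have h1 := hL₀ j t (Kpiece_support hψ K j ht).2 i₀
    rw [← hL] at h1
    have h2 := abs_coord_le_norm (polyMap P t + latticePt z) i₀
    rw [PiLp.add_apply, latticePt_apply] at h2
    have h3 : |(z i₀ : ℝ)| ≤ |polyMap P t i₀ + z i₀| + |polyMap P t i₀| := by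
      have := abs_sub (polyMap P t i₀ + z i₀) (polyMap P t i₀)
      rwa [add_sub_cancel_left] at this
    rw [hU]
    linarith [hi₀.2]
  have hzU : 1 + ∑ i, |(z i : ℝ)| ≤ (n + 1) * U ^ D := by
    have hUD : 1 ≤ U ^ D := one_le_pow₀ hU1
    have h1 : ∀ i, |(z i : ℝ)| ≤ U ^ D := by
      intro i
      have hDi := hP.one_le_degs i
      by_cases hi : L ^ degs P i ≤ |(z i : ℝ)|
      · rw [hU]
        refine (hmax i (by simpa using hi)).trans ?_
        rw [← hU]
        exact le_self_pow₀ hU1 (by have := hD i; omega)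
      · calc |(z i : ℝ)| ≤ L ^ degs P i := (not_le.1 hi).le
          _ ≤ L ^ D := pow_le_pow_right₀ hL1 (hD i)
          _ ≤ U ^ D := by gcongr
    have h2 : ∑ i, |(z i : ℝ)| ≤ n * U ^ D := by
      refine (Finset.sum_le_sum fun i _ => h1 i).trans (le_of_eq ?_)
      simp
    linarith
  have hm : ‖multKernel (EMult P δ₁ ψ χ K j) z‖ = ‖multKernel (LMult P δ₁ ψ χ K j) z‖ := by
    have hmm := multKernel_mMult (P := P) hψ K j (z := z) (by
      intro y hy
      refine ⟨i₀, fun h => ?_⟩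
      have h1 := hL₀ j _ (Kpiece_support hψ K j hy).2 i₀
      rw [polyMap_latticePt, eq_neg_of_add_eq_zero_left h, ← hL] at h1
      push_cast at h1
      rw [abs_neg] at h1
      linarith [hi₀.2])
    have : multKernel (EMult P δ₁ ψ χ K j) z
        = multKernel (mMult P ψ K j) z - multKernel (LMult P δ₁ ψ χ K j) z := by
      simp only [multKernel, EMult, sub_mul]
      exact integral_sub (integrableOn_mul_expPhase hmm.1 z)
        (integrableOn_mul_expPhase (integrableOn_LMult hψ hχ hKc δ₁) z)
    rw [this, hmm.2, zero_sub, norm_neg]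
  rw [hm]
  refine (norm_multKernel_LMult_le hψ hχ hKc δ₁ hKb hC0.le hC hU0 hfar).trans ?_
  obtain ⟨J, hJ⟩ : ∃ J : ℕ, J = ⌊(j : ℝ) * δ₁⌋₊ := ⟨_, rfl⟩
  rw [← hJ]
  have hJj : 1000 * J ≤ j := by
    have h1 : (J : ℝ) ≤ j * δ₁ := by rw [hJ]; exact Nat.floor_le (by positivity)
    have h2 : (j : ℝ) * δ₁ ≤ j * (1 / 1000) := by gcongr
    have : (1000 : ℝ) * J ≤ j := by linarith
    exact_mod_cast this
  have hUJ : ∀ m ≤ 1000, (2 : ℝ) ^ (m * J) ≤ U := fun m hm =>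
    (pow_le_pow_right₀ (by norm_num) (by nlinarith)).trans (hLj.trans hLU)
  have e1 : (2 : ℝ) ^ (J * (n + 2)) ≤ U ^ (n + 2) := by
    rw [pow_mul]
    exact pow_le_pow_left₀ (by positivity) (by simpa using hUJ 1 (by norm_num)) _
  have e2 : ((2 : ℝ) ^ (10 * J)) ^ (2 * R) ≤ U ^ R := by
    have : ((2 : ℝ) ^ (10 * J)) ^ (2 * R) = (2 ^ (20 * J)) ^ R := by
      rw [← pow_mul, ← pow_mul]; congr 1; ring
    rw [this]
    exact pow_le_pow_left₀ (by positivity) (hUJ 20 (by norm_num)) _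
  have e3 : (2 : ℝ) ^ j * (1 + ∑ i, |(z i : ℝ)|) ^ M ≤ (n + 1) ^ M * (U * U ^ (D * M)) := by
    have hs : 0 ≤ ∑ i, |(z i : ℝ)| := Finset.sum_nonneg fun _ _ => abs_nonneg _
    calc (2 : ℝ) ^ j * (1 + ∑ i, |(z i : ℝ)|) ^ M ≤ U * ((n + 1) * U ^ D) ^ M := by
          gcongr; exact hLj.trans hLU
      _ = _ := by rw [mul_pow, ← pow_mul]; ring
  have hs : 0 < 1 + ∑ i, |(z i : ℝ)| := by
    have : 0 ≤ ∑ i, |(z i : ℝ)| := Finset.sum_nonneg fun _ _ => abs_nonneg _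
    linarith
  rw [le_div_iff₀ (by positivity)]
  calc 2 ^ (J * (n + 2)) * (4 ^ d * B * (C * (2 ^ (10 * J)) ^ (2 * R) * 2 ^ (2 * R) / U ^ (2 * R)))
        * (2 ^ j * (1 + ∑ i, |(z i : ℝ)|) ^ M)
      ≤ U ^ (n + 2) * (4 ^ d * B * (C * U ^ R * 2 ^ (2 * R) / U ^ (2 * R)))
        * ((n + 1) ^ M * (U * U ^ (D * M))) := by gcongr
    _ = 4 ^ d * B * (C * 2 ^ (2 * R)) * (n + 1) ^ M *
        (U ^ (n + 2) * U ^ R * (U * U ^ (D * M)) / U ^ (2 * R)) := by ring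
    _ = 4 ^ d * B * (C * 2 ^ (2 * R)) * (n + 1) ^ M := by
        have : U ^ (n + 2) * U ^ R * (U * U ^ (D * M)) = U ^ (2 * R) := by
          rw [← pow_succ', ← pow_add, ← pow_add]
          congr 1
          rw [hR]; ring
        rw [this, div_self (by positivity), mul_one]

end Decay

/-! ### Sparse bounds at a single scale -/

section Sparse

variable {n : ℕ} {D : Fin n → ℕ}

/-- The `ℓ²` norm of `f` on `Q`. -/
noncomputable def l2On (Q : Finset (Fin n → ℤ)) (f : (Fin n → ℤ) →₀ ℂ) : ℝ :=
  √(∑ x ∈ Q, ‖f x‖ ^ 2)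

lemma l2On_nonneg (Q : Finset (Fin n → ℤ)) (f : (Fin n → ℤ) →₀ ℂ) : 0 ≤ l2On Q f :=
  Real.sqrt_nonneg _

lemma avg_nonneg (r : ℝ) (Q : Finset (Fin n → ℤ)) (f : (Fin n → ℤ) →₀ ℂ) : 0 ≤ avg r Q f := by
  unfold avg; positivity

lemma sum_rpow_le_rpow_sum {ι : Type*} (s : Finset ι) {b : ι → ℝ} (hb : ∀ i, 0 ≤ b i) {p : ℝ}
    (hp : 1 ≤ p) : ∑ i ∈ s, b i ^ p ≤ (∑ i ∈ s, b i) ^ p := by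
  have hs : 0 ≤ ∑ i ∈ s, b i := Finset.sum_nonneg fun i _ => hb i
  have hsplit : ∀ x : ℝ, 0 ≤ x → x ^ p = x * x ^ (p - 1) := by
    intro x hx
    rw [mul_comm, ← Real.rpow_add_one' hx (by linarith), sub_add_cancel]
  rw [hsplit _ hs, Finset.sum_mul]
  refine Finset.sum_le_sum fun i hi => ?_
  rw [hsplit _ (hb i)]
  refine mul_le_mul_of_nonneg_left ?_ (hb i)
  exact Real.rpow_le_rpow (hb i) (Finset.single_le_sum (fun i _ => hb i) hi) (by linarith)

/-- The loss in passing from an `L²` average to an `L^r` average is a small power of the size of the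
cube when `r` is close to two. -/
lemma l2On_le_avg {r η : ℝ} (hr : 1 ≤ r) (hrη : |1 / r - 1 / 2| < η) {Q : Finset (Fin n → ℤ)}
    (hQ : Q.Nonempty) (f : (Fin n → ℤ) →₀ ℂ) :
    l2On Q f ≤ (Q.card : ℝ) ^ (1 / 2 + η) * avg r Q f := by
  have hr0 : 0 < r := by linarith
  have hQ1 : (1 : ℝ) ≤ Q.card := by exact_mod_cast hQ.card_pos
  have hQ0 : (0 : ℝ) < Q.card := by linarith
  rw [abs_lt] at hrη
  rw [l2On, Real.sqrt_eq_rpow]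
  rcases le_total r 2 with h2 | h2
  · have h1 : ∑ x ∈ Q, ‖f x‖ ^ 2 ≤ (∑ x ∈ Q, ‖f x‖ ^ r) ^ (2 / r) := by
      refine le_trans (le_of_eq ?_) (sum_rpow_le_rpow_sum Q (b := fun x => ‖f x‖ ^ r)
        (fun x => by positivity) (by rw [le_div_iff₀ hr0]; linarith))
      refine Finset.sum_congr rfl fun x _ => ?_
      rw [← Real.rpow_mul (norm_nonneg _), mul_div_cancel₀ _ hr0.ne', Real.rpow_two]
    calc (∑ x ∈ Q, ‖f x‖ ^ 2) ^ (1 / 2 : ℝ)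
        ≤ ((∑ x ∈ Q, ‖f x‖ ^ r) ^ (2 / r)) ^ (1 / 2 : ℝ) := by gcongr
      _ = (∑ x ∈ Q, ‖f x‖ ^ r) ^ (1 / r) := by
          rw [← Real.rpow_mul (by positivity)]; congr 1; field_simp
      _ = (Q.card : ℝ) ^ (1 / r) * avg r Q f := by
          rw [avg, ← Real.mul_rpow (by positivity) (by positivity), ← mul_assoc,
            mul_inv_cancel₀ hQ0.ne', one_mul]
      _ ≤ (Q.card : ℝ) ^ (1 / 2 + η) * avg r Q f := by
          refine mul_le_mul_of_nonneg_right ?_ (avg_nonneg r Q f)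
          exact Real.rpow_le_rpow_of_exponent_le hQ1 (by linarith)
  · have h1 := Real.rpow_arith_mean_le_arith_mean_rpow Q (fun _ => (Q.card : ℝ)⁻¹)
      (fun x => ‖f x‖ ^ 2) (fun _ _ => by positivity)
      (by rw [Finset.sum_const, nsmul_eq_mul, mul_inv_cancel₀ hQ0.ne'])
      (fun _ _ => by positivity) (p := r / 2) (by linarith)
    rw [← Finset.mul_sum, ← Finset.mul_sum] at h1
    have h3 : ∀ x, (‖f x‖ ^ 2) ^ (r / 2) = ‖f x‖ ^ r := by
      intro x
      rw [← Real.rpow_two, ← Real.rpow_mul (norm_nonneg _)]; congr 1; ring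
    simp only [h3] at h1
    have h4 : ((Q.card : ℝ)⁻¹ * ∑ x ∈ Q, ‖f x‖ ^ 2) ^ (1 / 2 : ℝ) ≤ avg r Q f := by
      have h5 := Real.rpow_le_rpow (by positivity) h1 (by positivity : 0 ≤ 1 / r)
      rw [← Real.rpow_mul (by positivity)] at h5
      have e : r / 2 * (1 / r) = 1 / 2 := by field_simp
      rw [e] at h5
      exact h5
    calc (∑ x ∈ Q, ‖f x‖ ^ 2) ^ (1 / 2 : ℝ)
        = (Q.card : ℝ) ^ (1 / 2 : ℝ) * ((Q.card : ℝ)⁻¹ * ∑ x ∈ Q, ‖f x‖ ^ 2) ^ (1 / 2 : ℝ) := by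
          rw [← Real.mul_rpow (by positivity) (by positivity), ← mul_assoc,
            mul_inv_cancel₀ hQ0.ne', one_mul]
      _ ≤ (Q.card : ℝ) ^ (1 / 2 + η) * avg r Q f := by
          refine mul_le_mul ?_ h4 (by positivity) (by positivity)
          exact Real.rpow_le_rpow_of_exponent_le hQ1 (by linarith)

/-- The grid cell of side lengths `L ^ D_i` that contains a lattice point. -/
def cell (D : Fin n → ℕ) (L : ℕ) (y : Fin n → ℤ) : Fin n → ℤ := fun i => y i / (L : ℤ) ^ D i

/-- A `P`-cube with parameter `3 L` that contains the neighbourhood of a grid cell. -/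
noncomputable def bigCube (D : Fin n → ℕ) (L : ℕ) (m : Fin n → ℤ) : Finset (Fin n → ℤ) :=
  Fintype.piFinset fun i => Finset.Ico ((m i - 1) * (L : ℤ) ^ D i)
    ((m i - 1) * (L : ℤ) ^ D i + (3 * L : ℤ) ^ D i)

lemma mem_bigCube {L : ℕ} {m x : Fin n → ℤ} : x ∈ bigCube D L m ↔
    ∀ i, (m i - 1) * (L : ℤ) ^ D i ≤ x i ∧
      x i < (m i - 1) * (L : ℤ) ^ D i + (3 * L : ℤ) ^ D i := by
  simp [bigCube]

lemma card_bigCube (D : Fin n → ℕ) (L : ℕ) (m : Fin n → ℤ) :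
    (bigCube D L m).card = (3 * L) ^ ∑ i, D i := by
  rw [bigCube, Fintype.card_piFinset, ← Finset.prod_pow_eq_pow_sum]
  refine Finset.prod_congr rfl fun i _ => ?_
  rw [Int.card_Ico, add_sub_cancel_left]
  exact_mod_cast Int.toNat_natCast _

lemma bigCube_nonempty {L : ℕ} (hL : 1 ≤ L) (m : Fin n → ℤ) : (bigCube D L m).Nonempty := by
  rw [← Finset.card_pos, card_bigCube]; positivity

lemma isPCube_bigCube {L : ℕ} (hL : 1 ≤ L) (m : Fin n → ℤ) : IsPCube D (bigCube D L m) := by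
  refine ⟨3 * L, fun i => Set.Ico (((m i - 1) * (L : ℤ) ^ D i : ℤ) : ℝ)
    (((m i - 1) * (L : ℤ) ^ D i + (3 * L : ℤ) ^ D i : ℤ) : ℝ), by positivity,
    fun i => ⟨Set.ordConnected_Ico, ?_⟩, fun x => ?_⟩
  · rw [Real.volume_Ico]
    congr 1; push_cast; ring
  · rw [mem_bigCube]
    simp only [Set.mem_Ico, Int.cast_le, Int.cast_lt]

/-- The neighbourhood of a grid cell. -/
lemma mem_bigCube_cell {L : ℕ} (hL : 1 ≤ L) (hD : ∀ i, 1 ≤ D i) {x y : Fin n → ℤ}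
    (h : ∀ i, |x i - y i| < (L : ℤ) ^ D i) : x ∈ bigCube D L (cell D L y) := by
  rw [mem_bigCube]
  intro i
  have hpos : (0 : ℤ) < (L : ℤ) ^ D i := by positivity
  have h1 := abs_lt.1 (h i)
  have h2 : cell D L y i * (L : ℤ) ^ D i ≤ y i := Int.ediv_mul_le _ hpos.ne'
  have h3 : y i < (cell D L y i + 1) * (L : ℤ) ^ D i := Int.lt_ediv_add_one_mul_self _ hpos
  have h4 : (3 : ℤ) * (L : ℤ) ^ D i ≤ (3 * L : ℤ) ^ D i := by
    rw [mul_pow]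
    have : (3 : ℤ) ≤ 3 ^ D i := le_self_pow₀ (by norm_num) (by have := hD i; omega)
    exact mul_le_mul_of_nonneg_right this hpos.le
  constructor <;> nlinarith

/-- Big cubes whose indices agree modulo `3 ^ D_i` are disjoint. -/
lemma disjoint_bigCube {L : ℕ} {m m' : Fin n → ℤ} (hne : m ≠ m')
    (h : ∀ i, m i % 3 ^ D i = m' i % 3 ^ D i) : Disjoint (bigCube D L m) (bigCube D L m') := by
  rw [Finset.disjoint_left]
  intro x hx hx'
  rw [mem_bigCube] at hx hx'
  apply hne
  funext i
  have hdvd : (3 : ℤ) ^ D i ∣ m i - m' i := Int.dvd_iff_emod_eq_zero.2 (by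
    rw [Int.sub_emod, h i]; simp)
  obtain ⟨c, hc⟩ := hdvd
  obtain ⟨h1, h2⟩ := hx i
  obtain ⟨h3, h4⟩ := hx' i
  rw [mul_pow] at h2 h4
  have hLn : (0 : ℤ) ≤ (L : ℤ) ^ D i := by positivity
  have h3p : (0 : ℤ) < 3 ^ D i := by positivity
  have hm : m i = m' i + 3 ^ D i * c := by linarith
  have hc0 : c = 0 := by
    have e1 : (3 : ℤ) ^ D i * c * (L : ℤ) ^ D i < 3 ^ D i * (L : ℤ) ^ D i := by
      rw [hm] at h1; linarith
    have e2 : -((3 : ℤ) ^ D i * (L : ℤ) ^ D i) < 3 ^ D i * c * (L : ℤ) ^ D i := by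
      rw [hm] at h2; linarith
    have hp : 0 < (3 : ℤ) ^ D i * (L : ℤ) ^ D i := by linarith
    have e3 : (3 : ℤ) ^ D i * c * (L : ℤ) ^ D i = c * (3 ^ D i * (L : ℤ) ^ D i) := by ring
    rw [e3] at e1 e2
    have e4 : c < 1 := by
      by_contra hcon
      have := mul_le_mul_of_nonneg_right (not_lt.1 hcon) hp.le
      linarith
    have e5 : -1 < c := by
      by_contra hcon
      have := mul_le_mul_of_nonneg_right (not_lt.1 hcon) hp.le
      linarith
    omega
  rw [hm, hc0]; ring

/-- The supremum of all `σ`-sparse forms. -/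
noncomputable def sparseSup (D : Fin n → ℕ) (σ r s : ℝ) (f g : (Fin n → ℤ) →₀ ℂ) : ℝ≥0∞ :=
  ⨆ (S : Set (Finset (Fin n → ℤ))) (_ : IsSparse D σ S), sparseForm r s S f g

/-- Disjoint big cubes form a sparse collection for every sparsity parameter. -/
lemma sum_le_sparseSup_of_disjoint {L : ℕ} (hL : 1 ≤ L) {σ : ℝ} (hσ : σ ≤ 1) (r s : ℝ)
    (f g : (Fin n → ℤ) →₀ ℂ) (t : Finset (Fin n → ℤ))
    (ht : (t : Set (Fin n → ℤ)).PairwiseDisjoint (bigCube D L)) :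
    ∑ m ∈ t, ENNReal.ofReal (((bigCube D L m).card : ℝ) * avg r (bigCube D L m) f
      * avg s (bigCube D L m) g) ≤ sparseSup D σ r s f g := by
  classical
  have hinj : Set.InjOn (bigCube D L) (t : Set (Fin n → ℤ)) := by
    intro m hm m' hm' h
    by_contra hne
    have := ht hm hm' hne
    rw [Function.onFun, h, disjoint_self] at this
    exact (bigCube_nonempty hL m').ne_empty this
  have hS : IsSparse D σ ((t.image (bigCube D L) : Finset _) : Set (Finset (Fin n → ℤ))) := by
    constructor
    · intro Q hQ
      obtain ⟨m, -, rfl⟩ := Finset.mem_image.1 (Finset.mem_coe.1 hQ)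
      exact isPCube_bigCube hL m
    · refine ⟨id, fun Q _ => ⟨subset_rfl, mul_le_of_le_one_left (Nat.cast_nonneg _) hσ⟩, ?_⟩
      rw [Finset.coe_image]
      rintro _ ⟨m, hm, rfl⟩ _ ⟨m', hm', rfl⟩ hne
      exact ht hm hm' fun h => hne (by rw [h])
  refine le_trans (le_of_eq ?_) (le_iSup₂_of_le _ hS le_rfl)
  rw [sparseForm, Finset.tsum_subtype' (t.image (bigCube D L))
    fun Q => ENNReal.ofReal ((Q.card : ℝ) * avg r Q f * avg s Q g), Finset.sum_image hinj]

/-- Sums of local `ℓ²` norms over the cubes of one scale. The cubes overlap, but they split into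
boundedly many families of disjoint cubes. -/
lemma sum_l2On_le_sparseSup {L : ℕ} (hL : 1 ≤ L) {σ : ℝ} (hσ : σ ≤ 1) {r s η : ℝ} (hr : 1 ≤ r)
    (hs : 1 ≤ s) (hrη : |1 / r - 1 / 2| < η) (hsη : |1 / s - 1 / 2| < η)
    (f g : (Fin n → ℤ) →₀ ℂ) (t : Finset (Fin n → ℤ)) :
    ENNReal.ofReal (∑ m ∈ t, l2On (bigCube D L m) f * l2On (bigCube D L m) g)
      ≤ ENNReal.ofReal (3 ^ (∑ i, D i) * (3 * L : ℝ) ^ ((∑ i, D i : ℕ) * (2 * η)))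
        * sparseSup D σ r s f g := by
  classical
  have hL0 : (0 : ℝ) < 3 * L := by positivity
  set A : ℝ := (3 * L : ℝ) ^ ((∑ i, D i : ℕ) * (2 * η)) with hA
  have hA0 : 0 ≤ A := by positivity
  have hone : ∀ m, ENNReal.ofReal (l2On (bigCube D L m) f * l2On (bigCube D L m) g)
      ≤ ENNReal.ofReal A * ENNReal.ofReal (((bigCube D L m).card : ℝ) * avg r (bigCube D L m) f
      * avg s (bigCube D L m) g) := by
    intro m
    rw [← ENNReal.ofReal_mul hA0]
    apply ENNReal.ofReal_le_ofReal
    have h1 := l2On_le_avg hr hrη (bigCube_nonempty (D := D) hL m) f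
    have h2 := l2On_le_avg hs hsη (bigCube_nonempty (D := D) hL m) g
    have hcard : ((bigCube D L m).card : ℝ) = (3 * L : ℝ) ^ (∑ i, D i : ℕ) := by
      rw [card_bigCube]; push_cast; rfl
    have hc0 : (0 : ℝ) < (bigCube D L m).card := by rw [hcard]; positivity
    calc _ ≤ _ := mul_le_mul h1 h2 (l2On_nonneg _ _)
          (mul_nonneg (by positivity) (avg_nonneg _ _ _))
      _ = ((bigCube D L m).card : ℝ) ^ (2 * η) * (((bigCube D L m).card : ℝ)
          * avg r (bigCube D L m) f * avg s (bigCube D L m) g) := by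
          have e : ((bigCube D L m).card : ℝ) ^ (1 / 2 + η) * ((bigCube D L m).card : ℝ) ^ (1 / 2 + η)
              = ((bigCube D L m).card : ℝ) ^ (2 * η) * (bigCube D L m).card := by
            rw [← Real.rpow_add hc0, ← Real.rpow_add_one hc0.ne']; congr 1; ring
          calc _ = (((bigCube D L m).card : ℝ) ^ (1 / 2 + η)
                * ((bigCube D L m).card : ℝ) ^ (1 / 2 + η))
                * (avg r (bigCube D L m) f * avg s (bigCube D L m) g) := by ring
            _ = _ := by rw [e]; ring
      _ = A * _ := by
          congr 1
          rw [hA, hcard, Real.rpow_mul hL0.le, Real.rpow_natCast]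
  rw [ENNReal.ofReal_sum_of_nonneg fun m _ => mul_nonneg (l2On_nonneg _ _) (l2On_nonneg _ _)]
  refine (Finset.sum_le_sum fun m _ => hone m).trans ?_
  rw [← Finset.mul_sum]
  set T : Finset (Fin n → ℤ) := Fintype.piFinset fun i => Finset.Ico 0 (3 ^ D i) with hT
  have hTcard : T.card = 3 ^ ∑ i, D i := by
    rw [hT, Fintype.card_piFinset, ← Finset.prod_pow_eq_pow_sum]
    refine Finset.prod_congr rfl fun i _ => ?_
    rw [Int.card_Ico, sub_zero]
    exact_mod_cast Int.toNat_natCast _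
  have hmaps : ∀ m ∈ t, (fun i => m i % 3 ^ D i) ∈ T := by
    intro m _
    rw [hT, Fintype.mem_piFinset]
    intro i
    rw [Finset.mem_Ico]
    exact ⟨Int.emod_nonneg _ (by positivity), Int.emod_lt_of_pos _ (by positivity)⟩
  rw [← Finset.sum_fiberwise_of_maps_to hmaps]
  have hfib : ∀ c ∈ T, ∑ m ∈ t with (fun i => m i % 3 ^ D i) = c,
      ENNReal.ofReal (((bigCube D L m).card : ℝ) * avg r (bigCube D L m) f
      * avg s (bigCube D L m) g) ≤ sparseSup D σ r s f g := by
    intro c _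
    refine sum_le_sparseSup_of_disjoint hL hσ r s f g _ ?_
    intro m hm m' hm' hne
    rw [Finset.mem_coe, Finset.mem_filter] at hm hm'
    exact disjoint_bigCube hne fun i => (congrFun hm.2 i).trans (congrFun hm'.2 i).symm
  refine (mul_le_mul_right (Finset.sum_le_card_nsmul _ _ _ hfib) _).trans (le_of_eq ?_)
  rw [hTcard, nsmul_eq_mul, ← mul_assoc, mul_comm (3 ^ (∑ i, D i) : ℝ), ENNReal.ofReal_mul hA0]
  congr 2
  rw [ENNReal.ofReal_pow (by norm_num)]
  norm_num

end Sparse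

/-! ### Sparse bounds for Fourier multipliers with decaying kernels -/

section NearFar

variable {n : ℕ} {D : Fin n → ℕ}

lemma exists_sum_inv_sq_le : ∃ Z : ℝ, 0 ≤ Z ∧
    ∀ F : Finset ℤ, ∑ k ∈ F, 1 / (1 + |(k : ℝ)|) ^ 2 ≤ Z := by
  have hs : Summable fun k : ℤ => 1 / (1 + |(k : ℝ)|) ^ 2 := by
    have h1 : Summable fun k : ℕ => 1 / (1 + |((k : ℤ) : ℝ)|) ^ 2 := by
      have := (summable_nat_add_iff 1).2 (Real.summable_one_div_nat_pow.2 (by norm_num : 1 < 2))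
      refine this.congr fun k => ?_
      rw [Int.cast_natCast, Nat.abs_cast]; push_cast; ring
    exact Summable.of_nat_of_neg h1 (by simpa using h1)
  exact ⟨_, tsum_nonneg fun k => by positivity, fun F => hs.sum_le_tsum F fun k _ => by positivity⟩

lemma sum_one_div_pow_le {Z : ℝ} (hZ : ∀ F : Finset ℤ, ∑ k ∈ F, 1 / (1 + |(k : ℝ)|) ^ 2 ≤ Z)
    (F : Finset (Fin n → ℤ)) : ∑ z ∈ F, 1 / (1 + ∑ i, |(z i : ℝ)|) ^ (2 * n) ≤ Z ^ n := by
  classical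
  have h1 : ∀ z : Fin n → ℤ, 1 / (1 + ∑ i, |(z i : ℝ)|) ^ (2 * n)
      ≤ ∏ i, 1 / (1 + |(z i : ℝ)|) ^ 2 := by
    intro z
    rw [Finset.prod_div_distrib, Finset.prod_const_one, Finset.prod_pow, mul_comm, pow_mul]
    refine one_div_le_one_div_of_le ?_ ?_
    · exact pow_pos (Finset.prod_pos fun i _ => by positivity) 2
    · refine pow_le_pow_left₀ (Finset.prod_nonneg fun i _ => by positivity) ?_ 2
      refine (Finset.prod_le_prod (fun i _ => by positivity)
        (g := fun _ => 1 + ∑ l, |(z l : ℝ)|) fun i _ => ?_).trans (le_of_eq ?_)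
      · have := Finset.single_le_sum (f := fun l => |(z l : ℝ)|) (fun l _ => abs_nonneg _)
          (Finset.mem_univ i)
        linarith
      · simp
  calc _ ≤ ∑ z ∈ F, ∏ i, 1 / (1 + |(z i : ℝ)|) ^ 2 := Finset.sum_le_sum fun z _ => h1 z
    _ ≤ ∑ z ∈ Fintype.piFinset fun i => (F.image fun z => z i : Finset ℤ), ∏ i, 1 / (1 + |(z i : ℝ)|) ^ 2 := by
        refine Finset.sum_le_sum_of_subset_of_nonneg (fun z hz => ?_) fun z _ _ =>
          Finset.prod_nonneg fun i _ => by positivity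
        rw [Fintype.mem_piFinset]
        exact fun i => Finset.mem_image_of_mem _ hz
    _ = ∏ i, ∑ k ∈ (F.image fun z => z i : Finset ℤ), 1 / (1 + |(k : ℝ)|) ^ 2 :=
        (Finset.prod_univ_sum (fun i : Fin n => (F.image fun z => z i : Finset ℤ))
          fun _ (k : ℤ) => 1 / (1 + |(k : ℝ)|) ^ 2).symm
    _ ≤ ∏ _i : Fin n, Z := Finset.prod_le_prod
        (fun i _ => Finset.sum_nonneg fun k _ => by positivity) fun i _ => hZ _
    _ = Z ^ n := by simp

/-- Correlations at distance below `L` are controlled by the cubes of scale `L`. -/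
lemma sum_mul_shift_le {L : ℕ} (hL : 1 ≤ L) (hD : ∀ i, 1 ≤ D i) {z : Fin n → ℤ}
    (hz : ∀ i, |z i| < (L : ℤ) ^ D i) (f g : (Fin n → ℤ) →₀ ℂ) :
    ∑ y ∈ f.support, ‖f y‖ * ‖g (y + z)‖
      ≤ ∑ m ∈ f.support.image (cell D L), l2On (bigCube D L m) f * l2On (bigCube D L m) g := by
  classical
  rw [← Finset.sum_fiberwise_of_maps_to fun y hy => Finset.mem_image_of_mem (cell D L) hy]
  refine Finset.sum_le_sum fun m _ => ?_
  refine (Real.sum_mul_le_sqrt_mul_sqrt _ _ _).trans ?_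
  refine mul_le_mul (Real.sqrt_le_sqrt ?_) (Real.sqrt_le_sqrt ?_) (Real.sqrt_nonneg _)
    (l2On_nonneg _ _)
  · refine Finset.sum_le_sum_of_subset_of_nonneg ?_ fun _ _ _ => by positivity
    intro y hy
    rw [← (Finset.mem_filter.1 hy).2]
    exact mem_bigCube_cell hL hD fun i => by rw [sub_self, abs_zero]; positivity
  · have hinj : Set.InjOn (fun y => y + z)
        ((f.support.filter fun y => cell D L y = m : Finset (Fin n → ℤ)) : Set (Fin n → ℤ)) :=
      fun _ _ _ _ h => add_right_cancel h
    rw [← Finset.sum_image (f := fun x => ‖g x‖ ^ 2) hinj]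
    refine Finset.sum_le_sum_of_subset_of_nonneg ?_ fun _ _ _ => by positivity
    intro x hx
    obtain ⟨y, hy, rfl⟩ := Finset.mem_image.1 hx
    rw [← (Finset.mem_filter.1 hy).2]
    exact mem_bigCube_cell hL hD fun i => by simpa using hz i

/-- The part of the form close to the diagonal is a sum of localized copies of the form. -/
lemma near_eq_sum_pairing {k : EuclideanSpace ℝ (Fin n) → ℂ} (hk : IntegrableOn k (cubeAt 0))
    (D : Fin n → ℕ) (L : ℕ) (f g : (Fin n → ℤ) →₀ ℂ) :
    ∑ x ∈ g.support, ∑ y ∈ f.support, (if x ∈ bigCube D L (cell D L y) then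
      f y * (starRingEnd ℂ) (g x) * multKernel k (x - y) else 0)
    = ∑ m ∈ f.support.image (cell D L),
      pairing (multOp k (f.filter fun y => cell D L y = m)) (g.filter (· ∈ bigCube D L m)) := by
  classical
  have h1 : ∀ m, pairing (multOp k (f.filter fun y => cell D L y = m))
      (g.filter (· ∈ bigCube D L m))
      = ∑ x ∈ g.support, ∑ y ∈ f.support, if cell D L y = m then
        (if x ∈ bigCube D L (cell D L y) then
          f y * (starRingEnd ℂ) (g x) * multKernel k (x - y) else 0) else 0 := by
    intro m
    rw [pairing_multOp_eq_sum hk, Finsupp.support_filter, Finsupp.support_filter,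
      Finset.sum_filter]
    refine Finset.sum_congr rfl fun x _ => ?_
    rw [Finset.sum_filter]
    split_ifs with hx
    · refine Finset.sum_congr rfl fun y _ => ?_
      by_cases hy : cell D L y = m
      · rw [if_pos hy, if_pos hy, hy, if_pos hx, Finsupp.filter_apply_pos (fun y => cell D L y = m) _ hy,
          Finsupp.filter_apply_pos (· ∈ bigCube D L m) _ hx]
      · rw [if_neg hy, if_neg hy]
    · refine (Finset.sum_eq_zero fun y _ => ?_).symm
      by_cases hy : cell D L y = m
      · rw [if_pos hy, hy, if_neg hx]
      · rw [if_neg hy]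
  simp only [h1]
  rw [Finset.sum_comm (s := f.support.image (cell D L))]
  refine Finset.sum_congr rfl fun x _ => ?_
  rw [Finset.sum_comm (s := f.support.image (cell D L))]
  refine Finset.sum_congr rfl fun y hy => ?_
  rw [Finset.sum_ite_eq, if_pos (Finset.mem_image_of_mem _ hy)]

lemma norm_near_le {k : EuclideanSpace ℝ (Fin n) → ℂ} (hk : IntegrableOn k (cubeAt 0))
    {S : ℝ} (hS : ∀ ξ, ‖k ξ‖ ≤ S) (hD : ∀ i, 1 ≤ D i) {L : ℕ} (hL : 1 ≤ L)
    (f g : (Fin n → ℤ) →₀ ℂ) :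
    ‖∑ x ∈ g.support, ∑ y ∈ f.support, (if x ∈ bigCube D L (cell D L y) then
      f y * (starRingEnd ℂ) (g x) * multKernel k (x - y) else 0)‖
    ≤ S * ∑ m ∈ f.support.image (cell D L),
      l2On (bigCube D L m) f * l2On (bigCube D L m) g := by
  classical
  have hS0 : 0 ≤ S := (norm_nonneg _).trans (hS 0)
  rw [near_eq_sum_pairing hk, Finset.mul_sum]
  refine norm_sum_le_of_le _ fun m _ => (norm_pairing_multOp_le hk hS _ _).trans ?_
  refine mul_le_mul_of_nonneg_left ?_ hS0
  refine mul_le_mul (Real.sqrt_le_sqrt ?_) (Real.sqrt_le_sqrt ?_) (Real.sqrt_nonneg _)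
    (l2On_nonneg _ _)
  · rw [Finsupp.support_filter]
    refine le_trans (le_of_eq ?_) (Finset.sum_le_sum_of_subset_of_nonneg
      (s := f.support.filter fun y => cell D L y = m) ?_ fun _ _ _ => by positivity)
    · refine Finset.sum_congr rfl fun y hy => ?_
      rw [Finsupp.filter_apply_pos (fun y => cell D L y = m) _ (Finset.mem_filter.1 hy).2]
    · intro y hy
      rw [← (Finset.mem_filter.1 hy).2]
      exact mem_bigCube_cell hL hD fun i => by rw [sub_self, abs_zero]; positivity
  · rw [Finsupp.support_filter]
    refine le_trans (le_of_eq ?_) (Finset.sum_le_sum_of_subset_of_nonneg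
      (s := g.support.filter (· ∈ bigCube D L m)) ?_ fun _ _ _ => by positivity)
    · refine Finset.sum_congr rfl fun y hy => ?_
      rw [Finsupp.filter_apply_pos (· ∈ bigCube D L m) _ (Finset.mem_filter.1 hy).2]
    · exact fun x hx => (Finset.mem_filter.1 hx).2

/-- A point outside the neighbourhood of the cell of another point differs from it by at least the
side length in some coordinate. -/
lemma exists_le_of_notMem_bigCube {L : ℕ} (hL : 1 ≤ L) (hD : ∀ i, 1 ≤ D i) {x y : Fin n → ℤ}
    (h : x ∉ bigCube D L (cell D L y)) : ∃ i, (L : ℝ) ^ D i ≤ |(((x - y) i : ℤ) : ℝ)| := by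
  by_contra hcon
  push Not at hcon
  refine h (mem_bigCube_cell hL hD fun i => ?_)
  have := hcon i
  rw [Pi.sub_apply] at this
  exact_mod_cast this

/-- The part of the form away from the diagonal, as a superposition of correlations. -/
lemma norm_far_le {κ : (Fin n → ℤ) → ℂ} {p : (Fin n → ℤ) → (Fin n → ℤ) → Prop}
    [∀ x y, Decidable (p x y)] {β : (Fin n → ℤ) → ℝ} (hβ0 : ∀ z, 0 ≤ β z)
    (hβ : ∀ x y, ¬ p x y → ‖κ (x - y)‖ ≤ β (x - y)) (f g : (Fin n → ℤ) →₀ ℂ) :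
    ∃ F : Finset (Fin n → ℤ), ‖∑ x ∈ g.support, ∑ y ∈ f.support, (if p x y then 0 else
      f y * (starRingEnd ℂ) (g x) * κ (x - y))‖
    ≤ ∑ z ∈ F, β z * ∑ y ∈ f.support, ‖f y‖ * ‖g (y + z)‖ := by
  classical
  refine ⟨(g.support ×ˢ f.support).image fun q => q.1 - q.2, ?_⟩
  rw [Finset.sum_comm]
  simp only [Finset.mul_sum]
  rw [Finset.sum_comm (s := (g.support ×ˢ f.support).image fun q => q.1 - q.2)]
  refine norm_sum_le_of_le _ fun y hy => ?_
  have hinj : Set.InjOn (fun x => x - y) (g.support : Set (Fin n → ℤ)) :=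
    fun _ _ _ _ h => sub_left_injective h
  calc _ ≤ ∑ x ∈ g.support, β (x - y) * (‖f y‖ * ‖g (y + (x - y))‖) := by
        refine norm_sum_le_of_le _ fun x _ => ?_
        rw [add_sub_cancel]
        split_ifs with hp
        · rw [norm_zero]; exact mul_nonneg (hβ0 _) (by positivity)
        · rw [norm_mul, norm_mul, RCLike.norm_conj, mul_comm]
          exact mul_le_mul_of_nonneg_right (hβ x y hp) (by positivity)
    _ = ∑ z ∈ g.support.image (fun x => x - y), β z * (‖f y‖ * ‖g (y + z)‖) :=
        (Finset.sum_image (f := fun z => β z * (‖f y‖ * ‖g (y + z)‖)) hinj).symm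
    _ ≤ _ := by
        refine Finset.sum_le_sum_of_subset_of_nonneg ?_ fun z _ _ =>
          mul_nonneg (hβ0 _) (by positivity)
        intro z hz
        obtain ⟨x, hx, rfl⟩ := Finset.mem_image.1 hz
        exact Finset.mem_image.2 ⟨(x, y), Finset.mem_product.2 ⟨hx, hy⟩, rfl⟩

/-- A Fourier multiplier bounded by `S`, whose kernel is small and decays rapidly beyond the scale
`L`, has a sparse bound that is only slightly worse than `S`. -/
theorem enorm_pairing_multOp_le_sparseSup {Z : ℝ} (hZ0 : 0 ≤ Z)
    (hZ : ∀ F : Finset ℤ, ∑ k ∈ F, 1 / (1 + |(k : ℝ)|) ^ 2 ≤ Z)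
    (hD : ∀ i, 1 ≤ D i) {L : ℕ} (hL : 1 ≤ L) {σ : ℝ} (hσ : σ ≤ 1) {r s η : ℝ} (hr : 1 ≤ r)
    (hs : 1 ≤ s) (hrη : |1 / r - 1 / 2| < η) (hsη : |1 / s - 1 / 2| < η) (hη : η ≤ 1 / 2)
    {k : EuclideanSpace ℝ (Fin n) → ℂ} (hk : IntegrableOn k (cubeAt 0))
    {S : ℝ} (hS : ∀ ξ, ‖k ξ‖ ≤ S) {ε : ℝ} (hε : 0 ≤ ε)
    (hker : ∀ z : Fin n → ℤ, (∃ i, (L : ℝ) ^ D i ≤ |(z i : ℝ)|) →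
      ‖multKernel k z‖ ≤ ε / (1 + ∑ i, |(z i : ℝ)|) ^ (∑ i, D i + 2 * n))
    (f g : (Fin n → ℤ) →₀ ℂ) :
    ‖pairing (multOp k f) g‖ₑ ≤
      ENNReal.ofReal (S * (3 ^ (∑ i, D i) * (3 * L : ℝ) ^ ((∑ i, D i : ℕ) * (2 * η)))
        + ε * (9 ^ (∑ i, D i) * Z ^ n)) * sparseSup D σ r s f g := by
  classical
  have hS0 : 0 ≤ S := (norm_nonneg _).trans (hS 0)
  have hη0 : 0 < η := (abs_nonneg _).trans_lt hrη
  obtain ⟨N, hN⟩ : ∃ N : ℕ, N = ∑ i, D i := ⟨_, rfl⟩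
  have hw0 : ∀ z : Fin n → ℤ, 1 ≤ 1 + ∑ i, |(z i : ℝ)| := fun z => by
    have : 0 ≤ ∑ i, |(z i : ℝ)| := Finset.sum_nonneg fun _ _ => abs_nonneg _
    linarith
  have hw0' : ∀ z : Fin n → ℤ, 0 < 1 + ∑ i, |(z i : ℝ)| := fun z => by linarith [hw0 z]
  have hsplit : pairing (multOp k f) g
      = (∑ x ∈ g.support, ∑ y ∈ f.support, (if x ∈ bigCube D L (cell D L y) then
          f y * (starRingEnd ℂ) (g x) * multKernel k (x - y) else 0))
        + ∑ x ∈ g.support, ∑ y ∈ f.support, (if x ∈ bigCube D L (cell D L y) then 0 else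
          f y * (starRingEnd ℂ) (g x) * multKernel k (x - y)) := by
    rw [pairing_multOp_eq_sum hk, ← Finset.sum_add_distrib]
    refine Finset.sum_congr rfl fun x _ => ?_
    rw [← Finset.sum_add_distrib]
    refine Finset.sum_congr rfl fun y _ => ?_
    split_ifs <;> simp
  obtain ⟨F, hF⟩ := norm_far_le (κ := multKernel k)
    (p := fun x y => x ∈ bigCube D L (cell D L y))
    (β := fun z => ε / (1 + ∑ i, |(z i : ℝ)|) ^ (N + 2 * n))
    (fun z => div_nonneg hε (pow_pos (hw0' z) _).le)
    (fun x y h => by rw [hN]; exact hker _ (exists_le_of_notMem_bigCube hL hD h)) f g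
  have hnear : ENNReal.ofReal (S * ∑ m ∈ f.support.image (cell D L),
      l2On (bigCube D L m) f * l2On (bigCube D L m) g)
      ≤ ENNReal.ofReal (S * (3 ^ N * (3 * L : ℝ) ^ ((N : ℕ) * (2 * η))))
        * sparseSup D σ r s f g := by
    rw [ENNReal.ofReal_mul hS0, ENNReal.ofReal_mul hS0, mul_assoc, hN]
    exact mul_le_mul_right (sum_l2On_le_sparseSup hL hσ hr hs hrη hsη f g _) _
  have hfar : ENNReal.ofReal (∑ z ∈ F, ε / (1 + ∑ i, |(z i : ℝ)|) ^ (N + 2 * n)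
        * ∑ y ∈ f.support, ‖f y‖ * ‖g (y + z)‖)
      ≤ ENNReal.ofReal (ε * (9 ^ N * Z ^ n)) * sparseSup D σ r s f g := by
    have hone : ∀ z : Fin n → ℤ,
        ENNReal.ofReal (ε / (1 + ∑ i, |(z i : ℝ)|) ^ (N + 2 * n)
          * ∑ y ∈ f.support, ‖f y‖ * ‖g (y + z)‖)
        ≤ ENNReal.ofReal (ε * 9 ^ N * (1 / (1 + ∑ i, |(z i : ℝ)|) ^ (2 * n)))
          * sparseSup D σ r s f g := by
      intro z
      -- the scale of the cubes that capture the shift by `z`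
      obtain ⟨w, hw⟩ : ∃ w : ℕ, w = 1 + ∑ i, (z i).natAbs := ⟨_, rfl⟩
      have hwr : (w : ℝ) = 1 + ∑ i, |(z i : ℝ)| := by
        rw [hw]; push_cast; simp [Nat.cast_natAbs]
      have hw1 : 1 ≤ w := by omega
      have hw1r : (1 : ℝ) ≤ w := by exact_mod_cast hw1
      have hzw : ∀ i, |z i| < (w : ℤ) ^ D i := by
        intro i
        have h1 : (z i).natAbs ≤ ∑ i, (z i).natAbs :=
          Finset.single_le_sum (f := fun i => (z i).natAbs) (fun _ _ => Nat.zero_le _)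
            (Finset.mem_univ i)
        have h2 : (w : ℤ) ≤ (w : ℤ) ^ D i :=
          le_self_pow₀ (by exact_mod_cast hw1) (by have := hD i; omega)
        have h3 : |z i| = ((z i).natAbs : ℤ) := Int.abs_eq_natAbs _
        omega
      have h1 := (ENNReal.ofReal_le_ofReal (sum_mul_shift_le hw1 hD hzw f g)).trans
        (sum_l2On_le_sparseSup (σ := σ) hw1 hσ hr hs hrη hsη f g _)
      have h2 : 3 ^ N * (3 * w : ℝ) ^ ((N : ℕ) * (2 * η)) ≤ 9 ^ N * (w : ℝ) ^ N := by
        have h3 : (3 * w : ℝ) ^ ((N : ℕ) * (2 * η)) ≤ (3 * w : ℝ) ^ N := by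
          rw [← Real.rpow_natCast]
          refine Real.rpow_le_rpow_of_exponent_le (by linarith) ?_
          exact mul_le_of_le_one_right (Nat.cast_nonneg N) (by linarith)
        calc 3 ^ N * (3 * w : ℝ) ^ ((N : ℕ) * (2 * η)) ≤ 3 ^ N * (3 * w : ℝ) ^ N := by gcongr
          _ = 9 ^ N * (w : ℝ) ^ N := by
            rw [mul_pow, ← mul_assoc, ← mul_pow]; norm_num
      rw [← hN] at h1
      have h4 := h1.trans (mul_le_mul_left (ENNReal.ofReal_le_ofReal h2) (sparseSup D σ r s f g))
      have hβ0 : 0 ≤ ε / (1 + ∑ i, |(z i : ℝ)|) ^ (N + 2 * n) :=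
        div_nonneg hε (pow_pos (hw0' z) _).le
      rw [ENNReal.ofReal_mul hβ0]
      refine (mul_le_mul_right h4 _).trans (le_of_eq ?_)
      rw [← mul_assoc, ← ENNReal.ofReal_mul hβ0]
      congr 2
      rw [hwr, pow_add]
      have := (hw0' z).ne'
      field_simp
    rw [ENNReal.ofReal_sum_of_nonneg fun z _ => mul_nonneg
      (div_nonneg hε (pow_pos (hw0' z) _).le) (Finset.sum_nonneg fun _ _ => by positivity)]
    refine (Finset.sum_le_sum fun z _ => hone z).trans ?_
    rw [← Finset.sum_mul, ← ENNReal.ofReal_sum_of_nonneg fun z _ => mul_nonneg (by positivity)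
      (one_div_nonneg.2 (pow_pos (hw0' z) _).le), ← Finset.mul_sum]
    refine mul_le_mul_left (ENNReal.ofReal_le_ofReal ?_) _
    rw [← mul_assoc]
    exact mul_le_mul_of_nonneg_left (sum_one_div_pow_le hZ F) (by positivity)
  rw [← hN, ENNReal.ofReal_add (by positivity) (by positivity), add_mul]
  rw [← ofReal_norm, hsplit]
  refine (ENNReal.ofReal_le_ofReal (norm_add_le _ _)).trans ?_
  rw [ENNReal.ofReal_add (norm_nonneg _) (norm_nonneg _)]
  exact add_le_add ((ENNReal.ofReal_le_ofReal (norm_near_le hk hS hD hL f g)).trans hnear)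
    ((ENNReal.ofReal_le_ofReal hF).trans hfar)

end NearFar

/-! ### The sparse norm of the error operator -/

/-- The loss in the sparse bound at scale `L₀ 2 ^ j` is at most half of the gain `2 ^ (-γ j)`. -/
lemma scale_rpow_le {γ η : ℝ} (hη : η ≤ 1 / 2) {N L₀ : ℕ} (hL₀ : 1 ≤ L₀)
    (hNη : (N : ℝ) * (2 * η) ≤ γ / 2) (j : ℕ) :
    (3 * ((L₀ * 2 ^ j : ℕ) : ℝ)) ^ ((N : ℝ) * (2 * η))
      ≤ (3 * L₀ : ℝ) ^ N * (2 : ℝ) ^ (γ / 2 * j) := by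
  have hL₀r : (1 : ℝ) ≤ L₀ := by exact_mod_cast hL₀
  have h1 : (3 * ((L₀ * 2 ^ j : ℕ) : ℝ)) = 3 * L₀ * 2 ^ j := by push_cast; ring
  rw [h1, Real.mul_rpow (by positivity) (by positivity)]
  refine mul_le_mul ?_ ?_ (by positivity) (by positivity)
  · rw [← Real.rpow_natCast (3 * L₀ : ℝ) N]
    refine Real.rpow_le_rpow_of_exponent_le (by linarith) ?_
    exact mul_le_of_le_one_right (Nat.cast_nonneg N) (by linarith)
  · rw [← Real.rpow_natCast 2 j, ← Real.rpow_mul (by norm_num), mul_comm (γ / 2)]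
    refine Real.rpow_le_rpow_of_exponent_le (by norm_num) ?_
    exact mul_le_mul_of_nonneg_left hNη (Nat.cast_nonneg j)

end DiscreteRadon

theorem proposition3p3 {d n : ℕ} (P : Fin n → MvPolynomial (Fin d) ℤ)
    (hP : DiscreteRadon.IsAdmissible P)
    (δ₁ : ℝ) (hδ₁_pos : 0 < δ₁) (hδ₁_lt : δ₁ < 1 / 1000) :
    ∃ η : ℝ, 0 < η ∧
      ∀ r s : ℝ, 1 ≤ r → 1 ≤ s → |1 / r - 1 / 2| < η → |1 / s - 1 / 2| < η →
        ∃ γ : ℝ, 0 < γ ∧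
          ∀ σ : ℝ, 0 < σ → σ < 1 →
          ∀ ψ : EuclideanSpace ℝ (Fin d) → ℝ, DiscreteRadon.IsDyadicPartition ψ →
          ∀ χ : EuclideanSpace ℝ (Fin n) → ℂ, DiscreteRadon.IsCutoff χ →
            ∃ C : ℝ, 0 < C ∧
              ∀ K : EuclideanSpace ℝ (Fin d) → ℂ, DiscreteRadon.IsCZKernel K →
              ∀ j : ℕ, 1 ≤ j →
                DiscreteRadon.spNorm (DiscreteRadon.degs P) σ r s
                    (DiscreteRadon.multOp (DiscreteRadon.EMult P δ₁ ψ χ K j))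
                  ≤ ENNReal.ofReal (C * (2 : ℝ) ^ (-γ * (j : ℝ))) := by
  obtain ⟨γ₀, hγ₀, hE⟩ := DiscreteRadon.exists_norm_EMult_le hP hδ₁_pos hδ₁_lt
  obtain ⟨L₀, hL₀, hdecay⟩ :=
    DiscreteRadon.exists_multKernel_EMult_decay hP hδ₁_pos hδ₁_lt
  obtain ⟨Z, hZ0, hZ⟩ := DiscreteRadon.exists_sum_inv_sq_le
  obtain ⟨N, hN⟩ : ∃ N : ℕ, N = ∑ i, DiscreteRadon.degs P i := ⟨_, rfl⟩
  -- For this `η` the passage from `L²` averages to `L^r` and `L^s` averages over cubes of scale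
  -- `L₀ 2 ^ j` loses at most `2 ^ (γ₀ j / 2)`, half of the gain in the bound of the multiplier.
  refine ⟨min (1 / 2) (γ₀ / (4 * (N + 1))), by positivity, fun r s hr hs hrη hsη => ?_⟩
  obtain ⟨η, hη⟩ : ∃ η : ℝ, η = min (1 / 2) (γ₀ / (4 * (N + 1))) := ⟨_, rfl⟩
  rw [← hη] at hrη hsη
  have hη0 : 0 ≤ η := by rw [hη]; positivity
  have hη1 : η ≤ 1 / 2 := by rw [hη]; exact min_le_left _ _
  have hNη : (N : ℝ) * (2 * η) ≤ γ₀ / 2 := by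
    have h1 : η ≤ γ₀ / (4 * (N + 1)) := by rw [hη]; exact min_le_right _ _
    rw [le_div_iff₀ (by positivity)] at h1
    linarith
  obtain ⟨γ, hγ0, hγγ₀, hγ1⟩ : ∃ γ : ℝ, 0 < γ ∧ γ ≤ γ₀ / 2 ∧ γ ≤ 1 :=
    ⟨min (γ₀ / 2) 1, by positivity, min_le_left _ _, min_le_right _ _⟩
  refine ⟨γ, hγ0, fun σ _ hσ ψ hψ χ hχ => ?_⟩
  obtain ⟨C₁, hC₁, hC₁E⟩ := hE ψ hψ χ hχ
  obtain ⟨C₂, hC₂, hC₂E⟩ := hdecay (N + 2 * n) ψ hψ χ hχ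
  obtain ⟨B, -, hB⟩ := DiscreteRadon.exists_Kpiece_bounds hψ
  refine ⟨C₁ * (3 ^ N * (3 * L₀) ^ N) + C₂ * (9 ^ N * Z ^ n), by positivity,
    fun K hK j hj => ?_⟩
  refine sInf_le ⟨?_, ENNReal.ofReal_ne_top, fun f g => ?_⟩
  · rw [← pos_iff_ne_zero, ENNReal.ofReal_pos]
    positivity
  have hj0 : (0 : ℝ) ≤ j := Nat.cast_nonneg j
  have hmain := DiscreteRadon.enorm_pairing_multOp_le_sparseSup (D := DiscreteRadon.degs P)
    hZ0 hZ hP.one_le_degs (L := L₀ * 2 ^ j) (Nat.mul_pos hL₀ (by positivity)) hσ.le hr hs hrη hsη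
    hη1 (DiscreteRadon.integrableOn_EMult hψ hχ (hB K hK j hj).2.2 δ₁) (hC₁E K hK j hj)
    (ε := C₂ / 2 ^ j) (by positivity)
    (fun z hz => (hC₂E K hK j hj z hz).trans (le_of_eq (by rw [hN, div_div]))) f g
  refine hmain.trans (mul_le_mul_left (ENNReal.ofReal_le_ofReal ?_) _)
  rw [← hN, add_mul]
  refine add_le_add ?_ ?_
  · have h1 := DiscreteRadon.scale_rpow_le hη1 hL₀ hNη j
    have h2 : (2 : ℝ) ^ (-γ₀ * (j : ℝ)) * (2 : ℝ) ^ (γ₀ / 2 * j) ≤ (2 : ℝ) ^ (-γ * (j : ℝ)) := by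
      rw [← Real.rpow_add (by norm_num)]
      refine Real.rpow_le_rpow_of_exponent_le (by norm_num) ?_
      have := mul_le_mul_of_nonneg_right hγγ₀ hj0
      linarith
    calc C₁ * (2 : ℝ) ^ (-γ₀ * (j : ℝ)) *
          (3 ^ N * (3 * ((L₀ * 2 ^ j : ℕ) : ℝ)) ^ ((N : ℝ) * (2 * η)))
        ≤ C₁ * (2 : ℝ) ^ (-γ₀ * (j : ℝ)) *
          (3 ^ N * ((3 * L₀ : ℝ) ^ N * (2 : ℝ) ^ (γ₀ / 2 * j))) := by gcongr
      _ = C₁ * (3 ^ N * (3 * L₀) ^ N)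
          * ((2 : ℝ) ^ (-γ₀ * (j : ℝ)) * (2 : ℝ) ^ (γ₀ / 2 * j)) := by ring
      _ ≤ _ := by gcongr
  · have h3 : ((2 : ℝ) ^ j)⁻¹ ≤ (2 : ℝ) ^ (-γ * (j : ℝ)) := by
      rw [← Real.rpow_natCast, ← Real.rpow_neg (by norm_num)]
      refine Real.rpow_le_rpow_of_exponent_le (by norm_num) ?_
      have := mul_le_mul_of_nonneg_right hγ1 hj0
      linarith
    calc C₂ / 2 ^ j * (9 ^ N * Z ^ n) = C₂ * (9 ^ N * Z ^ n) * ((2 : ℝ) ^ j)⁻¹ := by ring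
      _ ≤ _ := by gcongr
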